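/- Let $M$ be a matroid of rank $r$ on a finite ground set $S$, $|S|=n$. Let $P(M)\subseteq\mathbb R^S$ be the convex hull of the characteristic vectors of its bases, and let $D(M)=\Delta\cap\operatorname{aff}P(M)$, where $\Delta=\{x\in[0,1]^S:\sum_{s\in S}x_s=r\}$. A split flacet of $M$ is a flat $F$ such that $P(M)\cap\{x:\sum_{s\in F}x_s=r_M(F)\}$ is a facet of $P(M)$ and the hyperplane $\{x:\sum_{s\in F}x_s=r_M(F)\}$ meets the relative interior of $D(M)$. The matroid $M$ is a split matroid if, for any two split flacets that define different facets of $P(M)$, the two hyperplanes do not meet in the relative interior of $D(M)$. Two ordered pairs of bases $(A_1,A_2)$ and $(B_1,B_2)$ of $M$ are compatible if $A_1\cap A_2=B_1\cap B_2$ and $A_1\cup A_2=B_1\cup B_2$. A symmetric exchange replaces a pair $(A_1,A_2)$ of bases by $(A_1-e+f,\,A_2+e-f)$, where $e\in A_1-A_2$, $f\in A_2-A_1$ and both new sets are bases. A sequence of symmetric exchanges starting from $(A_1,A_2)$ is strictly monotone for $(A_1,A_2)$ and $(B_1,B_2)$ if each step decreases $|X_1-B_1|$, where $X_1$ is the first member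 of the current pair; it need not reach $(B_1,B_2)$. **Theorem.** There are a single deterministic algorithm, which accesses the matroid only through an independence oracle, and a polynomial $p$ such that the following holds. For every $n$, every split matroid $M$ on a ground set of $n$ elements, and all compatible pairs $(A_1,A_2)$ and $(B_1,B_2)$ of bases of $M$, the algorithm, given $n$ and the four bases, outputs a strictly monotone sequence of symmetric exchanges for $(A_1,A_2)$ and $(B_1,B_2)$ that is longest among all such sequences, using at most $p(n)$ oracle calls and at most $p(n)$ elementary steps (on a random access machine with addition and truncated subtraction of natural numbers as its only arithmetic, each at unit cost). -/

import Mathlib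

noncomputable section

namespace SplitExchange

/-! ### Split matroids, through the matroid base polytope -/

section Polytope

variable {α : Type*} [Fintype α]

/-- The base polytope of `M`: the convex hull of the characteristic vectors of its bases. -/
def basePolytope (M : Matroid α) : Set (α → ℝ) :=
  convexHull ℝ {x | ∃ B : Set α, M.IsBase B ∧ x = B.indicator 1}

/-- The hypersimplex of all vectors of `[0,1]^α` with coordinate sum `r`; it is the base polytope
of the uniform matroid of rank `r`. -/
def hypersimplex (α : Type*) [Fintype α] (r : ℕ) : Set (α → ℝ) :=
  {x | (∀ i, 0 ≤ x i ∧ x i ≤ 1) ∧ ∑ i, x i = r}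

/-- The hypersimplex containing the base polytope, intersected with the affine hull of the base
polytope. For a connected matroid this is the whole hypersimplex; in general it is the product of
the hypersimplices of the connected components. -/
def ambientPolytope (M : Matroid α) : Set (α → ℝ) :=
  hypersimplex α M.eRank.toNat ∩ (affineSpan ℝ (basePolytope M) : Set (α → ℝ))

open Classical in
/-- The hyperplane `x(F) = r_M(F)` of a set `F`. -/
def rankHyperplane (M : Matroid α) (F : Set α) : Set (α → ℝ) :=
  {x | ∑ i, (if i ∈ F then x i else 0) = ((M.eRk F).toNat : ℝ)}

/-- The face of the base polytope on which the valid inequality `x(F) ≤ r_M(F)` is tight. -/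
def rankFace (M : Matroid α) (F : Set α) : Set (α → ℝ) :=
  basePolytope M ∩ rankHyperplane M F

/-- A flacet of `M`: a flat whose face of the base polytope is a facet, that is, a nonempty face of
codimension one. -/
def IsFlacet (M : Matroid α) (F : Set α) : Prop :=
  M.IsFlat F ∧ (rankFace M F).Nonempty ∧
    Module.finrank ℝ (vectorSpan ℝ (rankFace M F)) + 1 =
      Module.finrank ℝ (vectorSpan ℝ (basePolytope M))

/-- A split flacet of `M`: a flacet whose hyperplane splits the ambient polytope, that is, meets its
relative interior. (The other requirement on the hyperplane of a split, that it cuts no edge of the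
polytope in its relative interior, holds automatically: `x(F)` is integral at the vertices, and it
changes by at most one along an edge.) -/
def IsSplitFlacet (M : Matroid α) (F : Set α) : Prop :=
  IsFlacet M F ∧ (rankHyperplane M F ∩ intrinsicInterior ℝ (ambientPolytope M)).Nonempty

/-- A matroid on the finite ground set `α` is split if its split flacets form a compatible system of
splits of the ambient polytope: the hyperplanes of two different splits do not meet in its
relative interior. (Two split flacets that cut out the same facet give the same split.) -/
def IsSplit (M : Matroid α) : Prop :=
  ∀ F G : Set α, IsSplitFlacet M F → IsSplitFlacet M G → rankFace M F ≠ rankFace M G →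
    rankHyperplane M F ∩ rankHyperplane M G ∩ intrinsicInterior ℝ (ambientPolytope M) = ∅

end Polytope

/-! ### Basis pairs and symmetric exchanges -/

section Exchange

variable {α : Type*}

/-- An ordered pair of bases. -/
def IsBasisPair (M : Matroid α) (P : Set α × Set α) : Prop :=
  M.IsBase P.1 ∧ M.IsBase P.2

/-- Compatibility of two pairs of sets. -/
def Compatible (P Q : Set α × Set α) : Prop :=
  P.1 ∩ P.2 = Q.1 ∩ Q.2 ∧ P.1 ∪ P.2 = Q.1 ∪ Q.2

/-- The pair `(P₁ - e + f, P₂ + e - f)`, where `s = (e, f)`. -/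
def swap (P : Set α × Set α) (s : α × α) : Set α × Set α :=
  (insert s.2 (P.1 \ {s.1}), insert s.1 (P.2 \ {s.2}))

/-- The elements `s = (e, f)` define a symmetric exchange for the pair `P`. -/
def IsSymmetricExchange (M : Matroid α) (P : Set α × Set α) (s : α × α) : Prop :=
  s.1 ∈ P.1 \ P.2 ∧ s.2 ∈ P.2 \ P.1 ∧ IsBasisPair M (swap P s)

/-- Performed one after the other from `A` on, the exchanges in the list form a sequence of symmetric
exchanges that is strictly monotone for `A` and `B`: each step decreases the difference between
the first members of the current pair and of `B`. -/
def IsStrictlyMonotone (M : Matroid α) (B : Set α × Set α) :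
    Set α × Set α → List (α × α) → Prop
  | _, [] => True
  | A, s :: l => IsSymmetricExchange M A s ∧
      ((swap A s).1 \ B.1).ncard < (A.1 \ B.1).ncard ∧ IsStrictlyMonotone M B (swap A s) l

/-- The list is a strictly monotone sequence of symmetric exchanges for `A` and `B` of largest
possible length. -/
def IsLongestStrictlyMonotone (M : Matroid α) (A B : Set α × Set α) (l : List (α × α)) : Prop :=
  IsStrictlyMonotone M B A l ∧ ∀ l', IsStrictlyMonotone M B A l' → l'.length ≤ l.length

end Exchange

/-! ### Oracle programs with step counts

A random access machine with registers and arrays holding natural numbers, with addition and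
truncated subtraction as its only arithmetic, and with an independence oracle. -/

/-- Contents of the memory, number of oracle calls and number of steps so far. -/
structure Config where
  reg : ℕ → ℕ
  arr : ℕ → ℕ → ℕ
  calls : ℕ
  steps : ℕ

/-- Arithmetic expressions over registers and array cells. -/
inductive Expr where
  | const (k : ℕ)
  | var (v : ℕ)
  | get (a : ℕ) (i : Expr)
  | add (e f : Expr)
  | sub (e f : Expr)

/-- The value of an expression. -/
def Expr.value (s : Config) : Expr → ℕ
  | .const k => k
  | .var v => s.reg v
  | .get a i => s.arr a (i.value s)
  | .add e f => e.value s + f.value s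
  | .sub e f => e.value s - f.value s

/-- The number of elementary operations in the evaluation of an expression. -/
def Expr.cost : Expr → ℕ
  | .const _ => 1
  | .var _ => 1
  | .get _ i => i.cost + 1
  | .add e f => e.cost + f.cost + 1
  | .sub e f => e.cost + f.cost + 1

/-- Programs. -/
inductive Program where
  /-- do nothing -/
  | skip
  /-- write the value of `e` into the register `v` -/
  | assign (v : ℕ) (e : Expr)
  /-- write the value of `e` into cell `i` of the array `a` -/
  | store (a : ℕ) (i e : Expr)
  /-- ask the oracle whether the set whose characteristic vector is in array `a` is independent;
  write `1` (yes) or `0` (no) into the register `v` -/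
  | query (v a : ℕ)
  /-- first `c`, then `d` -/
  | seq (c d : Program)
  /-- `c` if the value of `e` is not `0`, else `d` -/
  | ite (e : Expr) (c d : Program)
  /-- for `k = 0, …, m - 1`, where `m` is the value of `e` at the beginning: write `k` into the
  register `v` and run `c` -/
  | loop (v : ℕ) (e : Expr) (c : Program)

/-- Let `k` steps pass. -/
def Config.tick (s : Config) (k : ℕ) : Config := { s with steps := s.steps + k }

/-- Write `x` into register `v`. -/
def Config.setReg (s : Config) (v x : ℕ) : Config :=
  { s with reg := Function.update s.reg v x }

/-- Write `x` into cell `i` of array `a`. -/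
def Config.setArr (s : Config) (a i x : ℕ) : Config :=
  { s with arr := Function.update s.arr a (Function.update (s.arr a) i x) }

/-- The subset of the ground set `{0, …, n - 1}` whose characteristic vector is in array `a`. -/
def Config.readSet (s : Config) (n a : ℕ) : Set (Fin n) := {i | s.arr a i ≠ 0}

open Classical in
/-- The run of a program on a ground set of size `n`. The matroid is accessible to the program only
through the oracle `indep`. Every command costs one step, plus the cost of the expressions that it
evaluates, and every round of a loop costs one step besides those of its body. -/
def Program.exec {n : ℕ} (indep : Set (Fin n) → Prop) : Program → Config → Config
  | .skip, s => s.tick 1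
  | .assign v e, s => (s.setReg v (e.value s)).tick (e.cost + 1)
  | .store a i e, s => (s.setArr a (i.value s) (e.value s)).tick (i.cost + e.cost + 1)
  | .query v a, s =>
      { (s.setReg v (if indep (s.readSet n a) then 1 else 0)).tick 1 with calls := s.calls + 1 }
  | .seq c d, s => d.exec indep ((c.exec indep s).tick 1)
  | .ite e c d, s =>
      if e.value s ≠ 0 then c.exec indep (s.tick (e.cost + 1))
      else d.exec indep (s.tick (e.cost + 1))
  | .loop v e c, s =>
      (List.range (e.value s)).foldl (fun t k => c.exec indep ((t.setReg v k).tick 1))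
        (s.tick (e.cost + 1))

open Classical in
/-- The characteristic vector of a set of natural numbers below `n`. -/
def charVec {n : ℕ} (X : Set (Fin n)) (i : ℕ) : ℕ :=
  if ∃ h : i < n, (⟨i, h⟩ : Fin n) ∈ X then 1 else 0

/-- The initial configuration: register `0` holds the size of the ground set, arrays `0`, `1`, `2`,
`3` hold the characteristic vectors of `A₁`, `A₂`, `B₁`, `B₂`, and everything else is `0`. -/
def startConfig {n : ℕ} (A B : Set (Fin n) × Set (Fin n)) : Config where
  reg := fun v => if v = 0 then n else 0
  arr := fun a =>
    if a = 0 then charVec A.1 else if a = 1 then charVec A.2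
    else if a = 2 then charVec B.1 else if a = 3 then charVec B.2 else fun _ => 0
  calls := 0
  steps := 0

/-- The output convention: the list `(x₁, y₁), …, (xₗ, yₗ)` is given by its length `l` in register
`1`, the `xᵢ` in array `4` and the `yᵢ` in array `5`. -/
def Config.Outputs {n : ℕ} (s : Config) (l : List (Fin n × Fin n)) : Prop :=
  s.reg 1 = l.length ∧
    ∀ (i : ℕ) (h : i < l.length), s.arr 4 i = (l[i].1 : ℕ) ∧ s.arr 5 i = (l[i].2 : ℕ)

end SplitExchange

end

/-!
The bases of a split matroid are governed by the cuts of a single connected component: every cut has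
a nonnegative slack at every base, an exchange is possible unless it violates a cut of slack `0`,
and two different cuts cannot both have small slack. Let `P` be the set of the elements that the
first base still has to lose, and `Q` the set of those that it has to gain. An obstruction consists
of two cuts of slack `0` for each of the two bases, such that either pair of cuts partitions
`P ∪ Q`, and such that `P` and `Q` have different numbers of elements, say with difference `d`, in
the cells of the common refinement. Exchanges do not leave their cell, so an obstruction persists
and `2 * d` exchanges can never be made; all the others are made by every sequence that goes on as
long as possible. If there is no obstruction and `P` is nonempty, then some exchange creates none.

Hence it suffices to avoid obstructions greedily. The cuts need not be known for that: an
obstruction is recognized from the exchanges that are possible between four elements and the rest of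
`P` and `Q`, and an independence oracle reveals these.
-/

namespace SplitExchange

/-! ### Terms and their compilation -/

section Machine

/-- The value of an expression in a given memory, without the step and call counters. -/
def Expr.eval (e : Expr) (reg : ℕ → ℕ) (arr : ℕ → ℕ → ℕ) : ℕ := e.value ⟨reg, arr, 0, 0⟩

lemma Expr.value_eq_eval (e : Expr) (s : Config) : e.value s = e.eval s.reg s.arr := by
  induction e with
  | const k => rfl
  | var v => rfl
  | get a i ih => simp only [Expr.value, Expr.eval, ih]
  | add e f ihe ihf => simp only [Expr.value, Expr.eval, ihe, ihf]
  | sub e f ihe ihf => simp only [Expr.value, Expr.eval, ihe, ihf]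

@[simp] lemma Expr.eval_const (k : ℕ) (reg arr) : (Expr.const k).eval reg arr = k := rfl

@[simp] lemma Expr.eval_var (v : ℕ) (reg arr) : (Expr.var v).eval reg arr = reg v := rfl

@[simp] lemma Expr.eval_get (a : ℕ) (i : Expr) (reg arr) :
    (Expr.get a i).eval reg arr = arr a (i.eval reg arr) := rfl

@[simp] lemma Expr.eval_add (e f : Expr) (reg arr) :
    (Expr.add e f).eval reg arr = e.eval reg arr + f.eval reg arr := rfl

@[simp] lemma Expr.eval_sub (e f : Expr) (reg arr) :
    (Expr.sub e f).eval reg arr = e.eval reg arr - f.eval reg arr := rfl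

/-- A strict upper bound on the registers read by an expression. -/
def Expr.bound : Expr → ℕ
  | .const _ => 0
  | .var v => v + 1
  | .get _ i => i.bound
  | .add e f => max e.bound f.bound
  | .sub e f => max e.bound f.bound

lemma Expr.dependsOn_eval (e : Expr) {d : ℕ} (hd : e.bound ≤ d) :
    DependsOn e.eval (Set.Iio d) := by
  intro reg reg' h
  ext arr
  induction e with
  | const k => rfl
  | var v => exact h v hd
  | get a i ih => simp only [Expr.eval_get, ih hd]
  | add e f ihe ihf =>
    obtain ⟨he, hf⟩ := max_le_iff.1 hd
    simp only [Expr.eval_add, ihe he, ihf hf]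
  | sub e f ihe ihf =>
    obtain ⟨he, hf⟩ := max_le_iff.1 hd
    simp only [Expr.eval_sub, ihe he, ihf hf]

/-- Terms are the specification language of the algorithm: expressions, oracle answers, and sums
over the ground set. They are free of side effects and compile to programs by `Term.compile`. -/
inductive Term where
  | expr (e : Expr)
  /-- the oracle answer for the set in an array -/
  | query (a : ℕ)
  | add (t u : Term)
  | sub (t u : Term)
  | ite (c t u : Term)
  /-- the sum over all values below `n` of a register -/
  | sum (v : ℕ) (t : Term)
  /-- the value after an array cell has been overwritten -/
  | update (a : ℕ) (i e : Expr) (t : Term)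

open Classical in
/-- The value of a term; sums range up to the value of register `0`, the size of the ground set. -/
noncomputable def Term.den {n : ℕ} (indep : Set (Fin n) → Prop) : Term → (ℕ → ℕ) → (ℕ → ℕ → ℕ) → ℕ
  | .expr e, reg, arr => e.eval reg arr
  | .query a, _, arr => if indep {i | arr a i ≠ 0} then 1 else 0
  | .add t u, reg, arr => t.den indep reg arr + u.den indep reg arr
  | .sub t u, reg, arr => t.den indep reg arr - u.den indep reg arr
  | .ite c t u, reg, arr => if c.den indep reg arr ≠ 0 then t.den indep reg arr
      else u.den indep reg arr
  | .sum v t, reg, arr => ∑ k ∈ Finset.range (reg 0), t.den indep (Function.update reg v k) arr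
  | .update a i e t, reg, arr => t.den indep reg
      (Function.update arr a (Function.update (arr a) (i.eval reg arr) (e.eval reg arr)))

/-- A strict upper bound on the registers that occur in a term. -/
def Term.bound : Term → ℕ
  | .expr e => e.bound
  | .query _ => 0
  | .add t u => max t.bound u.bound
  | .sub t u => max t.bound u.bound
  | .ite c t u => max c.bound (max t.bound u.bound)
  | .sum v t => max (max 1 (v + 1)) t.bound
  | .update _ i e t => max (max i.bound e.bound) t.bound

lemma Term.dependsOn_den {n : ℕ} (indep : Set (Fin n) → Prop) (t : Term) {d : ℕ}
    (hd : t.bound ≤ d) : DependsOn (t.den indep) (Set.Iio d) := by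
  intro reg reg' h
  ext arr
  induction t generalizing reg reg' arr with
  | expr e => exact congrFun (e.dependsOn_eval hd h) arr
  | query a => rfl
  | add t u iht ihu =>
    obtain ⟨ht, hu⟩ := max_le_iff.1 hd
    simp only [Term.den, iht ht h, ihu hu h]
  | sub t u iht ihu =>
    obtain ⟨ht, hu⟩ := max_le_iff.1 hd
    simp only [Term.den, iht ht h, ihu hu h]
  | ite c t u ihc iht ihu =>
    obtain ⟨hc, htu⟩ := max_le_iff.1 hd
    obtain ⟨ht, hu⟩ := max_le_iff.1 htu
    simp only [Term.den, ihc hc h, iht ht h, ihu hu h]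
  | sum w t ih =>
    obtain ⟨h0w, ht⟩ := max_le_iff.1 hd
    simp only [Term.den]
    rw [h 0 (max_le_iff.1 h0w).1]
    refine Finset.sum_congr rfl fun k _ => ih ht (fun v hv => ?_) arr
    simp only [Function.update_apply, h v hv]
  | update a i e t ih =>
    obtain ⟨hie, ht⟩ := max_le_iff.1 hd
    obtain ⟨hi, he⟩ := max_le_iff.1 hie
    simp only [Term.den, i.dependsOn_eval hi h, e.dependsOn_eval he h, ih ht h]

/-- A program that writes the value of a term into register `d`, using only registers from `d` on
as scratch space; the registers bound by sums and the array cells that are overwritten get their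
old values back. -/
def Term.compile : Term → ℕ → Program
  | .expr e, d => .assign d e
  | .query a, d => .query d a
  | .add t u, d => .seq (t.compile d) (.seq (u.compile (d + 1))
      (.assign d (.add (.var d) (.var (d + 1)))))
  | .sub t u, d => .seq (t.compile d) (.seq (u.compile (d + 1))
      (.assign d (.sub (.var d) (.var (d + 1)))))
  | .ite c t u, d => .seq (c.compile d) (.ite (.var d) (t.compile d) (u.compile d))
  | .sum v t, d => .seq (.assign (d + 1) (.var v)) (.seq (.assign d (.const 0))
      (.seq (.loop v (.var 0) (.seq (t.compile (d + 2))
        (.assign d (.add (.var d) (.var (d + 2)))))) (.assign v (.var (d + 1)))))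
  | .update a i e t, d => .seq (.assign (d + 1) (.get a i)) (.seq (.assign (d + 2) i)
      (.seq (.store a i e) (.seq (t.compile (d + 3))
        (.seq (.assign d (.var (d + 3))) (.store a (.var (d + 2)) (.var (d + 1)))))))

variable {n : ℕ} (indep : Set (Fin n) → Prop)

@[simp] lemma tick_reg (s : Config) (k : ℕ) : (s.tick k).reg = s.reg := rfl

@[simp] lemma tick_arr (s : Config) (k : ℕ) : (s.tick k).arr = s.arr := rfl

@[simp] lemma setReg_reg (s : Config) (v x : ℕ) :
    (s.setReg v x).reg = Function.update s.reg v x := rfl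

@[simp] lemma setReg_arr (s : Config) (v x : ℕ) : (s.setReg v x).arr = s.arr := rfl

@[simp] lemma exec_seq (c d : Program) (s : Config) :
    (Program.seq c d).exec indep s = d.exec indep ((c.exec indep s).tick 1) := rfl

@[simp] lemma exec_assign_reg (v : ℕ) (e : Expr) (s : Config) :
    ((Program.assign v e).exec indep s).reg = Function.update s.reg v (e.eval s.reg s.arr) := by
  rw [← Expr.value_eq_eval]; rfl

@[simp] lemma exec_assign_arr (v : ℕ) (e : Expr) (s : Config) :
    ((Program.assign v e).exec indep s).arr = s.arr := rfl

@[simp] lemma exec_store_reg (a : ℕ) (i e : Expr) (s : Config) :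
    ((Program.store a i e).exec indep s).reg = s.reg := rfl

@[simp] lemma exec_store_arr (a : ℕ) (i e : Expr) (s : Config) :
    ((Program.store a i e).exec indep s).arr = Function.update s.arr a
      (Function.update (s.arr a) (i.eval s.reg s.arr) (e.eval s.reg s.arr)) := by
  simp only [← Expr.value_eq_eval]; rfl

open Classical in
@[simp] lemma exec_query_reg (v a : ℕ) (s : Config) :
    ((Program.query v a).exec indep s).reg =
      Function.update s.reg v (if indep {i | s.arr a i ≠ 0} then 1 else 0) := rfl

lemma exec_ite (e : Expr) (c d : Program) (s : Config) :
    (Program.ite e c d).exec indep s = if e.eval s.reg s.arr ≠ 0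
      then c.exec indep (s.tick (e.cost + 1)) else d.exec indep (s.tick (e.cost + 1)) := by
  rw [← Expr.value_eq_eval]; rfl

lemma exec_loop (v : ℕ) (e : Expr) (c : Program) (s : Config) :
    (Program.loop v e c).exec indep s = (List.range (e.eval s.reg s.arr)).foldl
      (fun t k => c.exec indep ((t.setReg v k).tick 1)) (s.tick (e.cost + 1)) := by
  rw [← Expr.value_eq_eval]; rfl

lemma exec_loop_induction {v : ℕ} {e : Expr} {c : Program} {s : Config}
    (I : ℕ → Config → Prop) (h0 : I 0 (s.tick (e.cost + 1)))
    (hs : ∀ k t, k < e.eval s.reg s.arr → I k t →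
      I (k + 1) (c.exec indep ((t.setReg v k).tick 1))) :
    I (e.eval s.reg s.arr) ((Program.loop v e c).exec indep s) := by
  rw [exec_loop]
  have partial_run : ∀ m ≤ e.eval s.reg s.arr, I m ((List.range m).foldl
      (fun t k => c.exec indep ((t.setReg v k).tick 1)) (s.tick (e.cost + 1))) := by
    intro m hm
    induction m with
    | zero => exact h0
    | succ m ih =>
      rw [List.range_succ, List.foldl_append]
      exact hs m _ hm (ih (by omega))
  exact partial_run _ le_rfl

/-- The program `c` writes `f`, a function of the memory, into register `d`; it leaves the registers
below `d` and the arrays as they were. -/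
def Program.Computes (c : Program) (d : ℕ) (f : (ℕ → ℕ) → (ℕ → ℕ → ℕ) → ℕ) : Prop :=
  ∀ s, (c.exec indep s).reg d = f s.reg s.arr ∧
    (∀ v < d, (c.exec indep s).reg v = s.reg v) ∧ (c.exec indep s).arr = s.arr

variable {indep}
variable {c c' c'' : Program} {d : ℕ} {f f' f'' : (ℕ → ℕ) → (ℕ → ℕ → ℕ) → ℕ}

lemma Program.computes_assign (e : Expr) : (Program.assign d e).Computes indep d e.eval :=
  fun s => ⟨by simp, fun v hv => by simp [hv.ne], rfl⟩

lemma Program.computes_query (a : ℕ) :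
    (Program.query d a).Computes indep d (Term.query a |>.den indep) :=
  fun s => ⟨by simp [Term.den], fun v hv => by simp [hv.ne], rfl⟩

lemma Program.Computes.binary (h : c.Computes indep d f) (h' : c'.Computes indep (d + 1) f')
    (hf' : DependsOn f' (Set.Iio d)) (op : ℕ → ℕ → ℕ) {e : Expr}
    (he : ∀ reg arr, e.eval reg arr = op (reg d) (reg (d + 1))) :
    (c.seq (c'.seq (.assign d e))).Computes indep d
      fun reg arr => op (f reg arr) (f' reg arr) := by
  intro s
  obtain ⟨val, frame, arr⟩ := h s
  obtain ⟨val', frame', arr'⟩ := h' ((c.exec indep s).tick 1)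
  have same : f' (c.exec indep s).reg = f' s.reg := hf' frame
  refine ⟨?_, fun v hv => ?_, ?_⟩
  · simp only [exec_seq, exec_assign_reg, tick_reg, Function.update_self, he, val',
      frame' d d.lt_succ_self, tick_arr, val, arr, same]
  · simp only [exec_seq, exec_assign_reg, tick_reg, Function.update_of_ne hv.ne,
      frame' v (hv.trans d.lt_succ_self), frame v hv]
  · simp only [exec_seq, exec_assign_arr, tick_arr, arr', arr]

lemma Program.Computes.ite (h : c.Computes indep d f) (h' : c'.Computes indep d f')
    (h'' : c''.Computes indep d f'') (hf' : DependsOn f' (Set.Iio d))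
    (hf'' : DependsOn f'' (Set.Iio d)) :
    (c.seq (.ite (.var d) c' c'')).Computes indep d
      fun reg arr => if f reg arr ≠ 0 then f' reg arr else f'' reg arr := by
  intro s
  obtain ⟨val, frame, arr⟩ := h s
  have same' : f' (c.exec indep s).reg = f' s.reg := hf' frame
  have same'' : f'' (c.exec indep s).reg = f'' s.reg := hf'' frame
  simp only [exec_seq, exec_ite, Expr.eval_var, tick_reg, val]
  split_ifs
  · obtain ⟨val', frame', arr'⟩ := h' (((c.exec indep s).tick 1).tick ((Expr.var d).cost + 1))
    exact ⟨val'.trans (by simp only [tick_reg, tick_arr, arr, same']),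
      fun v hv => (frame' v hv).trans (frame v hv), arr'.trans arr⟩
  · obtain ⟨val', frame', arr'⟩ := h'' (((c.exec indep s).tick 1).tick ((Expr.var d).cost + 1))
    exact ⟨val'.trans (by simp only [tick_reg, tick_arr, arr, same'']),
      fun v hv => (frame' v hv).trans (frame v hv), arr'.trans arr⟩

lemma exec_sum_loop {w : ℕ} (h : c.Computes indep (d + 2) f) (hf : DependsOn f (Set.Iio d))
    (hw : w < d) {s : Config} (hs : s.reg d = 0) :
    let r := (Program.loop w (.var 0) (c.seq (.assign d (.add (.var d) (.var (d + 2)))))).exec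
      indep s
    r.reg d = ∑ k ∈ Finset.range (s.reg 0), f (Function.update s.reg w k) s.arr ∧
      (∀ v ≤ d + 1, v ≠ d → v ≠ w → r.reg v = s.reg v) ∧ r.arr = s.arr := by
  refine exec_loop_induction indep (fun k r =>
    r.reg d = ∑ k ∈ Finset.range k, f (Function.update s.reg w k) s.arr ∧
      (∀ v ≤ d + 1, v ≠ d → v ≠ w → r.reg v = s.reg v) ∧ r.arr = s.arr) (by simp [hs]) ?_
  rintro k r - ⟨sum, frame, arr⟩
  obtain ⟨val, frame', arr'⟩ := h ((r.setReg w k).tick 1)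
  have same : f (Function.update r.reg w k) = f (Function.update s.reg w k) := by
    refine hf fun v hv => ?_
    rcases eq_or_ne v w with rfl | hvw
    · simp
    · simp [hvw, frame v (le_of_lt hv |>.trans d.le_succ) (ne_of_lt hv) hvw]
  refine ⟨?_, fun v hv hvd hvw => ?_, ?_⟩
  · simp only [exec_seq, exec_assign_reg, tick_reg, Function.update_self, Expr.eval_add,
      Expr.eval_var, val, frame' d (by omega), setReg_reg, tick_arr, setReg_arr, arr, same]
    rw [Function.update_of_ne hw.ne', sum, Finset.sum_range_succ]
  · simp only [exec_seq, exec_assign_reg, tick_reg, Function.update_of_ne hvd,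
      frame' v (by omega), setReg_reg, Function.update_of_ne hvw, frame v hv hvd hvw]
  · simp only [exec_seq, exec_assign_arr, tick_arr, arr', setReg_arr, arr]

lemma Program.Computes.sum {w : ℕ} (h : c.Computes indep (d + 2) f)
    (hf : DependsOn f (Set.Iio d)) (hw : w < d) :
    (Program.seq (.assign (d + 1) (.var w)) (.seq (.assign d (.const 0))
      (.seq (.loop w (.var 0) (c.seq (.assign d (.add (.var d) (.var (d + 2))))))
        (.assign w (.var (d + 1)))))).Computes indep d
      fun reg arr => ∑ k ∈ Finset.range (reg 0), f (Function.update reg w k) arr := by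
  intro s
  set s₁ := (((Program.assign d (.const 0)).exec indep
    (((Program.assign (d + 1) (.var w)).exec indep s).tick 1)).tick 1) with hs₁
  have below : ∀ v < d, s₁.reg v = s.reg v := fun v hv => by
    simp [hs₁, hv.ne, (hv.trans d.lt_succ_self).ne]
  have same : ∀ k, f (Function.update s₁.reg w k) = f (Function.update s.reg w k) :=
    fun k => hf fun v hv => by simp only [Function.update_apply, below v hv]
  obtain ⟨sum, frame, arr⟩ := exec_sum_loop h hf hw (s := s₁) (by simp [hs₁])
  simp only [below 0 (by omega), same] at sum
  refine ⟨?_, fun v hv => ?_, arr⟩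
  · simp only [exec_seq, exec_assign_reg, tick_reg, Function.update_of_ne hw.ne']
    exact sum
  · simp only [exec_seq, exec_assign_reg, tick_reg, tick_arr, Expr.eval_var]
    rcases eq_or_ne v w with rfl | hvw
    · rw [Function.update_self, frame (d + 1) le_rfl (by omega) (by omega)]
      simp [hs₁]
    · rw [Function.update_of_ne hvw, frame v (by omega) hv.ne hvw, below v hv]

lemma Program.Computes.update {i e : Expr} (a : ℕ) (h : c.Computes indep (d + 3) f)
    (hf : DependsOn f (Set.Iio d)) (hi : i.bound ≤ d) (he : e.bound ≤ d) :
    (Program.seq (.assign (d + 1) (.get a i)) (.seq (.assign (d + 2) i)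
      (.seq (.store a i e) (c.seq (.seq (.assign d (.var (d + 3)))
        (.store a (.var (d + 2)) (.var (d + 1)))))))).Computes indep d
      fun reg arr => f reg (Function.update arr a
        (Function.update (arr a) (i.eval reg arr) (e.eval reg arr))) := by
  intro s
  set s₁ := (((Program.assign (d + 2) i).exec indep
    (((Program.assign (d + 1) (.get a i)).exec indep s).tick 1)).tick 1) with hs₁
  have below : ∀ v < d, s₁.reg v = s.reg v := fun v hv => by
    simp [hs₁, show v ≠ d + 1 by omega, show v ≠ d + 2 by omega]
  have same_i : i.eval s₁.reg = i.eval s.reg := i.dependsOn_eval hi below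
  have same_e : e.eval s₁.reg = e.eval s.reg := e.dependsOn_eval he below
  have old_value : s₁.reg (d + 1) = s.arr a (i.eval s.reg s.arr) := by simp [hs₁]
  have index : s₁.reg (d + 2) = i.eval s.reg s.arr := by
    simp only [hs₁, exec_assign_reg, tick_reg, Function.update_self, tick_arr, exec_assign_arr]
    exact congrFun (i.dependsOn_eval hi fun v (hv : v < d) => by
      simp [show v ≠ d + 1 by omega]) _
  have arr : s₁.arr = s.arr := by simp [hs₁]
  obtain ⟨val, frame, arr'⟩ := h (((Program.store a i e).exec indep s₁).tick 1)
  simp only [tick_reg, tick_arr, exec_store_reg, exec_store_arr, arr, same_i, same_e,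
    hf below] at val frame arr'
  simp only [exec_seq]
  refine ⟨?_, fun v hv => ?_, ?_⟩
  · simp only [exec_store_reg, tick_reg, exec_assign_reg, Function.update_self, Expr.eval_var,
      ← val]
    rfl
  · simp only [exec_store_reg, tick_reg, exec_assign_reg, Function.update_of_ne hv.ne]
    exact (frame v (by omega)).trans (below v hv)
  · simp only [exec_store_arr, tick_arr, exec_assign_arr, tick_reg, exec_assign_reg,
      Expr.eval_var, Function.update_of_ne (show d + 2 ≠ d by omega),
      Function.update_of_ne (show d + 1 ≠ d by omega)]
    rw [← hs₁, arr', frame (d + 1) (by omega), frame (d + 2) (by omega), old_value, index]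
    simp

theorem Term.computes_compile (t : Term) (hd : t.bound ≤ d) :
    (t.compile d).Computes indep d (t.den indep) := by
  induction t generalizing d with
  | expr e => exact Program.computes_assign e
  | query a => exact Program.computes_query a
  | add t u iht ihu =>
    obtain ⟨ht, hu⟩ := max_le_iff.1 hd
    exact (iht ht).binary (ihu (hu.trans d.le_succ)) (u.dependsOn_den indep hu) (· + ·)
      fun _ _ => rfl
  | sub t u iht ihu =>
    obtain ⟨ht, hu⟩ := max_le_iff.1 hd
    exact (iht ht).binary (ihu (hu.trans d.le_succ)) (u.dependsOn_den indep hu) (· - ·)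
      fun _ _ => rfl
  | ite c t u ihc iht ihu =>
    obtain ⟨hc, htu⟩ := max_le_iff.1 hd
    obtain ⟨ht, hu⟩ := max_le_iff.1 htu
    exact (ihc hc).ite (iht ht) (ihu hu) (t.dependsOn_den indep ht) (u.dependsOn_den indep hu)
  | sum w t ih =>
    obtain ⟨hw, ht⟩ := max_le_iff.1 hd
    exact (ih (by omega)).sum (t.dependsOn_den indep ht) (max_le_iff.1 hw).2
  | update a i e t ih =>
    obtain ⟨hie, ht⟩ := max_le_iff.1 hd
    obtain ⟨hi, he⟩ := max_le_iff.1 hie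
    exact (ih (by omega)).update a (t.dependsOn_den indep ht) hi he

variable (indep)

/-! ### Running times -/

/-- Programs that do not write into register `0` and all of whose loops run up to its value. Since
register `0` holds the size of the ground set, such programs take polynomial time. -/
def Program.Tame : Program → Prop
  | .skip => True
  | .assign v _ => v ≠ 0
  | .store _ _ _ => True
  | .query v _ => v ≠ 0
  | .seq c d => c.Tame ∧ d.Tame
  | .ite _ c d => c.Tame ∧ d.Tame
  | .loop v e c => v ≠ 0 ∧ e = .var 0 ∧ c.Tame

/-- A bound on the numbers of steps and oracle calls of a tame program, as a polynomial in the value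
of register `0`. -/
noncomputable def Program.time : Program → Polynomial ℕ
  | .skip => 1
  | .assign _ e => Polynomial.C (e.cost + 1)
  | .store _ i e => Polynomial.C (i.cost + e.cost + 1)
  | .query _ _ => 1
  | .seq c d => c.time + d.time + 1
  | .ite e c d => Polynomial.C (e.cost + 1) + c.time + d.time
  | .loop _ e c => Polynomial.C (e.cost + 1) + Polynomial.X * (c.time + 1)

lemma exec_loop_le {v : ℕ} {c : Program} (hv : v ≠ 0) {T : ℕ} (s : Config)
    (hc : ∀ t : Config, t.reg 0 = s.reg 0 → (c.exec indep t).reg 0 = t.reg 0 ∧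
      (c.exec indep t).calls ≤ t.calls + T ∧ (c.exec indep t).steps ≤ t.steps + T) :
    let r := (Program.loop v (.var 0) c).exec indep s
    r.reg 0 = s.reg 0 ∧ r.calls ≤ s.calls + s.reg 0 * (T + 1) ∧
      r.steps ≤ s.steps + ((Expr.var 0).cost + 1) + s.reg 0 * (T + 1) := by
  refine exec_loop_induction indep (fun k r => r.reg 0 = s.reg 0 ∧
    r.calls ≤ s.calls + k * (T + 1) ∧
    r.steps ≤ s.steps + ((Expr.var 0).cost + 1) + k * (T + 1)) (by simp [Config.tick]) ?_
  rintro k r - ⟨reg, calls, steps⟩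
  have reg' : ((r.setReg v k).tick 1).reg 0 = s.reg 0 := by
    rw [tick_reg, setReg_reg, Function.update_of_ne hv.symm, reg]
  obtain ⟨body_reg, body_calls, body_steps⟩ := hc _ reg'
  simp only [Config.tick, Config.setReg] at body_calls body_steps ⊢
  rw [Nat.succ_mul]
  exact ⟨body_reg.trans reg', by omega, by omega⟩

theorem Program.Tame.exec_le {c : Program} (hc : c.Tame) (s : Config) :
    (c.exec indep s).reg 0 = s.reg 0 ∧
    (c.exec indep s).calls ≤ s.calls + c.time.eval (s.reg 0) ∧
    (c.exec indep s).steps ≤ s.steps + c.time.eval (s.reg 0) := by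
  induction c generalizing s with
  | skip => simp [Program.exec, Program.time, Config.tick]
  | assign v e =>
    refine ⟨?_, ?_⟩
    · rw [exec_assign_reg, Function.update_of_ne (Ne.symm hc)]
    · simp [Program.exec, Program.time, Config.tick, Config.setReg]
  | store a i e => simp [Program.exec, Program.time, Config.tick, Config.setArr]
  | query v a =>
    refine ⟨?_, ?_⟩
    · rw [exec_query_reg, Function.update_of_ne (Ne.symm hc)]
    · simp [Program.exec, Program.time, Config.tick, Config.setReg]
  | seq c d ihc ihd =>
    obtain ⟨c_reg, c_calls, c_steps⟩ := ihc hc.1 s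
    obtain ⟨d_reg, d_calls, d_steps⟩ := ihd hc.2 ((c.exec indep s).tick 1)
    simp only [tick_reg, c_reg] at d_reg d_calls d_steps
    simp only [exec_seq, Program.time, Polynomial.eval_add, Polynomial.eval_one]
    simp only [Config.tick] at d_calls d_steps ⊢
    exact ⟨d_reg, by omega, by omega⟩
  | ite e c d ihc ihd =>
    obtain ⟨c_reg, c_calls, c_steps⟩ := ihc hc.1 (s.tick (e.cost + 1))
    obtain ⟨d_reg, d_calls, d_steps⟩ := ihd hc.2 (s.tick (e.cost + 1))
    rw [exec_ite]
    simp only [Program.time, Polynomial.eval_add, Polynomial.eval_C]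
    simp only [Config.tick] at c_reg c_calls c_steps d_reg d_calls d_steps ⊢
    split_ifs
    · exact ⟨c_reg, by omega, by omega⟩
    · exact ⟨d_reg, by omega, by omega⟩
  | loop v e c ih =>
    obtain ⟨hv, rfl, hc⟩ := hc
    obtain ⟨reg, calls, steps⟩ :=
      exec_loop_le indep hv (T := c.time.eval (s.reg 0)) s fun t ht => by
        simpa only [ht] using ih hc t
    simp only [Program.time, Polynomial.eval_add, Polynomial.eval_C, Polynomial.eval_mul,
      Polynomial.eval_X, Polynomial.eval_one]
    exact ⟨reg, by omega, by omega⟩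

/-- Terms that do not bind register `0`. -/
def Term.Tame : Term → Prop
  | .expr _ => True
  | .query _ => True
  | .add t u => t.Tame ∧ u.Tame
  | .sub t u => t.Tame ∧ u.Tame
  | .ite c t u => c.Tame ∧ t.Tame ∧ u.Tame
  | .sum v t => v ≠ 0 ∧ t.Tame
  | .update _ _ _ t => t.Tame

lemma Term.Tame.compile {t : Term} (ht : t.Tame) {d : ℕ} (hd : d ≠ 0) : (t.compile d).Tame := by
  induction t generalizing d with
  | expr e => exact hd
  | query a => exact hd
  | add t u iht ihu => exact ⟨iht ht.1 hd, ihu ht.2 (by omega), hd⟩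
  | sub t u iht ihu => exact ⟨iht ht.1 hd, ihu ht.2 (by omega), hd⟩
  | ite c t u ihc iht ihu => exact ⟨ihc ht.1 hd, iht ht.2.1 hd, ihu ht.2.2 hd⟩
  | sum v t ih =>
    exact ⟨Nat.succ_ne_zero d, hd, ⟨ht.1, rfl, ih ht.2 (by omega), hd⟩, ht.1⟩
  | update a i e t ih =>
    exact ⟨Nat.succ_ne_zero _, Nat.succ_ne_zero _, trivial, ih ht (by omega), hd, trivial⟩

end Machine

/-! ### Split systems -/

section SplitSystem

variable {α ι κ : Type*}

/-- No tight set is violated when `p` is replaced by `q`. -/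
def Allowed (A : ι → Finset α) (s : ι → ℤ) (p q : α) : Prop :=
  ∀ i, s i = 0 → q ∈ A i → p ∈ A i

/-- Two different tight sets that partition both `P` and `Q`. -/
structure TightPartition (P Q : Finset α) (A : ι → Finset α) (s : ι → ℤ) (i j : ι) : Prop where
  ne : i ≠ j
  left : s i = 0
  right : s j = 0
  memP : ∀ x ∈ P, x ∈ A j ↔ x ∉ A i
  memQ : ∀ x ∈ Q, x ∈ A j ↔ x ∉ A i

/-- No exchange is allowed by both systems. -/
def Stuck (P Q : Finset α) (A : ι → Finset α) (s : ι → ℤ) (B : κ → Finset α) (t : κ → ℤ) : Prop :=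
  ∀ p ∈ P, ∀ q ∈ Q, Allowed A s p q → ¬ Allowed B t p q

/-- Representatives of the four cells that are nonempty because of an obstruction. -/
structure Corners (P Q : Finset α) (A : ι → Finset α) (B : κ → Finset α) (i₁ i₂ : ι) (j₁ j₂ : κ)
    (x₁ x₂ y₁ y₂ : α) : Prop where
  x₁_mem : x₁ ∈ P ∧ x₁ ∈ A i₁ ∧ x₁ ∈ B j₁
  x₂_mem : x₂ ∈ P ∧ x₂ ∈ A i₂ ∧ x₂ ∈ B j₂
  y₁_mem : y₁ ∈ Q ∧ y₁ ∈ A i₁ ∧ y₁ ∈ B j₂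
  y₂_mem : y₂ ∈ Q ∧ y₂ ∈ A i₂ ∧ y₂ ∈ B j₁

/-- The cell of an element `q` of `Q` that lies in a tight set of each of two systems. -/
structure TightCell (Q : Finset α) (A : ι → Finset α) (s : ι → ℤ) (B : κ → Finset α) (t : κ → ℤ)
    (i : ι) (j : κ) (q : α) : Prop where
  left : s i = 0
  right : t j = 0
  mem : q ∈ Q
  mem_left : q ∈ A i
  mem_right : q ∈ B j

variable {P Q : Finset α} {A : ι → Finset α} {s : ι → ℤ} {B : κ → Finset α} {t : κ → ℤ}
  {i j i₁ i₂ : ι} {j₁ j₂ : κ} {p q x y x₁ x₂ y₁ y₂ : α} {d : ℕ}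

lemma TightPartition.symm (h : TightPartition P Q A s i j) : TightPartition P Q A s j i :=
  ⟨h.ne.symm, h.right, h.left, fun x hx => by rw [h.memP x hx, not_not],
    fun x hx => by rw [h.memQ x hx, not_not]⟩

lemma TightPartition.mem_iff_of_allowed (h : TightPartition P Q A s i j) (hp : p ∈ P) (hq : q ∈ Q)
    (ha : Allowed A s p q) : p ∈ A i ↔ q ∈ A i := by
  have hi := ha i h.left
  have hj := ha j h.right
  rw [h.memP p hp, h.memQ q hq] at hj
  tauto

lemma Stuck.symm (h : Stuck P Q A s B t) : Stuck P Q B t A s :=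
  fun p hp q hq hb ha => h p hp q hq ha hb

lemma Corners.flip (h : Corners P Q A B i₁ i₂ j₁ j₂ x₁ x₂ y₁ y₂) :
    Corners P Q A B i₂ i₁ j₂ j₁ x₂ x₁ y₂ y₁ :=
  ⟨h.x₂_mem, h.x₁_mem, h.y₂_mem, h.y₁_mem⟩

lemma TightCell.symm {j : κ} (c : TightCell Q A s B t i j q) : TightCell Q B t A s j i q :=
  ⟨c.right, c.left, c.mem, c.mem_right, c.mem_left⟩

variable [DecidableEq α]

/-- A family of sets `A i` with slacks `s i`, as it arises from the cuts of a split matroid when the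
elements `P` of a basis have to be replaced by the elements `Q` of another one. A set of slack `0`
is called tight. -/
structure SplitSystem (P Q : Finset α) (A : ι → Finset α) (s : ι → ℤ) : Prop where
  nonneg : ∀ i, 0 ≤ s i
  target : ∀ i, ((Q ∩ A i).card : ℤ) ≤ s i + (P ∩ A i).card
  pair : ∀ i j, i ≠ j →
    ((Q ∩ (A i ∩ A j)).card : ℤ) + (P \ (A i ∪ A j)).card ≤ s i + s j

/-- Two split systems for the same replacement of `P` by `Q`; they describe the two members of a
pair of bases. -/
structure SplitPair (P Q : Finset α) (A : ι → Finset α) (s : ι → ℤ) (B : κ → Finset α)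
    (t : κ → ℤ) : Prop where
  left : SplitSystem P Q A s
  right : SplitSystem P Q B t
  card_eq : P.card = Q.card

/-- The slack after `p` has been replaced by `q`. -/
def nextSlack (A : ι → Finset α) (s : ι → ℤ) (p q : α) (i : ι) : ℤ :=
  s i + (if p ∈ A i then 1 else 0) - (if q ∈ A i then 1 else 0)

/-- A tight partition from each of two systems, such that the four cells that they cut out are
unbalanced by `d`. As exchanges stay within a cell, `2 * d` of them can never be made. -/
structure Obstruction (P Q : Finset α) (A : ι → Finset α) (s : ι → ℤ) (B : κ → Finset α)
    (t : κ → ℤ) (i₁ i₂ : ι) (j₁ j₂ : κ) (d : ℕ) : Prop where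
  fst : TightPartition P Q A s i₁ i₂
  snd : TightPartition P Q B t j₁ j₂
  card_eq : (P ∩ (A i₁ ∩ B j₁)).card = (Q ∩ (A i₁ ∩ B j₁)).card + d
  pos : 0 < d

/-- There is an obstruction of imbalance `d`. -/
def Obstructed (P Q : Finset α) (A : ι → Finset α) (s : ι → ℤ) (B : κ → Finset α)
    (t : κ → ℤ) (d : ℕ) : Prop :=
  ∃ i₁ i₂ j₁ j₂, Obstruction P Q A s B t i₁ i₂ j₁ j₂ d

lemma card_erase_inter (hp : p ∈ P) (C : Finset α) :
    (((P.erase p) ∩ C).card : ℤ) = (P ∩ C).card - (if p ∈ C then 1 else 0) := by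
  rw [Finset.erase_inter]
  split_ifs with h
  · rw [← Finset.card_erase_add_one (Finset.mem_inter.2 ⟨hp, h⟩)]
    simp
  · rw [Finset.erase_eq_of_notMem (by simp [h]), sub_zero]

lemma card_erase_sdiff (hp : p ∈ P) (C : Finset α) :
    (((P.erase p) \ C).card : ℤ) = (P \ C).card - (if p ∈ C then 0 else 1) := by
  rw [Finset.erase_sdiff_comm]
  split_ifs with h
  · rw [Finset.erase_eq_of_notMem (by simp [h]), sub_zero]
  · rw [← Finset.card_erase_add_one (Finset.mem_sdiff.2 ⟨hp, h⟩)]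
    simp

lemma card_inter_add_card_inter {R C D : Finset α} (h : ∀ x ∈ R, x ∈ D ↔ x ∉ C) :
    (R ∩ C).card + (R ∩ D).card = R.card := by
  have : R ∩ D = R \ C := by
    ext x
    simp only [Finset.mem_inter, Finset.mem_sdiff]
    exact and_congr_right (h x)
  rw [this, Finset.card_inter_add_card_sdiff]

lemma card_inter_inter_add_card_inter_inter {R C D : Finset α} (h : ∀ x ∈ R, x ∈ D ↔ x ∉ C)
    (E : Finset α) : (R ∩ (C ∩ E)).card + (R ∩ (D ∩ E)).card = (R ∩ E).card := by
  rw [← card_inter_add_card_inter (R := R ∩ E) fun x hx => h x (Finset.mem_inter.1 hx).1,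
    Finset.inter_right_comm, Finset.inter_assoc, Finset.inter_right_comm, Finset.inter_assoc]

lemma nextSlack_eq_one_of_nonneg_of_eq_zero (hs : 0 ≤ s i) (h : nextSlack A s p q i = 0)
    (hi : s i ≠ 0) : s i = 1 ∧ p ∉ A i ∧ q ∈ A i := by
  unfold nextSlack at h
  split_ifs at h with hp hq hq
  all_goals first | omega | exact ⟨by omega, hp, hq⟩

lemma mem_iff_of_nextSlack_eq_zero (h : nextSlack A s p q i = 0) (hi : s i = 0) :
    p ∈ A i ↔ q ∈ A i := by
  unfold nextSlack at h
  split_ifs at h with hp hq hq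
  all_goals first | omega | tauto

namespace SplitSystem

lemma next (h : SplitSystem P Q A s) (hp : p ∈ P) (hq : q ∈ Q) (ha : Allowed A s p q) :
    SplitSystem (P.erase p) (Q.erase q) A (nextSlack A s p q) where
  nonneg i := by
    have hi := h.nonneg i
    have := ha i
    unfold nextSlack
    split_ifs <;> grind
  target i := by
    have := h.target i
    rw [card_erase_inter hp, card_erase_inter hq]
    unfold nextSlack
    split_ifs <;> omega
  pair i j hij := by
    have := h.pair i j hij
    rw [card_erase_sdiff hp, card_erase_inter hq]
    simp only [nextSlack, Finset.mem_inter, Finset.mem_union]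
    split_ifs <;> first | omega | tauto

lemma notMem_of_add_le_zero (h : SplitSystem P Q A s) (hij : i ≠ j) (hs : s i + s j ≤ 0)
    (hx : x ∈ Q) (hi : x ∈ A i) : x ∉ A j := by
  intro hj
  have := h.pair i j hij
  have : 0 < (Q ∩ (A i ∩ A j)).card := Finset.card_pos.2 ⟨x, by simp [*]⟩
  omega

lemma mem_of_add_le_zero (h : SplitSystem P Q A s) (hij : i ≠ j) (hs : s i + s j ≤ 0)
    (hx : x ∈ P) (hi : x ∉ A i) : x ∈ A j := by
  by_contra hj
  have := h.pair i j hij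
  have : 0 < (P \ (A i ∪ A j)).card := Finset.card_pos.2 ⟨x, by simp [*]⟩
  omega

lemma mem_of_add_le_one (h : SplitSystem P Q A s) (hij : i ≠ j) (hs : s i + s j ≤ 1)
    (hy : y ∈ Q) (hyi : y ∈ A i) (hyj : y ∈ A j) (hx : x ∈ P) (hi : x ∉ A i) : x ∈ A j := by
  by_contra hj
  have := h.pair i j hij
  have : 0 < (P \ (A i ∪ A j)).card := Finset.card_pos.2 ⟨x, by simp [*]⟩
  have : 0 < (Q ∩ (A i ∩ A j)).card := Finset.card_pos.2 ⟨y, by simp [*]⟩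
  omega

lemma eq_of_tight (h : SplitSystem P Q A s) (hi : s i = 0) (hj : s j = 0) (hx : x ∈ Q)
    (hxi : x ∈ A i) (hxj : x ∈ A j) : i = j := by
  by_contra hij
  exact h.notMem_of_add_le_zero hij (by omega) hx hxi hxj

lemma exists_mem_of_tight (h : SplitSystem P Q A s) (hi : s i = 0) (hx : x ∈ Q) (hxi : x ∈ A i) :
    ∃ y ∈ P, y ∈ A i := by
  have := h.target i
  have : 0 < (Q ∩ A i).card := Finset.card_pos.2 ⟨x, Finset.mem_inter.2 ⟨hx, hxi⟩⟩
  obtain ⟨y, hy⟩ := Finset.card_pos.1 (show 0 < (P ∩ A i).card by omega)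
  exact ⟨y, Finset.mem_inter.1 hy⟩

lemma subset_of_tight (h : SplitSystem P Q A s) (hc : P.card = Q.card) (hi : s i = 0)
    (hQ : Q ⊆ A i) : P ⊆ A i := by
  have ht := h.target i
  rw [Finset.inter_eq_left.2 hQ, hi] at ht
  exact Finset.inter_eq_left.1
    (Finset.eq_of_subset_of_card_le Finset.inter_subset_left (by omega))

lemma allowed_of_mem_tight (h : SplitSystem P Q A s) (hi : s i = 0) (hx : x ∈ A i) (hy : y ∈ Q)
    (hyi : y ∈ A i) : Allowed A s x y :=
  fun _ hk hyk => h.eq_of_tight hi hk hy hyi hyk ▸ hx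

lemma allowed_of_notMem_tight (h : SplitSystem P Q A s) (hi : s i = 0) (hx : x ∈ P)
    (hxi : x ∉ A i) (hyi : y ∉ A i) : Allowed A s x y := by
  intro k hk hyk
  have hik : i ≠ k := by
    rintro rfl
    exact hyi hyk
  exact h.mem_of_add_le_zero hik (by omega) hx hxi

lemma allowed_of_slack_eq_one (h : SplitSystem P Q A s) (hi : s i = 1) (hx : x ∈ P)
    (hxi : x ∉ A i) (hy : y ∈ Q) (hyi : y ∈ A i) : Allowed A s x y := by
  intro k hk hyk
  have hik : i ≠ k := by
    rintro rfl
    omega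
  exact h.mem_of_add_le_one hik (by omega) hy hyi hyk hx hxi

lemma compl (h : SplitSystem P Q A s) (hc : P.card = Q.card) {A' : ι → Finset α}
    (hA' : ∀ i x, x ∈ A' i ↔ x ∉ A i) : SplitSystem Q P A' s where
  nonneg := h.nonneg
  target i := by
    have hi := h.target i
    have hP := card_inter_add_card_inter fun x (_ : x ∈ P) => hA' i x
    have hQ := card_inter_add_card_inter fun x (_ : x ∈ Q) => hA' i x
    omega
  pair i j hij := by
    have hP : P ∩ (A' i ∩ A' j) = P \ (A i ∪ A j) := by
      ext x
      simp [hA']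
    have hQ : Q \ (A' i ∪ A' j) = Q ∩ (A i ∩ A j) := by
      ext x
      simp [hA']
    rw [hP, hQ, add_comm]
    exact h.pair i j hij

end SplitSystem

lemma SplitPair.symm (h : SplitPair P Q A s B t) : SplitPair P Q B t A s :=
  ⟨h.right, h.left, h.card_eq⟩

lemma SplitPair.next (h : SplitPair P Q A s B t) (hp : p ∈ P) (hq : q ∈ Q)
    (ha : Allowed A s p q) (hb : Allowed B t p q) :
    SplitPair (P.erase p) (Q.erase q) A (nextSlack A s p q) B (nextSlack B t p q) where
  left := h.left.next hp hq ha
  right := h.right.next hp hq hb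
  card_eq := by rw [Finset.card_erase_of_mem hp, Finset.card_erase_of_mem hq, h.card_eq]

namespace TightPartition

lemma card_eq (h : TightPartition P Q A s i j) (hA : SplitSystem P Q A s)
    (hc : P.card = Q.card) : (P ∩ A i).card = (Q ∩ A i).card := by
  have hi := hA.target i
  have hj := hA.target j
  rw [h.left] at hi
  rw [h.right] at hj
  have := card_inter_add_card_inter h.memP
  have := card_inter_add_card_inter h.memQ
  omega

lemma exists_right (h : TightPartition P Q A s i₁ i₂) (hA : SplitSystem P Q A s) (hi : s i = 0)
    (hx : x ∈ Q) (hxi : x ∈ A i) : ∃ k, TightPartition P Q A s i k := by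
  by_cases hx1 : x ∈ A i₁
  · obtain rfl := hA.eq_of_tight hi h.left hx hxi hx1
    exact ⟨i₂, h⟩
  · obtain rfl := hA.eq_of_tight hi h.right hx hxi ((h.memQ x hx).2 hx1)
    exact ⟨i₁, h.symm⟩

lemma next (h : TightPartition P Q A s i j) (hp : p ∈ P) (hq : q ∈ Q) (ha : Allowed A s p q) :
    TightPartition (P.erase p) (Q.erase q) A (nextSlack A s p q) i j where
  ne := h.ne
  left := by simp [nextSlack, h.mem_iff_of_allowed hp hq ha, h.left]
  right := by simp [nextSlack, h.symm.mem_iff_of_allowed hp hq ha, h.right]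
  memP x hx := h.memP x (Finset.mem_of_mem_erase hx)
  memQ x hx := h.memQ x (Finset.mem_of_mem_erase hx)

lemma of_next (h : TightPartition (P.erase p) (Q.erase q) A (nextSlack A s p q) i j)
    (hA : SplitSystem P Q A s) (hp : p ∈ P) (hq : q ∈ Q) (hi : s i = 0) (hj : s j = 0) :
    TightPartition P Q A s i j := by
  have hpi := mem_iff_of_nextSlack_eq_zero h.left hi
  have hpj := mem_iff_of_nextSlack_eq_zero h.right hj
  have memQ : ∀ x ∈ Q, x ∈ A i → x ∉ A j := fun x hx hxi hxj =>
    h.ne (hA.eq_of_tight hi hj hx hxi hxj)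
  have memP : ∀ x ∈ P, x ∉ A i → x ∈ A j := fun x =>
    hA.mem_of_add_le_zero h.ne (by omega)
  refine ⟨h.ne, hi, hj, fun x hx => ?_, fun x hx => ?_⟩
  · rcases eq_or_ne x p with rfl | hxp
    · have := memP x hx
      have := memQ q hq
      tauto
    · exact h.memP x (Finset.mem_erase.2 ⟨hxp, hx⟩)
  · rcases eq_or_ne x q with rfl | hxq
    · have := memQ x hx
      have := memP p hp
      tauto
    · exact h.memQ x (Finset.mem_erase.2 ⟨hxq, hx⟩)

end TightPartition

namespace Obstruction

lemma swap (h : Obstruction P Q A s B t i₁ i₂ j₁ j₂ d) :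
    Obstruction P Q B t A s j₁ j₂ i₁ i₂ d :=
  ⟨h.snd, h.fst, by simpa only [Finset.inter_comm] using h.card_eq, h.pos⟩

lemma card_cells (h : Obstruction P Q A s B t i₁ i₂ j₁ j₂ d) (hAB : SplitPair P Q A s B t) :
    (P ∩ (A i₂ ∩ B j₂)).card = (Q ∩ (A i₂ ∩ B j₂)).card + d ∧
    (Q ∩ (A i₁ ∩ B j₂)).card = (P ∩ (A i₁ ∩ B j₂)).card + d ∧
    (Q ∩ (A i₂ ∩ B j₁)).card = (P ∩ (A i₂ ∩ B j₁)).card + d := by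
  have hi₁ := h.fst.card_eq hAB.left hAB.card_eq
  have hj₁ := h.snd.card_eq hAB.right hAB.card_eq
  have hj₂ := h.snd.symm.card_eq hAB.right hAB.card_eq
  have hPj₁ := card_inter_inter_add_card_inter_inter h.fst.memP (B j₁)
  have hPj₂ := card_inter_inter_add_card_inter_inter h.fst.memP (B j₂)
  have hQj₁ := card_inter_inter_add_card_inter_inter h.fst.memQ (B j₁)
  have hQj₂ := card_inter_inter_add_card_inter_inter h.fst.memQ (B j₂)
  have hPi₁ := card_inter_inter_add_card_inter_inter h.snd.memP (A i₁)
  have hQi₁ := card_inter_inter_add_card_inter_inter h.snd.memQ (A i₁)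
  simp only [Finset.inter_comm (B _) (A _)] at hPi₁ hQi₁
  have := h.card_eq
  omega

lemma flip (h : Obstruction P Q A s B t i₁ i₂ j₁ j₂ d) (hAB : SplitPair P Q A s B t) :
    Obstruction P Q A s B t i₂ i₁ j₂ j₁ d :=
  ⟨h.fst.symm, h.snd.symm, (h.card_cells hAB).1, h.pos⟩

lemma card_eq_sum_cells (h : Obstruction P Q A s B t i₁ i₂ j₁ j₂ d) :
    (P ∩ (A i₁ ∩ B j₁)).card + (P ∩ (A i₂ ∩ B j₁)).card +
      ((P ∩ (A i₁ ∩ B j₂)).card + (P ∩ (A i₂ ∩ B j₂)).card) = P.card := by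
  rw [card_inter_inter_add_card_inter_inter h.fst.memP, card_inter_inter_add_card_inter_inter
    h.fst.memP, card_inter_add_card_inter h.snd.memP]

lemma two_mul_le (h : Obstruction P Q A s B t i₁ i₂ j₁ j₂ d) (hAB : SplitPair P Q A s B t) :
    2 * d ≤ P.card := by
  have := h.card_eq
  have := (h.card_cells hAB).1
  have := h.card_eq_sum_cells
  omega

lemma next (h : Obstruction P Q A s B t i₁ i₂ j₁ j₂ d) (hp : p ∈ P) (hq : q ∈ Q)
    (ha : Allowed A s p q) (hb : Allowed B t p q) :
    Obstruction (P.erase p) (Q.erase q) A (nextSlack A s p q) B (nextSlack B t p q)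
      i₁ i₂ j₁ j₂ d where
  fst := h.fst.next hp hq ha
  snd := h.snd.next hp hq hb
  card_eq := by
    have hP := card_erase_inter hp (A i₁ ∩ B j₁)
    have hQ := card_erase_inter hq (A i₁ ∩ B j₁)
    simp only [Finset.mem_inter, h.fst.mem_iff_of_allowed hp hq ha,
      h.snd.mem_iff_of_allowed hp hq hb] at hP hQ
    have := h.card_eq
    omega
  pos := h.pos

lemma of_next
    (h : Obstruction (P.erase p) (Q.erase q) A (nextSlack A s p q) B (nextSlack B t p q)
      i₁ i₂ j₁ j₂ d)
    (hAB : SplitPair P Q A s B t) (hp : p ∈ P) (hq : q ∈ Q) (hi₁ : s i₁ = 0) (hi₂ : s i₂ = 0)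
    (hj₁ : t j₁ = 0) (hj₂ : t j₂ = 0) : Obstruction P Q A s B t i₁ i₂ j₁ j₂ d where
  fst := h.fst.of_next hAB.left hp hq hi₁ hi₂
  snd := h.snd.of_next hAB.right hp hq hj₁ hj₂
  card_eq := by
    have hP := card_erase_inter hp (A i₁ ∩ B j₁)
    have hQ := card_erase_inter hq (A i₁ ∩ B j₁)
    simp only [Finset.mem_inter, mem_iff_of_nextSlack_eq_zero h.fst.left hi₁,
      mem_iff_of_nextSlack_eq_zero h.snd.left hj₁] at hP hQ
    have := h.card_eq
    omega
  pos := h.pos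

lemma card_eq_of_stuck (h : Obstruction P Q A s B t i₁ i₂ j₁ j₂ d)
    (hAB : SplitPair P Q A s B t) (hst : Stuck P Q A s B t) : P.card = 2 * d := by
  have empty_cell : ∀ {i j}, s i = 0 → t j = 0 →
      (P ∩ (A i ∩ B j)).card = 0 ∨ (Q ∩ (A i ∩ B j)).card = 0 := by
    intro i j hi hj
    simp only [Finset.card_eq_zero, ← Finset.not_nonempty_iff_eq_empty, ← not_and_or]
    rintro ⟨⟨x, hx⟩, y, hy⟩
    simp only [Finset.mem_inter] at hx hy
    exact hst x hx.1 y hy.1 (hAB.left.allowed_of_mem_tight hi hx.2.1 hy.1 hy.2.1)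
      (hAB.right.allowed_of_mem_tight hj hx.2.2 hy.1 hy.2.2)
  have := empty_cell h.fst.left h.snd.left
  have := empty_cell h.fst.left h.snd.right
  have := empty_cell h.fst.right h.snd.left
  have := empty_cell h.fst.right h.snd.right
  have := h.card_eq
  have := h.pos
  have := h.card_cells hAB
  have := h.card_eq_sum_cells
  omega

lemma exists_corners (h : Obstruction P Q A s B t i₁ i₂ j₁ j₂ d) (hAB : SplitPair P Q A s B t) :
    ∃ x₁ x₂ y₁ y₂, Corners P Q A B i₁ i₂ j₁ j₂ x₁ x₂ y₁ y₂ := by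
  have exists_mem : ∀ {R C D : Finset α}, 0 < (R ∩ (C ∩ D)).card → ∃ x, x ∈ R ∧ x ∈ C ∧ x ∈ D := by
    intro R C D hpos
    obtain ⟨x, hx⟩ := Finset.card_pos.1 hpos
    exact ⟨x, by simpa only [Finset.mem_inter] using hx⟩
  have := h.card_eq
  have := h.pos
  obtain ⟨h22, h12, h21⟩ := h.card_cells hAB
  obtain ⟨x₁, hx₁⟩ := exists_mem (show 0 < (P ∩ (A i₁ ∩ B j₁)).card by omega)
  obtain ⟨x₂, hx₂⟩ := exists_mem (show 0 < (P ∩ (A i₂ ∩ B j₂)).card by omega)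
  obtain ⟨y₁, hy₁⟩ := exists_mem (show 0 < (Q ∩ (A i₁ ∩ B j₂)).card by omega)
  obtain ⟨y₂, hy₂⟩ := exists_mem (show 0 < (Q ∩ (A i₂ ∩ B j₁)).card by omega)
  exact ⟨x₁, x₂, y₁, y₂, hx₁, hx₂, hy₁, hy₂⟩

end Obstruction

lemma Stuck.exists_tight (hst : Stuck P Q A s B t) (hB : SplitSystem P Q B t) (hP : P.Nonempty)
    (hq : q ∈ Q) : ∃ i, s i = 0 ∧ q ∈ A i := by
  by_contra! hcon
  have allowed : ∀ p, Allowed A s p q := fun p i hi hqi => absurd hqi (hcon i hi)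
  obtain ⟨p₀, hp₀⟩ := hP
  have hp₀q := hst p₀ hp₀ q hq (allowed p₀)
  unfold Allowed at hp₀q
  push Not at hp₀q
  obtain ⟨j, hj, hqj, -⟩ := hp₀q
  obtain ⟨p, hp, hpj⟩ := hB.exists_mem_of_tight hj hq hqj
  exact hst p hp q hq (allowed p) (hB.allowed_of_mem_tight hj hpj hq hqj)

lemma Stuck.exists_tightCell (hst : Stuck P Q A s B t) (hAB : SplitPair P Q A s B t)
    (hP : P.Nonempty) (hq : q ∈ Q) : ∃ i j, TightCell Q A s B t i j q := by
  obtain ⟨i, hi, hqi⟩ := hst.exists_tight hAB.right hP hq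
  obtain ⟨j, hj, hqj⟩ := hst.symm.exists_tight hAB.left hP hq
  exact ⟨i, j, hi, hj, hq, hqi, hqj⟩

namespace TightCell

variable {i' : ι} {j j' : κ} {q' : α}

lemma notMem_of_stuck (c : TightCell Q A s B t i j q) (hAB : SplitPair P Q A s B t)
    (hst : Stuck P Q A s B t) (hp : p ∈ P) (hpi : p ∈ A i) : p ∉ B j := fun hpj =>
  hst p hp q c.mem (hAB.left.allowed_of_mem_tight c.left hpi c.mem c.mem_left)
    (hAB.right.allowed_of_mem_tight c.right hpj c.mem c.mem_right)

lemma not_subset_of_stuck (c : TightCell Q A s B t i j q) (hAB : SplitPair P Q A s B t)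
    (hst : Stuck P Q A s B t) : ¬ P ⊆ A i := by
  obtain ⟨p, hp, hpj⟩ := hAB.right.exists_mem_of_tight c.right c.mem c.mem_right
  exact fun hsub => c.notMem_of_stuck hAB hst hp (hsub hp) hpj

lemma exists_ne_of_stuck (c : TightCell Q A s B t i j q) (hAB : SplitPair P Q A s B t)
    (hst : Stuck P Q A s B t) (hP : P.Nonempty) :
    ∃ i' j' q', TightCell Q A s B t i' j' q' ∧ i ≠ i' := by
  obtain ⟨q', hq', hq'i⟩ := Finset.not_subset.1 fun hsub =>
    c.not_subset_of_stuck hAB hst (hAB.left.subset_of_tight hAB.card_eq c.left hsub)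
  obtain ⟨i', j', c'⟩ := hst.exists_tightCell hAB hP hq'
  refine ⟨i', j', q', c', ?_⟩
  rintro rfl
  exact hq'i c'.mem_left

lemma mem_iff_of_stuck (c : TightCell Q A s B t i j q) (c' : TightCell Q A s B t i' j' q')
    (hi : i ≠ i') (hj : j ≠ j') (hAB : SplitPair P Q A s B t) (hst : Stuck P Q A s B t)
    (hx : x ∈ P) : (x ∈ A i ↔ x ∈ B j') ∧ (x ∈ A i' ↔ x ∉ A i) := by
  have := hAB.left.mem_of_add_le_zero hi (by rw [c.left, c'.left, add_zero]) hx
  have := hAB.right.mem_of_add_le_zero hj (by rw [c.right, c'.right, add_zero]) hx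
  have := c.notMem_of_stuck hAB hst hx
  have := c'.notMem_of_stuck hAB hst hx
  tauto

lemma tightPartition_of_stuck (c : TightCell Q A s B t i j q)
    (c' : TightCell Q A s B t i' j' q') (hi : i ≠ i') (hj : j ≠ j') (hAB : SplitPair P Q A s B t)
    (hst : Stuck P Q A s B t) (hP : P.Nonempty) : TightPartition P Q A s i i' := by
  have memP : ∀ x ∈ P, x ∈ A i' ↔ x ∉ A i := fun x hx =>
    (c.mem_iff_of_stuck c' hi hj hAB hst hx).2
  refine ⟨hi, c.left, c'.left, memP, fun x hx => ?_⟩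
  constructor
  · exact fun hxi' hxi => hi (hAB.left.eq_of_tight c.left c'.left hx hxi hxi')
  · intro hxi
    obtain ⟨k, l, cx⟩ := hst.exists_tightCell hAB hP hx
    have hik : i ≠ k := by
      rintro rfl
      exact hxi cx.mem_left
    by_contra hxi'
    have hik' : i' ≠ k := by
      rintro rfl
      exact hxi' cx.mem_left
    -- A third tight set would contain the complements of `A i` and `A i'`, hence all of `P`.
    refine cx.not_subset_of_stuck hAB hst fun y hy => ?_
    by_cases hyi : y ∈ A i
    · exact hAB.left.mem_of_add_le_zero hik' (by rw [c'.left, cx.left, add_zero]) hy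
        fun hyi' => (memP y hy).1 hyi' hyi
    · exact hAB.left.mem_of_add_le_zero hik (by rw [c.left, cx.left, add_zero]) hy hyi

end TightCell

lemma Stuck.exists_tightCell_ne (hst : Stuck P Q A s B t) (hAB : SplitPair P Q A s B t)
    (hP : P.Nonempty) : ∃ i i' j j' q q', TightCell Q A s B t i j q ∧
      TightCell Q A s B t i' j' q' ∧ i ≠ i' ∧ j ≠ j' := by
  obtain ⟨q₀, hq₀⟩ : Q.Nonempty := Finset.card_pos.1 (hAB.card_eq ▸ Finset.card_pos.2 hP)
  obtain ⟨i₀, j₀, c₀⟩ := hst.exists_tightCell hAB hP hq₀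
  obtain ⟨i₁, j₁, q₁, c₁, hi⟩ := c₀.exists_ne_of_stuck hAB hst hP
  obtain ⟨j₂, i₂, q₂, c₂, hj⟩ := c₀.symm.exists_ne_of_stuck hAB.symm hst.symm hP
  by_cases hj₁ : j₀ = j₁
  · subst hj₁
    by_cases hi₂ : i₀ = i₂
    · subst hi₂
      exact ⟨i₁, i₀, j₀, j₂, q₁, q₂, c₁, c₂.symm, hi.symm, hj⟩
    · exact ⟨i₀, i₂, j₀, j₂, q₀, q₂, c₀, c₂.symm, hi₂, hj⟩
  · exact ⟨i₀, i₁, j₀, j₁, q₀, q₁, c₀, c₁, hi, hj₁⟩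

lemma Stuck.exists_obstructed (hst : Stuck P Q A s B t) (hAB : SplitPair P Q A s B t)
    (hP : P.Nonempty) : ∃ d, Obstructed P Q A s B t d := by
  obtain ⟨i, i', j, j', q, q', c, c', hi, hj⟩ := hst.exists_tightCell_ne hAB hP
  have mem_iff : ∀ x ∈ P, x ∈ A i ↔ x ∈ B j' := fun x hx =>
    (c.mem_iff_of_stuck c' hi hj hAB hst hx).1
  obtain ⟨p, hp, hpi⟩ := hAB.left.exists_mem_of_tight c.left c.mem c.mem_left
  have hpj' := (mem_iff p hp).1 hpi
  have hQ : Q ∩ (A i ∩ B j') = ∅ := by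
    rw [Finset.eq_empty_iff_forall_notMem]
    intro x hx
    simp only [Finset.mem_inter] at hx
    have cx : TightCell Q A s B t i j' x := ⟨c.left, c'.right, hx.1, hx.2.1, hx.2.2⟩
    exact cx.notMem_of_stuck hAB hst hp hpi hpj'
  refine ⟨(P ∩ (A i ∩ B j')).card, i, i', j', j, ?_, ?_, ?_, ?_⟩
  · exact c.tightPartition_of_stuck c' hi hj hAB hst hP
  · exact c'.symm.tightPartition_of_stuck c.symm hj.symm hi.symm hAB.symm hst.symm hP
  · rw [hQ, Finset.card_empty, zero_add]
  · exact Finset.card_pos.2 ⟨p, by simp only [Finset.mem_inter, hp, hpi, hpj', and_self]⟩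

/-- Every exchange that is allowed by both systems leads to an obstruction. -/
def AlwaysObstructed (P Q : Finset α) (A : ι → Finset α) (s : ι → ℤ) (B : κ → Finset α)
    (t : κ → ℤ) : Prop :=
  ∀ x ∈ P, ∀ y ∈ Q, Allowed A s x y → Allowed B t x y →
    ∃ d, Obstructed (P.erase x) (Q.erase y) A (nextSlack A s x y) B (nextSlack B t x y) d

lemma AlwaysObstructed.swap (H : AlwaysObstructed P Q A s B t) : AlwaysObstructed P Q B t A s := by
  intro x hx y hy hb ha
  obtain ⟨d, i₁, i₂, j₁, j₂, h⟩ := H x hx y hy ha hb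
  exact ⟨d, j₁, j₂, i₁, i₂, h.swap⟩

/-- The exchange of `p` and `q` is allowed by both systems and leads to an obstruction. -/
structure LeadsToObstruction (P Q : Finset α) (A : ι → Finset α) (s : ι → ℤ) (B : κ → Finset α)
    (t : κ → ℤ) (p q : α) (i₁ i₂ : ι) (j₁ j₂ : κ) (d : ℕ) : Prop where
  pair : SplitPair P Q A s B t
  memP : p ∈ P
  memQ : q ∈ Q
  allowedA : Allowed A s p q
  allowedB : Allowed B t p q
  obs : Obstruction (P.erase p) (Q.erase q) A (nextSlack A s p q) B (nextSlack B t p q)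
    i₁ i₂ j₁ j₂ d

namespace LeadsToObstruction

lemma flip (h : LeadsToObstruction P Q A s B t p q i₁ i₂ j₁ j₂ d) :
    LeadsToObstruction P Q A s B t p q i₂ i₁ j₂ j₁ d :=
  { h with obs := h.obs.flip (h.pair.next h.memP h.memQ h.allowedA h.allowedB) }

lemma swap (h : LeadsToObstruction P Q A s B t p q i₁ i₂ j₁ j₂ d) :
    LeadsToObstruction P Q B t A s p q j₁ j₂ i₁ i₂ d :=
  ⟨h.pair.symm, h.memP, h.memQ, h.allowedB, h.allowedA, h.obs.swap⟩

lemma exists_corners (h : LeadsToObstruction P Q A s B t p q i₁ i₂ j₁ j₂ d) :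
    ∃ x₁ x₂ y₁ y₂, Corners (P.erase p) (Q.erase q) A B i₁ i₂ j₁ j₂ x₁ x₂ y₁ y₂ :=
  h.obs.exists_corners (h.pair.next h.memP h.memQ h.allowedA h.allowedB)

lemma slack_left (h : LeadsToObstruction P Q A s B t p q i₁ i₂ j₁ j₂ d) (hi₁ : s i₁ ≠ 0) :
    s i₁ = 1 ∧ p ∉ A i₁ ∧ q ∈ A i₁ :=
  nextSlack_eq_one_of_nonneg_of_eq_zero (h.pair.left.nonneg i₁) h.obs.fst.left hi₁

/- Exchanging `x` and `y₁` makes `A i₁` tight, so `A i₁` belongs to a tight partition with some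
`A k`. As `y₂` lies in `A k ∩ A i₂` and `x₁` outside of `A k ∪ A i₂`, the slacks of `A k` and `A i₂`
should sum to at least `2`. -/
lemma not_allowed (h : LeadsToObstruction P Q A s B t p q i₁ i₂ j₁ j₂ d)
    (H : AlwaysObstructed P Q A s B t)
    (c : Corners (P.erase p) (Q.erase q) A B i₁ i₂ j₁ j₂ x₁ x₂ y₁ y₂) (hi₁ : s i₁ ≠ 0)
    (hx : x ∈ P) (hxi₁ : x ∉ A i₁) (hi₂ : nextSlack A s x y₁ i₂ = 1) : ¬ Allowed B t x y₁ := by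
  intro hb
  obtain ⟨hs, -, hqi₁⟩ := h.slack_left hi₁
  obtain ⟨hy₁, hy₁i₁, -⟩ := c.y₁_mem
  obtain ⟨hy₁q, hy₁Q⟩ := Finset.mem_erase.1 hy₁
  have ha := h.pair.left.allowed_of_slack_eq_one hs hx hxi₁ hy₁Q hy₁i₁
  have hsys := h.pair.left.next hx hy₁Q ha
  have htight : nextSlack A s x y₁ i₁ = 0 := by simp [nextSlack, hs, hxi₁, hy₁i₁]
  obtain ⟨d', k₁, k₂, l₁, l₂, hobs⟩ := H x hx y₁ hy₁Q ha hb
  obtain ⟨k, hk⟩ := hobs.fst.exists_right hsys htight (Finset.mem_erase.2 ⟨hy₁q.symm, h.memQ⟩) hqi₁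
  have hki₂ : k ≠ i₂ := by
    rintro rfl
    exact absurd hk.right (by omega)
  obtain ⟨hy₂, hy₂i₂, -⟩ := c.y₂_mem
  have hy₂i₁ : y₂ ∉ A i₁ := (h.obs.fst.memQ y₂ hy₂).1 hy₂i₂
  have hy₂' : y₂ ∈ Q.erase y₁ :=
    Finset.mem_erase.2 ⟨fun e => hy₂i₁ (e ▸ hy₁i₁), Finset.mem_of_mem_erase hy₂⟩
  obtain ⟨hx₁, hx₁i₁, -⟩ := c.x₁_mem
  have hx₁' : x₁ ∈ P.erase x :=
    Finset.mem_erase.2 ⟨fun e => hxi₁ (e ▸ hx₁i₁), Finset.mem_of_mem_erase hx₁⟩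
  refine (h.obs.fst.memP x₁ hx₁).1 ?_ hx₁i₁
  exact hsys.mem_of_add_le_one hki₂ (by rw [hk.right, hi₂]; rfl) hy₂'
    ((hk.memQ y₂ hy₂').2 hy₂i₁) hy₂i₂ hx₁' fun hx₁k => (hk.memP x₁ hx₁').1 hx₁k hx₁i₁

lemma allowed_or_allowed (h : LeadsToObstruction P Q A s B t p q i₁ i₂ j₁ j₂ d)
    (c : Corners (P.erase p) (Q.erase q) A B i₁ i₂ j₁ j₂ x₁ x₂ y₁ y₂) :
    Allowed B t p y₁ ∨ Allowed B t p y₂ := by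
  have hy₁ := Finset.mem_of_mem_erase c.y₁_mem.1
  have hy₂ := Finset.mem_of_mem_erase c.y₂_mem.1
  by_cases hj₁ : t j₁ = 0
  · by_cases hj₂ : t j₂ = 0
    · by_cases hpj₁ : p ∈ B j₁
      · exact Or.inr (h.pair.right.allowed_of_mem_tight hj₁ hpj₁ hy₂ c.y₂_mem.2.2)
      · have hpj₂ := h.pair.right.mem_of_add_le_zero h.obs.snd.ne (by omega) h.memP hpj₁
        exact Or.inl (h.pair.right.allowed_of_mem_tight hj₂ hpj₂ hy₁ c.y₁_mem.2.2)
    · obtain ⟨hs, hpj₂, -⟩ := h.flip.swap.slack_left hj₂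
      exact Or.inl (h.pair.right.allowed_of_slack_eq_one hs h.memP hpj₂ hy₁ c.y₁_mem.2.2)
  · obtain ⟨hs, hpj₁, -⟩ := h.swap.slack_left hj₁
    exact Or.inr (h.pair.right.allowed_of_slack_eq_one hs h.memP hpj₁ hy₂ c.y₂_mem.2.2)

lemma tight_or_tight (h : LeadsToObstruction P Q A s B t p q i₁ i₂ j₁ j₂ d)
    (H : AlwaysObstructed P Q A s B t) : s i₁ = 0 ∨ s i₂ = 0 := by
  by_contra! hs
  obtain ⟨x₁, x₂, y₁, y₂, c⟩ := h.exists_corners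
  obtain ⟨hs₁, hpi₁, -⟩ := h.slack_left hs.1
  obtain ⟨hs₂, hpi₂, -⟩ := h.flip.slack_left hs.2
  have hy₁ : y₁ ∉ A i₂ := fun e => (h.obs.fst.memQ y₁ c.y₁_mem.1).1 e c.y₁_mem.2.1
  have hy₂ : y₂ ∉ A i₁ := (h.obs.fst.memQ y₂ c.y₂_mem.1).1 c.y₂_mem.2.1
  rcases h.allowed_or_allowed c with hb | hb
  · exact h.not_allowed H c hs.1 h.memP hpi₁ (by simp [nextSlack, hs₂, hpi₂, hy₁]) hb
  · exact h.flip.not_allowed H c.flip hs.2 h.memP hpi₂ (by simp [nextSlack, hs₁, hpi₁, hy₂]) hb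

lemma tight (h : LeadsToObstruction P Q A s B t p q i₁ i₂ j₁ j₂ d)
    (H : AlwaysObstructed P Q A s B t) : s i₁ = 0 := by
  by_contra hi₁
  have hi₂ : s i₂ = 0 := (h.tight_or_tight H).resolve_left hi₁
  obtain ⟨x₁, x₂, y₁, y₂, c⟩ := h.exists_corners
  have hx₂ := Finset.mem_of_mem_erase c.x₂_mem.1
  have hx₂i₁ : x₂ ∉ A i₁ := (h.obs.fst.memP x₂ c.x₂_mem.1).1 c.x₂_mem.2.1
  have hy₁i₂ : y₁ ∉ A i₂ := fun e => (h.obs.fst.memQ y₁ c.y₁_mem.1).1 e c.y₁_mem.2.1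
  refine h.not_allowed H c hi₁ hx₂ hx₂i₁ (by simp [nextSlack, hi₂, c.x₂_mem.2.1, hy₁i₂]) ?_
  rcases h.swap.tight_or_tight H.swap with hj | hj
  · have hx₂j₁ := (h.obs.snd.memP x₂ c.x₂_mem.1).1 c.x₂_mem.2.2
    have hy₁j₁ := (h.obs.snd.memQ y₁ c.y₁_mem.1).1 c.y₁_mem.2.2
    exact h.pair.right.allowed_of_notMem_tight hj hx₂ hx₂j₁ hy₁j₁
  · exact h.pair.right.allowed_of_mem_tight hj c.x₂_mem.2.2 (Finset.mem_of_mem_erase c.y₁_mem.1)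
      c.y₁_mem.2.2

end LeadsToObstruction

theorem SplitPair.exists_allowed_not_obstructed (h : SplitPair P Q A s B t) (hP : P.Nonempty)
    (hno : ∀ d, ¬ Obstructed P Q A s B t d) :
    ∃ p ∈ P, ∃ q ∈ Q, Allowed A s p q ∧ Allowed B t p q ∧
      ∀ d, ¬ Obstructed (P.erase p) (Q.erase q) A (nextSlack A s p q) B (nextSlack B t p q) d := by
  by_contra! H
  change AlwaysObstructed P Q A s B t at H
  obtain ⟨p, hp, q, hq, ha, hb⟩ : ∃ p ∈ P, ∃ q ∈ Q, Allowed A s p q ∧ Allowed B t p q := by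
    by_contra! hst
    obtain ⟨d, hd⟩ := Stuck.exists_obstructed hst h hP
    exact hno d hd
  obtain ⟨d, i₁, i₂, j₁, j₂, hobs⟩ := H p hp q hq ha hb
  have hlead : LeadsToObstruction P Q A s B t p q i₁ i₂ j₁ j₂ d := ⟨h, hp, hq, ha, hb, hobs⟩
  exact hno d ⟨i₁, i₂, j₁, j₂, hobs.of_next h hp hq (hlead.tight H) (hlead.flip.tight H)
    (hlead.swap.tight H.swap) (hlead.flip.swap.tight H.swap)⟩

end SplitSystem

/-! ### Exchanges, tight sets, and the connectivity of matroids -/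

section Relation

variable {α : Type*} {r : α → α → Prop} {N K U W : Set α} {p q x y : α}

/-- No edge of the relation `r` on `N` joins `U` to its complement. -/
def Isolates (r : α → α → Prop) (N U : Set α) : Prop :=
  ∀ x y, r x y → x ∈ N → y ∈ N → (x ∈ U ↔ y ∈ U)

/-- The graph that the relation `r` induces on `W` is connected (or empty). -/
def ConnectedOn (r : α → α → Prop) (W : Set α) : Prop :=
  ∀ U ⊆ W, U.Nonempty → Isolates r W U → U = W

/-- The vertex set of the connected component of `p` in the graph that `r` induces on `N`. -/
def componentOn (r : α → α → Prop) (N : Set α) (p : α) : Set α :=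
  ⋂₀ {U | p ∈ U ∧ U ⊆ N ∧ Isolates r N U}

lemma Isolates.sdiff (h : Isolates r W U) : Isolates r W (W \ U) := fun x y hxy hx hy => by
  simp only [Set.mem_sdiff, hx, hy, true_and, h x y hxy hx hy]

lemma Isolates.trans (hW : Isolates r N W) (hU : Isolates r W U) (h : U ⊆ W) :
    Isolates r N U := by
  intro x y hxy hx hy
  have hxyW := hW x y hxy hx hy
  by_cases hxW : x ∈ W
  · exact hU x y hxy hxW (hxyW.1 hxW)
  · exact iff_of_false (fun e => hxW (h e)) fun e => hxW (hxyW.2 (h e))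

lemma ConnectedOn.exists_adj (h : ConnectedOn r W) (hx : x ∈ W) (hy : y ∈ W) (hxy : x ≠ y) :
    ∃ u ∈ W, r x u ∨ r u x := by
  by_contra! hcon
  have hiso : Isolates r W {x} := by
    intro a b hab ha hb
    refine iff_of_false ?_ ?_
    · rintro rfl
      exact (hcon b hb).1 hab
    · rintro rfl
      exact (hcon a ha).2 hab
  have hWx := h {x} (Set.singleton_subset_iff.2 hx) (Set.singleton_nonempty x) hiso
  exact hxy (Set.mem_singleton_iff.1 (hWx ▸ hy)).symm

lemma ConnectedOn.subset_or_disjoint (hW : ConnectedOn r W) (hU : Isolates r W U) :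
    W ⊆ U ∨ Disjoint W U := by
  rw [or_iff_not_imp_right, Set.not_disjoint_iff_nonempty_inter]
  intro hne
  refine Set.inter_eq_left.1 (hW _ Set.inter_subset_left hne fun x y hxy hx hy => ?_)
  simp only [Set.mem_inter_iff, hx, hy, true_and, hU x y hxy hx hy]

lemma mem_componentOn : p ∈ componentOn r N p := fun _ hU => hU.1

lemma componentOn_subset (hp : p ∈ N) : componentOn r N p ⊆ N :=
  Set.sInter_subset_of_mem ⟨hp, subset_rfl, fun _ _ _ hx hy => iff_of_true hx hy⟩

lemma isolates_componentOn : Isolates r N (componentOn r N p) := fun x y hxy hx hy =>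
  forall₂_congr fun _ hU => hU.2.2 x y hxy hx hy

lemma connectedOn_componentOn (hp : p ∈ N) : ConnectedOn r (componentOn r N p) := by
  intro U hU hne hiso
  have minimal : ∀ U' ⊆ componentOn r N p, p ∈ U' → Isolates r (componentOn r N p) U' →
      componentOn r N p ⊆ U' := fun U' hU' hpU' hiso' => Set.sInter_subset_of_mem
    ⟨hpU', hU'.trans (componentOn_subset hp), isolates_componentOn.trans hiso' hU'⟩
  by_cases hpU : p ∈ U
  · exact hU.antisymm (minimal U hU hpU hiso)
  · obtain ⟨u, hu⟩ := hne
    exact absurd hu (minimal _ Set.sdiff_subset ⟨mem_componentOn, hpU⟩ hiso.sdiff (hU hu)).2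

lemma Isolates.of_sdiff (h : Isolates r (K \ W) U) (hU : U ⊆ K \ W)
    (hUW : ∀ x y, r x y → x ∈ U → y ∉ W) (hWU : ∀ x y, r x y → x ∈ W → y ∉ U) :
    Isolates r K U := fun x y hxy hx hy =>
  ⟨fun hxU => (h x y hxy (hU hxU) ⟨hy, hUW x y hxy hxU⟩).1 hxU, fun hyU =>
    (h x y hxy ⟨hx, fun hxW => hWU x y hxy hxW hyU⟩ (hU hyU)).2 hyU⟩

/- `W` is the component of `p` after the deletion of `q` and its in-neighbours. Every component of
the rest of `K` contains `q`, as otherwise it would be a component of `K`. -/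
lemma ConnectedOn.exists_split (hK : ConnectedOn r K) (hr : ∀ x y z, r x y → ¬ r y z)
    (hp : p ∈ K) (hq : q ∈ K) (hpq : p ≠ q) (hno : ¬ r p q) :
    ∃ W ⊆ K, p ∈ W ∧ q ∉ W ∧ (∀ x, r x q → x ∉ W) ∧ (∀ x y, r x y → x ∈ W → y ∈ K → y ∈ W) ∧
      ConnectedOn r W ∧ ConnectedOn r (K \ W) := by
  set N := K \ {x | x = q ∨ r x q}
  have hpN : p ∈ N := ⟨hp, fun h => h.elim hpq hno⟩
  set W := componentOn r N p
  have hWN : W ⊆ N := componentOn_subset hpN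
  have hWiso : Isolates r N W := isolates_componentOn
  have hqW : q ∉ W := fun h => (hWN h).2 (Or.inl rfl)
  have hclosed : ∀ x y, r x y → x ∈ W → y ∈ K → y ∈ W := by
    intro x y hxy hx hy
    refine (hWiso x y hxy (hWN hx) ⟨hy, ?_⟩).1 hx
    rintro (rfl | h)
    · exact (hWN hx).2 (Or.inr hxy)
    · exact hr x y q hxy h
  have mem_of_isolates : ∀ U ⊆ K \ W, U.Nonempty → Isolates r (K \ W) U → q ∈ U := by
    intro U hU hne hiso
    by_contra hqU
    have hUN : U ⊆ N := by
      refine fun x hx => ⟨(hU hx).1, ?_⟩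
      rintro (rfl | hxq)
      · exact hqU hx
      · exact hqU ((hiso x q hxq (hU hx) ⟨hq, hqW⟩).1 hx)
    have hKU : Isolates r K U := hiso.of_sdiff hU
      (fun x y hxy hx hyW => (hU hx).2 ((hWiso x y hxy (hUN hx) (hWN hyW)).2 hyW))
      fun x y hxy hxW hy => (hU hy).2 (hclosed x y hxy hxW (hU hy).1)
    exact hqU (hK U (hU.trans Set.sdiff_subset) hne hKU ▸ hq)
  refine ⟨W, hWN.trans Set.sdiff_subset, mem_componentOn, hqW, fun x hxq hx => (hWN hx).2
    (Or.inr hxq), hclosed, connectedOn_componentOn hpN, fun U hU hne hiso => ?_⟩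
  by_contra hne'
  have hrest : ((K \ W) \ U).Nonempty := Set.sdiff_nonempty.2 fun h => hne' (hU.antisymm h)
  exact (mem_of_isolates _ Set.sdiff_subset hrest hiso.sdiff).2 (mem_of_isolates U hU hne hiso)

end Relation

section Exchange

variable {α : Type*} {M : Matroid α} {I X B F W : Set α} {p q x y z : α}

/-- Replacing `p` by `q` in the base `X` yields a base. -/
def IsExchange (M : Matroid α) (X : Set α) (p q : α) : Prop :=
  p ∈ X ∧ q ∉ X ∧ M.IsBase (insert q (X \ {p}))

/-- No exchange of the base `X` leads out of `W`. -/
def IsClosedAt (M : Matroid α) (X W : Set α) : Prop :=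
  ∀ x y, IsExchange M X x y → x ∈ W → y ∈ W

/-- The rank of a set as a natural number. -/
noncomputable def rk (M : Matroid α) (F : Set α) : ℕ := (M.eRk F).toNat

lemma IsExchange.not_isExchange (h : IsExchange M X x y) : ¬ IsExchange M X y z :=
  fun h' => h.2.1 h'.1

lemma isExchange_of_mem_fundCircuit (hE : M.E = Set.univ) (hX : M.IsBase X) (hp : p ∈ X)
    (hq : q ∉ X) (h : p ∈ M.fundCircuit q X) : IsExchange M X p q := by
  have hpq : q ≠ p := fun e => hq (e ▸ hp)
  have hind : M.Indep (insert q X \ {p}) :=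
    (hX.indep.mem_fundCircuit_iff (by simp [hX.closure_eq, hE]) hq).1 h
  rw [← Set.insert_sdiff_singleton_comm hpq] at hind
  exact ⟨hp, hq, hX.exchange_isBase_of_indep hq hind⟩

variable [Finite α]

lemma cast_rk (M : Matroid α) (F : Set α) : (rk M F : ℕ∞) = M.eRk F :=
  ENat.natCast_toNat ((M.eRk_le_encard F).trans_lt (Set.toFinite F).encard_lt_top).ne

lemma ncard_le_rk (hI : M.Indep I) (hIF : I ⊆ F) : I.ncard ≤ rk M F := by
  have h := hI.encard_le_eRk_of_subset hIF
  rw [← cast_rk, ← (Set.toFinite I).cast_ncard_eq] at h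
  exact_mod_cast h

lemma ncard_eq_rk_of_isBasis (hI : M.IsBasis I F) : I.ncard = rk M F := by
  have h := hI.encard_eq_eRk
  rw [← cast_rk, ← (Set.toFinite I).cast_ncard_eq] at h
  exact_mod_cast h

lemma ncard_inter_le_rk (hX : M.IsBase X) (F : Set α) : (X ∩ F).ncard ≤ rk M F :=
  ncard_le_rk (hX.indep.subset Set.inter_subset_left) Set.inter_subset_right

lemma exists_isBase_ncard_inter_eq (hE : M.E = Set.univ) (F : Set α) :
    ∃ B, M.IsBase B ∧ (B ∩ F).ncard = rk M F := by
  obtain ⟨I, hI⟩ := M.exists_isBasis F (by simp [hE])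
  obtain ⟨B, hB, rfl⟩ := hI.exists_isBase
  exact ⟨B, hB, ncard_eq_rk_of_isBasis hI⟩

lemma ncard_inter_add_ncard_inter_compl (X U : Set α) :
    (X ∩ U).ncard + (X ∩ Uᶜ).ncard = X.ncard := by
  rw [← Set.sdiff_eq, Set.ncard_inter_add_ncard_sdiff_eq_ncard X U (Set.toFinite X)]

open Classical in
lemma ncard_inter_exchange (hp : p ∈ X) (hq : q ∉ X) (F : Set α) :
    (((insert q (X \ {p})) ∩ F).ncard : ℤ) =
      (X ∩ F).ncard + (if q ∈ F then 1 else 0) - (if p ∈ F then 1 else 0) := by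
  have hinsert : ((insert q (X \ {p})) ∩ F).ncard =
      ((X ∩ F) \ {p}).ncard + (if q ∈ F then 1 else 0) := by
    rw [Set.inter_sdiff_right_comm]
    split_ifs with h
    · rw [Set.insert_inter_of_mem h, Set.ncard_insert_of_notMem fun hh => hq hh.1.1]
    · rw [Set.insert_inter_of_notMem h, add_zero]
  rw [hinsert]
  by_cases hpF : p ∈ F
  · have := Set.ncard_sdiff_singleton_add_one (a := p) (s := X ∩ F) ⟨hp, hpF⟩
    rw [if_pos hpF]
    push_cast
    omega
  · rw [Set.sdiff_singleton_eq_self fun hh => hpF hh.2, if_neg hpF]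
    simp

lemma mem_of_isExchange_of_ncard_inter_eq (h : (X ∩ F).ncard = rk M F) (hpq : IsExchange M X p q)
    (hq : q ∈ F) : p ∈ F := by
  by_contra hp
  have hle := ncard_inter_le_rk hpq.2.2 F
  have hcard := ncard_inter_exchange hpq.1 hpq.2.1 F
  rw [if_pos hq, if_neg hp] at hcard
  omega

lemma ncard_inter_eq_rk (hE : M.E = Set.univ) (hX : M.IsBase X)
    (h : ∀ p q, IsExchange M X p q → q ∈ F → p ∈ F) : (X ∩ F).ncard = rk M F := by
  have hind : M.Indep (X ∩ F) := hX.indep.subset Set.inter_subset_left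
  refine ncard_eq_rk_of_isBasis
    (hind.isBasis_of_subset_of_subset_closure Set.inter_subset_right fun q hq => ?_)
  by_cases hqX : q ∈ X
  · exact M.mem_closure_of_mem ⟨hqX, hq⟩ (by simp [hE])
  · have hcircuit : M.IsCircuit (M.fundCircuit q X) :=
      hX.fundCircuit_isCircuit (by simp [hE]) hqX
    refine M.closure_subset_closure (fun p hp => ?_)
      (hcircuit.mem_closure_sdiff_singleton_of_mem (M.mem_fundCircuit q X))
    have hpX : p ∈ X := (M.fundCircuit_subset_insert q X hp.1).resolve_left hp.2
    exact ⟨hpX, h p q (isExchange_of_mem_fundCircuit hE hX hpX hqX hp.1) hq⟩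

lemma IsClosedAt.ncard_inter_compl (hE : M.E = Set.univ) (h : IsClosedAt M X W)
    (hX : M.IsBase X) : (X ∩ Wᶜ).ncard = rk M Wᶜ :=
  ncard_inter_eq_rk hE hX fun p q hpq hq hp => hq (h p q hpq hp)

lemma IsClosedAt.ncard_inter_le (hE : M.E = Set.univ) (h : IsClosedAt M X W) (hX : M.IsBase X)
    (hB : M.IsBase B) : (X ∩ W).ncard ≤ (B ∩ W).ncard := by
  have hXr := h.ncard_inter_compl hE hX
  have hBr := ncard_inter_le_rk hB Wᶜ
  have hcard := hX.ncard_eq_ncard_of_isBase hB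
  have hXW := ncard_inter_add_ncard_inter_compl X W
  have hBW := ncard_inter_add_ncard_inter_compl B W
  omega

lemma IsClosedAt.of_ncard_inter_eq (hE : M.E = Set.univ) (h : IsClosedAt M X W)
    (hX : M.IsBase X) (hB : M.IsBase B) (hBW : (B ∩ W).ncard = (X ∩ W).ncard) :
    IsClosedAt M B W := by
  have hXr := h.ncard_inter_compl hE hX
  have hcard := hX.ncard_eq_ncard_of_isBase hB
  have hXW := ncard_inter_add_ncard_inter_compl X W
  have hBW' := ncard_inter_add_ncard_inter_compl B W
  have hBr : (B ∩ Wᶜ).ncard = rk M Wᶜ := by omega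
  intro x y hxy hx
  by_contra hy
  exact mem_of_isExchange_of_ncard_inter_eq hBr hxy hy hx

end Exchange

section Component

variable {α : Type*} {M : Matroid α} {X U : Set α} {p q x y z : α}

/-- All bases have the same number of elements in the separator `U`. -/
def IsSeparator (M : Matroid α) (U : Set α) : Prop :=
  ∀ B, M.IsBase B → (B ∩ U).ncard = rk M U

/-- No separator contains exactly one of `x` and `y`. -/
def SameComponent (M : Matroid α) (x y : α) : Prop := ∀ U, IsSeparator M U → (x ∈ U ↔ y ∈ U)

/-- The connected component of the matroid that contains `x`. -/
def component (M : Matroid α) (x : α) : Set α := {y | SameComponent M x y}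

lemma SameComponent.symm (h : SameComponent M x y) : SameComponent M y x :=
  fun U hU => (h U hU).symm

lemma SameComponent.trans (h : SameComponent M x y) (h' : SameComponent M y z) :
    SameComponent M x z := fun U hU => (h U hU).trans (h' U hU)

lemma mem_component_self (M : Matroid α) (x : α) : x ∈ component M x := fun _ _ => Iff.rfl

lemma component_eq (h : SameComponent M x y) : component M x = component M y :=
  Set.ext fun _ => ⟨h.symm.trans, h.trans⟩

lemma IsSeparator.component_subset (hU : IsSeparator M U) (hx : x ∈ U) : component M x ⊆ U :=
  fun _ hy => (hy U hU).1 hx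

variable [Finite α]

lemma isSeparator_of_isClosedAt (hE : M.E = Set.univ) (hX : M.IsBase X) (hU : IsClosedAt M X U)
    (hU' : IsClosedAt M X Uᶜ) : IsSeparator M U := by
  intro B hB
  have hXr := hU'.ncard_inter_compl hE hX
  have hXB := hU.ncard_inter_le hE hX hB
  have hBr := ncard_inter_le_rk hB U
  rw [compl_compl] at hXr
  omega

lemma isSeparator_univ (hE : M.E = Set.univ) : IsSeparator M (Set.univ : Set α) := by
  obtain ⟨X, hX⟩ := M.exists_isBase
  exact isSeparator_of_isClosedAt hE hX (fun _ _ _ _ => trivial) fun _ _ _ h => absurd trivial h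

lemma IsSeparator.mem_iff (hU : IsSeparator M U) (hX : M.IsBase X) (h : IsExchange M X p q) :
    p ∈ U ↔ q ∈ U := by
  have hcard := ncard_inter_exchange h.1 h.2.1 U
  rw [hU _ h.2.2, hU X hX] at hcard
  split_ifs at hcard with hq hp hp
  · exact iff_of_true hp hq
  · omega
  · omega
  · exact iff_of_false hp hq

lemma IsExchange.sameComponent (hX : M.IsBase X) (h : IsExchange M X p q) :
    SameComponent M p q := fun _ hU => hU.mem_iff hX h

lemma isSeparator_component (hE : M.E = Set.univ) (x : α) : IsSeparator M (component M x) := by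
  obtain ⟨X, hX⟩ := M.exists_isBase
  exact isSeparator_of_isClosedAt hE hX (fun p q h hp => hp.trans (h.sameComponent hX))
    fun p q h hp hq => hp (hq.trans (h.sameComponent hX).symm)

lemma connectedOn_component (hE : M.E = Set.univ) (hX : M.IsBase X) (z : α) :
    ConnectedOn (IsExchange M X) (component M z) := by
  rintro U hU ⟨u, hu⟩ h
  have hiso : ∀ x y, IsExchange M X x y → (x ∈ U ↔ y ∈ U) := fun x y hxy => by
    have hmem := (isSeparator_component hE z).mem_iff hX hxy
    by_cases hx : x ∈ component M z
    · exact h x y hxy hx (hmem.1 hx)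
    · exact iff_of_false (fun e => hx (hU e)) fun e => hx (hmem.2 (hU e))
  have hsep : IsSeparator M U := isSeparator_of_isClosedAt hE hX (fun x y hxy => (hiso x y hxy).1)
    fun x y hxy hx hy => hx ((hiso x y hxy).2 hy)
  refine hU.antisymm ?_
  rw [component_eq (hU hu)]
  exact hsep.component_subset hu

end Component

section Cut

variable {α : Type*} {M : Matroid α} {X Y B K W W' : Set α} {p q : α}

/-- A cut `W` of the component `K` of a matroid, at the base `X`: no exchange leads from `W` to
`K \ W`, both parts are connected by exchanges, and each part meets both `X` and its complement.
The complements of the cuts are the flacets that matter here, see `IsCut.isSplitFlacet`. -/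
structure IsCut (M : Matroid α) (X K W : Set α) : Prop where
  isBase : M.IsBase X
  eq_component : ∃ z, K = component M z
  subset : W ⊆ K
  isClosedAt : IsClosedAt M X W
  connectedOn : ConnectedOn (IsExchange M X) W
  connectedOn_sdiff : ConnectedOn (IsExchange M X) (K \ W)
  inter_nonempty : (W ∩ X).Nonempty
  sdiff_nonempty : (W \ X).Nonempty
  compl_inter_nonempty : ((K \ W) ∩ X).Nonempty
  compl_sdiff_nonempty : ((K \ W) \ X).Nonempty

lemma IsCut.subset_of_isClosedAt (h : IsCut M X K W) (h' : IsCut M Y K W')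
    (hW : IsClosedAt M Y W) (hsub : W \ W' ⊆ Y) : W ⊆ W' := by
  by_contra hcon
  have heq := h'.connectedOn_sdiff (W \ W') (Set.sdiff_subset_sdiff_left h.subset)
    (Set.sdiff_nonempty.2 hcon) fun x y hxy _ hy => by
      refine iff_of_false (fun hxU => ?_) fun hyU => hxy.2.1 (hsub hyU)
      exact hxy.2.1 (hsub ⟨hW x y hxy hxU.1, hy.2⟩)
  obtain ⟨z, hz, hzY⟩ := h'.compl_sdiff_nonempty
  exact hzY (hsub (heq ▸ hz))

lemma IsCut.superset_of_isClosedAt (h' : IsCut M Y K W') (hW : IsClosedAt M Y W)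
    (hsub : Y ∩ W' ⊆ W) : W' ⊆ W := by
  by_contra hcon
  have heq := h'.connectedOn (W' \ W) Set.sdiff_subset (Set.sdiff_nonempty.2 hcon)
    fun x y hxy hx _ => by
      have hxW : x ∈ W := hsub ⟨hxy.1, hx⟩
      exact iff_of_false (fun e => e.2 hxW) fun e => e.2 (hW x y hxy hxW)
  obtain ⟨z, hz, hzY⟩ := h'.inter_nonempty
  have hzW' : z ∈ W' \ W := heq.symm ▸ hz
  exact hzW'.2 (hsub ⟨hzY, hz⟩)

lemma IsCut.component_eq_or_disjoint (h : IsCut M X K W) (x : α) :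
    component M x = K ∨ Disjoint (component M x) W := by
  rw [or_iff_not_imp_right, Set.not_disjoint_iff]
  rintro ⟨j, hj, hjW⟩
  obtain ⟨z, rfl⟩ := h.eq_component
  rw [component_eq hj, component_eq (h.subset hjW)]

variable [Finite α]

theorem exists_isCut (hE : M.E = Set.univ) (hX : M.IsBase X) (hp : p ∈ X) (hq : q ∉ X)
    (hpq : SameComponent M p q) (hno : ¬ IsExchange M X p q) :
    ∃ W, IsCut M X (component M p) W ∧ p ∈ W ∧ q ∉ W := by
  have hpK := mem_component_self M p
  have hqK : q ∈ component M p := hpq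
  have hne : p ≠ q := fun e => hq (e ▸ hp)
  have hK := connectedOn_component hE hX p
  obtain ⟨u, -, hu⟩ := hK.exists_adj hpK hqK hne
  obtain ⟨v, hvK, hv⟩ := hK.exists_adj hqK hpK hne.symm
  replace hu : IsExchange M X p u := hu.resolve_right fun h => h.2.1 hp
  replace hv : IsExchange M X v q := hv.resolve_left fun h => hq h.1
  obtain ⟨W, hWK, hpW, hqW, hin, hout, hconn, hconn'⟩ :=
    hK.exists_split (fun _ _ _ => IsExchange.not_isExchange) hpK hqK hne hno
  have hclosed : IsClosedAt M X W := fun x y hxy hx =>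
    hout x y hxy hx ((hWK hx).trans (hxy.sameComponent hX))
  exact ⟨W, ⟨hX, ⟨p, rfl⟩, hWK, hclosed, hconn, hconn', ⟨p, hpW, hp⟩,
    ⟨u, hclosed p u hu hpW, hu.2.1⟩, ⟨v, ⟨hvK, hin v hv⟩, hv.1⟩, ⟨q, ⟨hqK, hqW⟩, hq⟩⟩, hpW, hqW⟩

lemma IsCut.ncard_inter_le (hE : M.E = Set.univ) (h : IsCut M X K W) (hB : M.IsBase B) :
    (X ∩ W).ncard ≤ (B ∩ W).ncard :=
  h.isClosedAt.ncard_inter_le hE h.isBase hB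

lemma IsCut.isClosedAt_of_ncard_eq (hE : M.E = Set.univ) (h : IsCut M X K W) (hB : M.IsBase B)
    (hBW : (B ∩ W).ncard = (X ∩ W).ncard) : IsClosedAt M B W :=
  h.isClosedAt.of_ncard_inter_eq hE h.isBase hB hBW

lemma IsCut.eq_of_ncard_sdiff_le (hE : M.E = Set.univ) (h : IsCut M X K W) (h' : IsCut M Y K W')
    (hle : (W \ W').ncard + (Y ∩ W').ncard ≤ (X ∩ W).ncard) : W = W' := by
  have hmin := h.ncard_inter_le hE h'.isBase
  have hsplit := Set.ncard_inter_add_ncard_sdiff_eq_ncard (Y ∩ W) W' (Set.toFinite _)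
  have hinter : (Y ∩ W) ∩ W' ⊆ Y ∩ W' := Set.inter_subset_inter_left _ Set.inter_subset_left
  have hsdiff : (Y ∩ W) \ W' ⊆ W \ W' := Set.sdiff_subset_sdiff_left Set.inter_subset_right
  have hinter_card := Set.ncard_le_ncard hinter (Set.toFinite _)
  have hsdiff_card := Set.ncard_le_ncard hsdiff (Set.toFinite _)
  have hinter_eq := Set.eq_of_subset_of_ncard_le hinter (by omega)
  have hsdiff_eq := Set.eq_of_subset_of_ncard_le hsdiff (by omega)
  have hW := h.isClosedAt_of_ncard_eq hE h'.isBase (by omega)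
  refine (h.subset_of_isClosedAt h' hW ?_).antisymm (h'.superset_of_isClosedAt hW ?_)
  · exact hsdiff_eq.ge.trans (Set.sdiff_subset.trans Set.inter_subset_left)
  · exact hinter_eq.ge.trans (Set.inter_subset_left.trans Set.inter_subset_right)

lemma IsCut.connected (hE : M.E = Set.univ) (h : IsCut M X K W) :
    ConnectedOn (IsExchange M X) K := by
  obtain ⟨z, rfl⟩ := h.eq_component
  exact connectedOn_component hE h.isBase z

lemma IsCut.not_isClosedAt_sdiff (hE : M.E = Set.univ) (h : IsCut M X K W) :
    ¬ IsClosedAt M X (K \ W) := by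
  intro hcl
  have heq := h.connected hE W h.subset (h.inter_nonempty.mono Set.inter_subset_left)
    fun x y hxy hx _ => ⟨h.isClosedAt x y hxy, fun hyW => by
      by_contra hxW
      exact (hcl x y hxy ⟨hx, hxW⟩).2 hyW⟩
  obtain ⟨w, hw, -⟩ := h.compl_inter_nonempty
  exact hw.2 (heq.symm ▸ hw.1)

lemma IsCut.exists_crossing (hE : M.E = Set.univ) (h : IsCut M X K W) :
    ∃ p q, IsExchange M X p q ∧ p ∉ W ∧ q ∈ W := by
  by_contra! hcon
  refine h.not_isClosedAt_sdiff hE fun x y hxy hx => ⟨?_, hcon x y hxy hx.2⟩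
  obtain ⟨z, rfl⟩ := h.eq_component
  exact hx.1.trans (hxy.sameComponent h.isBase)

lemma IsCut.isFlat (hE : M.E = Set.univ) (h : IsCut M X K W) : M.IsFlat Wᶜ := by
  rw [Matroid.isFlat_iff_closure_eq]
  refine Set.Subset.antisymm (fun q hq hqW => ?_) (M.subset_closure _ (by simp [hE]))
  have hind : M.Indep (insert q (X ∩ Wᶜ)) := by
    by_cases hqX : q ∈ X
    · exact h.isBase.indep.subset (Set.insert_subset hqX Set.inter_subset_left)
    · obtain ⟨y, hy, hyX⟩ := h.inter_nonempty
      obtain ⟨u, hu, huq⟩ := h.connectedOn.exists_adj hqW hy fun e => hqX (e ▸ hyX)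
      replace huq : IsExchange M X u q := huq.resolve_left fun e => hqX e.1
      refine huq.2.2.indep.subset (Set.insert_subset_insert fun x hx => ⟨hx.1, ?_⟩)
      rintro rfl
      exact hx.2 hu
  have hsub : insert q (X ∩ Wᶜ) ⊆ M.closure Wᶜ :=
    Set.insert_subset hq (Set.inter_subset_right.trans (M.subset_closure _ (by simp [hE])))
  have hcard := ncard_le_rk hind hsub
  rw [rk, M.eRk_closure_eq, ← rk, ← h.isClosedAt.ncard_inter_compl hE h.isBase,
    Set.ncard_insert_of_notMem fun e => e.2 hqW] at hcard
  omega

lemma IsCut.disjoint_of_isClosedAt (hE : M.E = Set.univ) (h : IsCut M X K W)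
    (hW' : IsClosedAt M X W') (hsub : W ∩ W' ⊆ X) : Disjoint W W' := by
  rw [Set.disjoint_iff_inter_eq_empty, ← Set.not_nonempty_iff_eq_empty]
  intro hne
  have heq := h.connected hE (W ∩ W') (Set.inter_subset_left.trans h.subset) hne
    fun x y hxy _ _ => by
      refine iff_of_false (fun e => ?_) fun e => hxy.2.1 (hsub e)
      exact hxy.2.1 (hsub ⟨h.isClosedAt x y hxy e.1, hW' x y hxy e.2⟩)
  obtain ⟨z, hz, hzX⟩ := h.sdiff_nonempty
  exact hzX (hsub (heq.symm ▸ h.subset hz))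

lemma IsCut.subset_union_of_isClosedAt (hE : M.E = Set.univ) (h : IsCut M X K W)
    (hW' : IsClosedAt M X W') (hcov : X ∩ K ⊆ W ∪ W') : K ⊆ W ∪ W' := by
  by_contra hcon
  have heq := h.connected hE (K \ (W ∪ W')) Set.sdiff_subset
    (Set.sdiff_nonempty.2 hcon) fun x y hxy hx _ => by
      have hxW := hcov ⟨hxy.1, hx⟩
      refine iff_of_false (fun e => e.2 hxW) fun e => e.2 ?_
      exact hxW.imp (h.isClosedAt x y hxy) (hW' x y hxy)
  obtain ⟨z, hz, -⟩ := h.inter_nonempty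
  have hzK : z ∈ K \ (W ∪ W') := heq.symm ▸ h.subset hz
  exact hzK.2 (Or.inl hz)

lemma IsCut.lt_ncard_inter_add (hE : M.E = Set.univ) (h : IsCut M X K W) (h' : IsCut M Y K W') :
    (X ∩ W).ncard + (Y ∩ W').ncard < (W ∩ W').ncard + (X ∩ K).ncard := by
  by_contra! hle
  have hmin := h'.ncard_inter_le hE h.isBase
  have hsum := Set.ncard_union_add_ncard_inter (X ∩ W) (X ∩ W') (Set.toFinite _) (Set.toFinite _)
  rw [← Set.inter_union_distrib_left, ← Set.inter_inter_distrib_left] at hsum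
  have hunion : X ∩ (W ∪ W') ⊆ X ∩ K :=
    Set.inter_subset_inter_right X (Set.union_subset h.subset h'.subset)
  have hunion_card := Set.ncard_le_ncard hunion (Set.toFinite _)
  have hinter : X ∩ (W ∩ W') ⊆ W ∩ W' := Set.inter_subset_right
  have hinter_card := Set.ncard_le_ncard hinter (Set.toFinite _)
  have hunion_eq := Set.eq_of_subset_of_ncard_le hunion (by omega)
  have hinter_eq := Set.eq_of_subset_of_ncard_le hinter (by omega)
  have hW' := h'.isClosedAt_of_ncard_eq hE h.isBase (by omega)
  have hdisj := h.disjoint_of_isClosedAt hE hW' (hinter_eq.ge.trans Set.inter_subset_left)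
  have hcov := h.subset_union_of_isClosedAt hE hW' (hunion_eq.ge.trans Set.inter_subset_right)
  refine h.not_isClosedAt_sdiff hE fun x y hxy hx => ?_
  have hy := hW' x y hxy ((hcov hx.1).resolve_left hx.2)
  exact ⟨h'.subset hy, fun hyW => hdisj.le_bot ⟨hyW, hy⟩⟩

end Cut

/-! ### Facets of the base polytope -/

section LinearAlgebra

variable {α R : Type*} [Ring R]

lemma ConnectedOn.single_sub_single_mem [DecidableEq α] {r : α → α → Prop} {W : Set α}
    {S : Submodule R (α → R)} {i j : α} (h : ConnectedOn r W)
    (hS : ∀ x y, r x y → x ∈ W → y ∈ W → Pi.single y 1 - Pi.single x (1 : R) ∈ S)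
    (hi : i ∈ W) (hj : j ∈ W) : Pi.single i 1 - Pi.single j (1 : R) ∈ S := by
  have hiso : Isolates r W {k | Pi.single i 1 - Pi.single k (1 : R) ∈ S} := by
    intro x y hxy hx hy
    have hedge := hS x y hxy hx hy
    constructor
    · intro hmem
      simpa using S.sub_mem hmem hedge
    · intro hmem
      simpa using S.add_mem hmem hedge
  rcases h.subset_or_disjoint hiso with hsub | hdisj
  · exact hsub hj
  · exact absurd (by simp) (Set.disjoint_left.1 hdisj hi)

open Classical in
/-- The total weight of the coordinates in a set. -/
noncomputable def weight [Fintype α] (U : Set α) : (α → ℝ) →ₗ[ℝ] ℝ :=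
  ∑ i with i ∈ U, LinearMap.proj i

variable [Fintype α] {U V : Set α} {x y : α → ℝ}

open Classical in
lemma weight_apply (U : Set α) (x : α → ℝ) : weight U x = ∑ i with i ∈ U, x i := by
  simp [weight]

lemma weight_congr (h : ∀ i ∈ U, x i = y i) : weight U x = weight U y := by
  classical
  rw [weight_apply, weight_apply]
  exact Finset.sum_congr rfl fun i hi => h i (Finset.mem_filter.1 hi).2

lemma weight_union (h : Disjoint U V) (x : α → ℝ) :
    weight (U ∪ V) x = weight U x + weight V x := by
  classical
  simp only [weight_apply, Set.mem_union, Finset.filter_or]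
  exact Finset.sum_union (Finset.disjoint_filter.2 fun i _ hU hV => h.le_bot ⟨hU, hV⟩)

lemma weight_inter_add_weight_sdiff (U V : Set α) (x : α → ℝ) :
    weight (U ∩ V) x + weight (U \ V) x = weight U x := by
  rw [← weight_union Set.disjoint_sdiff_inter.symm, Set.inter_union_sdiff]

lemma weight_sdiff (h : U ⊆ V) (x : α → ℝ) : weight (V \ U) x = weight V x - weight U x := by
  rw [← weight_inter_add_weight_sdiff V U, Set.inter_eq_right.2 h, add_sub_cancel_left]

lemma weight_const (U : Set α) (c : ℝ) : weight U (fun _ => c) = U.ncard * c := by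
  classical
  rw [weight_apply, Finset.sum_const, nsmul_eq_mul, ← Set.toFinset_ofPred,
    Set.ncard_eq_toFinset_card']
  simp

lemma weight_indicator (U B : Set α) : weight U (B.indicator 1) = ((B ∩ U).ncard : ℝ) := by
  classical
  rw [← mul_one ((B ∩ U).ncard : ℝ), ← weight_const]
  simp [weight_apply, Set.indicator_apply, Finset.filter_filter, and_comm]

lemma weight_univ (x : α → ℝ) : weight Set.univ x = ∑ i, x i := by
  simp [weight_apply]

lemma weight_singleton (i : α) (x : α → ℝ) : weight {i} x = x i := by
  classical
  simp [weight_apply, Finset.sum_filter]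

lemma mem_of_weight_eq_zero [DecidableEq α] {S : Submodule ℝ (α → ℝ)} {b : α → Set α}
    (hb : ∀ i, i ∈ b i) (hb' : ∀ i, ∀ j ∈ b i, b j = b i)
    (hS : ∀ i, ∀ j ∈ b i, Pi.single i 1 - Pi.single j (1 : ℝ) ∈ S)
    (hx : ∀ i, weight (b i) x = 0) : x ∈ S := by
  classical
  rw [pi_eq_sum_univ' x, ← Finset.sum_fiberwise Finset.univ b]
  refine S.sum_mem fun B _ => ?_
  rcases Finset.eq_empty_or_nonempty {i | b i = B} with hB | ⟨k, hk⟩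
  · simp [hB]
  obtain rfl : b k = B := by simpa using hk
  have hfiber : ∀ i, b i = b k ↔ i ∈ b k := fun i => ⟨fun h => h ▸ hb i, hb' k i⟩
  have hsum : ∑ i with i ∈ b k, x i • (Pi.single k (1 : ℝ) : α → ℝ) = 0 := by
    rw [← Finset.sum_smul, ← weight_apply, hx, zero_smul]
  simp only [hfiber]
  rw [← sub_zero (∑ i with i ∈ b k, _), ← hsum, ← Finset.sum_sub_distrib]
  refine S.sum_mem fun i hi => ?_
  have hik := hS k i (by simpa using hi)
  rw [← smul_sub]
  exact S.smul_mem _ (by simpa using S.neg_mem hik)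

lemma finrank_inf_ker_add_one {E : Type*} [AddCommGroup E] [Module ℝ E] [FiniteDimensional ℝ E]
    {V : Submodule ℝ E} {f : E →ₗ[ℝ] ℝ} {v : E} (hv : v ∈ V) (hf : f v ≠ 0) :
    Module.finrank ℝ (V ⊓ f.ker : Submodule ℝ E) + 1 = Module.finrank ℝ V := by
  have hmap : (f.domRestrict V).ker.map V.subtype = V ⊓ f.ker := by
    rw [LinearMap.ker_domRestrict, Submodule.map_comap_subtype]
  rw [← hmap, Submodule.finrank_map_subtype_eq]
  exact Module.Dual.finrank_ker_add_one_of_ne_zero fun h0 =>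
    hf (LinearMap.congr_fun h0 ⟨v, hv⟩)

end LinearAlgebra

section Polytope

variable {α : Type*} {M : Matroid α} {X B F U W K : Set α} {p q : α} {x v : α → ℝ}

lemma indicator_mem_basePolytope (hB : M.IsBase B) : B.indicator 1 ∈ basePolytope M :=
  subset_convexHull ℝ _ ⟨B, hB, rfl⟩

lemma indicator_exchange [DecidableEq α] (hp : p ∈ X) (hq : q ∉ X) :
    (insert q (X \ {p})).indicator (1 : α → ℝ) - X.indicator 1 = Pi.single q 1 - Pi.single p 1 := by
  have hqp : q ≠ p := fun e => hq (e ▸ hp)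
  ext i
  by_cases hiq : i = q
  · simp [hiq, hq, hqp]
  by_cases hip : i = p
  · simp [hip, hp, hqp.symm]
  · by_cases hiX : i ∈ X <;> simp [hiq, hip, hiX]

lemma single_sub_single_mem_vectorSpan [DecidableEq α] (hX : M.IsBase X)
    (h : IsExchange M X p q) :
    Pi.single q 1 - Pi.single p (1 : ℝ) ∈ vectorSpan ℝ (basePolytope M) := by
  rw [← indicator_exchange h.1 h.2.1]
  exact vsub_mem_vectorSpan ℝ (indicator_mem_basePolytope h.2.2) (indicator_mem_basePolytope hX)

variable [Fintype α]

lemma mem_rankHyperplane : x ∈ rankHyperplane M F ↔ weight F x = rk M F := by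
  rw [weight_apply, Finset.sum_filter]
  rfl

lemma weight_of_mem_affineSpan (hU : IsSeparator M U)
    (hx : x ∈ affineSpan ℝ (basePolytope M)) : weight U x = rk M U := by
  have hle : affineSpan ℝ (basePolytope M) ≤
      (affineSpan ℝ {(rk M U : ℝ)}).comap (weight U).toAffineMap := by
    rw [basePolytope, affineSpan_convexHull, affineSpan_le]
    rintro _ ⟨B, hB, rfl⟩
    simp [weight_indicator, hU B hB]
  simpa using hle hx

lemma weight_of_mem_vectorSpan (hU : IsSeparator M U)
    (hv : v ∈ vectorSpan ℝ (basePolytope M)) : weight U v = 0 := by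
  obtain ⟨X, hX⟩ := M.exists_isBase
  have hc := mem_affineSpan ℝ (indicator_mem_basePolytope hX)
  rw [← direction_affineSpan] at hv
  have hvc := weight_of_mem_affineSpan hU (AffineSubspace.vadd_mem_of_mem_direction hv hc)
  rw [vadd_eq_add, map_add, weight_of_mem_affineSpan hU hc] at hvc
  exact add_eq_right.1 hvc

lemma mem_vectorSpan_iff (hE : M.E = Set.univ) :
    v ∈ vectorSpan ℝ (basePolytope M) ↔ ∀ z, weight (component M z) v = 0 := by
  classical
  refine ⟨fun h z => weight_of_mem_vectorSpan (isSeparator_component hE z) h, fun h => ?_⟩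
  obtain ⟨X, hX⟩ := M.exists_isBase
  refine mem_of_weight_eq_zero (mem_component_self M) (fun i j hj => (component_eq hj).symm)
    (fun i j hj => ?_) h
  exact (connectedOn_component hE hX i).single_sub_single_mem
    (fun x y hxy _ _ => single_sub_single_mem_vectorSpan hX hxy) (mem_component_self M i) hj

lemma mem_affineSpan_iff (hE : M.E = Set.univ) :
    x ∈ affineSpan ℝ (basePolytope M) ↔
      ∀ z, weight (component M z) x = rk M (component M z) := by
  refine ⟨fun h z => weight_of_mem_affineSpan (isSeparator_component hE z) h, fun h => ?_⟩
  obtain ⟨X, hX⟩ := M.exists_isBase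
  have hc := mem_affineSpan ℝ (indicator_mem_basePolytope hX)
  have hv : x - X.indicator 1 ∈ (affineSpan ℝ (basePolytope M)).direction := by
    rw [direction_affineSpan, mem_vectorSpan_iff hE]
    intro z
    rw [map_sub, h, weight_of_mem_affineSpan (isSeparator_component hE z) hc, sub_self]
  simpa using AffineSubspace.vadd_mem_of_mem_direction hv hc

lemma IsCut.mem_rankHyperplane_iff (hE : M.E = Set.univ) (h : IsCut M X K W)
    (hx : x ∈ affineSpan ℝ (basePolytope M)) :
    x ∈ rankHyperplane M Wᶜ ↔ weight W x = ((X ∩ W).ncard : ℝ) := by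
  have hsum : (X ∩ W).ncard + rk M Wᶜ = rk M Set.univ := by
    rw [← h.isClosedAt.ncard_inter_compl hE h.isBase, ncard_inter_add_ncard_inter_compl,
      ← isSeparator_univ hE X h.isBase, Set.inter_univ]
  have hxu := weight_of_mem_affineSpan (isSeparator_univ hE) hx
  rw [mem_rankHyperplane, Set.compl_eq_univ_sdiff, weight_sdiff (Set.subset_univ W), hxu,
    ← Set.compl_eq_univ_sdiff, ← hsum, Nat.cast_add]
  constructor <;> intro h <;> linarith

lemma IsCut.indicator_mem_rankFace_iff (hE : M.E = Set.univ) (h : IsCut M X K W)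
    (hB : M.IsBase B) : B.indicator 1 ∈ rankFace M Wᶜ ↔ (B ∩ W).ncard = (X ∩ W).ncard := by
  have hmem := indicator_mem_basePolytope hB
  rw [rankFace, Set.mem_inter_iff, and_iff_right hmem,
    h.mem_rankHyperplane_iff hE (mem_affineSpan ℝ hmem), weight_indicator, Nat.cast_inj]

lemma IsCut.indicator_exchange_mem_rankFace_iff (hE : M.E = Set.univ) (h : IsCut M X K W)
    (hB : M.IsBase B) (hBW : B.indicator 1 ∈ rankFace M Wᶜ) (hpq : IsExchange M B p q) :
    (insert q (B \ {p})).indicator 1 ∈ rankFace M Wᶜ ↔ (p ∈ W ↔ q ∈ W) := by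
  have hcard := ncard_inter_exchange hpq.1 hpq.2.1 W
  rw [h.indicator_mem_rankFace_iff hE hB] at hBW
  rw [h.indicator_mem_rankFace_iff hE hpq.2.2, ← hBW]
  split_ifs at hcard with hq hp hp <;> simp only [hp, hq, iff_true, iff_false, not_true] <;>
    omega

lemma IsCut.indicator_mem_rankFace (hE : M.E = Set.univ) (h : IsCut M X K W) :
    X.indicator 1 ∈ rankFace M Wᶜ :=
  (h.indicator_mem_rankFace_iff hE h.isBase).2 rfl

lemma IsCut.single_sub_single_mem_vectorSpan_rankFace [DecidableEq α] (hE : M.E = Set.univ)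
    (h : IsCut M X K W) (hU : U ⊆ W ∨ Disjoint U W) (hconn : ConnectedOn (IsExchange M X) U)
    (hp : p ∈ U) (hq : q ∈ U) :
    Pi.single p 1 - Pi.single q (1 : ℝ) ∈ vectorSpan ℝ (rankFace M Wᶜ) := by
  refine hconn.single_sub_single_mem (fun x y hxy hx hy => ?_) hp hq
  have hiff : x ∈ W ↔ y ∈ W := by
    rcases hU with hU | hU
    · exact iff_of_true (hU hx) (hU hy)
    · exact iff_of_false (Set.disjoint_left.1 hU hx) (Set.disjoint_left.1 hU hy)
  have hmem := h.indicator_mem_rankFace hE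
  rw [← indicator_exchange hxy.1 hxy.2.1]
  exact vsub_mem_vectorSpan ℝ
    ((h.indicator_exchange_mem_rankFace_iff hE h.isBase hmem hxy).2 hiff) hmem

lemma IsCut.vectorSpan_rankFace_le (hE : M.E = Set.univ) (h : IsCut M X K W) :
    vectorSpan ℝ (rankFace M Wᶜ) ≤ vectorSpan ℝ (basePolytope M) ⊓ (weight W).ker := by
  refine le_inf (vectorSpan_mono ℝ Set.inter_subset_left) ?_
  rw [vectorSpan, Submodule.span_le]
  rintro _ ⟨x, hx, y, hy, rfl⟩
  have hxW := (h.mem_rankHyperplane_iff hE (mem_affineSpan ℝ hx.1)).1 hx.2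
  have hyW := (h.mem_rankHyperplane_iff hE (mem_affineSpan ℝ hy.1)).1 hy.2
  simp [hxW, hyW]

open Classical in
lemma IsCut.le_vectorSpan_rankFace (hE : M.E = Set.univ) (h : IsCut M X K W) :
    vectorSpan ℝ (basePolytope M) ⊓ (weight W).ker ≤ vectorSpan ℝ (rankFace M Wᶜ) := by
  rintro v ⟨hv, hvW : weight W v = 0⟩
  rw [SetLike.mem_coe, mem_vectorSpan_iff hE] at hv
  refine mem_of_weight_eq_zero (b := fun i => if i ∈ W then W else component M i \ W)
    (fun i => ?_) (fun i j hj => ?_) (fun i j hj => ?_) fun i => ?_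
  · split_ifs with hi
    exacts [hi, ⟨mem_component_self M i, hi⟩]
  · split_ifs at hj with hi
    · rw [if_pos hi, if_pos hj]
    · rw [if_neg hi, if_neg hj.2, component_eq hj.1]
  · split_ifs at hj with hi
    · exact h.single_sub_single_mem_vectorSpan_rankFace hE (Or.inl subset_rfl) h.connectedOn hi hj
    · refine h.single_sub_single_mem_vectorSpan_rankFace hE (Or.inr Set.disjoint_sdiff_left) ?_
        ⟨mem_component_self M i, hi⟩ hj
      rcases h.component_eq_or_disjoint i with hiK | hiW
      · exact hiK ▸ h.connectedOn_sdiff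
      · rw [hiW.sdiff_eq_left]
        exact connectedOn_component hE h.isBase i
  · split_ifs with hi
    · exact hvW
    rcases h.component_eq_or_disjoint i with hiK | hiW
    · rw [weight_sdiff (hiK ▸ h.subset), hv, hvW, sub_zero]
    · rw [hiW.sdiff_eq_left, hv]

lemma IsCut.isFlacet (hE : M.E = Set.univ) (h : IsCut M X K W) : IsFlacet M Wᶜ := by
  classical
  obtain ⟨x, y, hxy, hx, hy⟩ := h.exists_crossing hE
  refine ⟨h.isFlat hE, ⟨_, h.indicator_mem_rankFace hE⟩, ?_⟩
  rw [(h.vectorSpan_rankFace_le hE).antisymm (h.le_vectorSpan_rankFace hE)]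
  refine finrank_inf_ker_add_one (single_sub_single_mem_vectorSpan h.isBase hxy) fun h0 => ?_
  have hcard := ncard_inter_exchange hxy.1 hxy.2.1 W
  rw [← indicator_exchange hxy.1 hxy.2.1, map_sub, weight_indicator, weight_indicator,
    sub_eq_zero, Nat.cast_inj] at h0
  rw [h0, if_pos hy, if_neg hx] at hcard
  omega

end Polytope

section RelativeInterior

variable {α : Type*} {M : Matroid α} {X Y B U W W' K K' : Set α} {x g : α → ℝ}

lemma disjoint_of_eq_component (hK : ∃ z, K = component M z) (hK' : ∃ z, K' = component M z)
    (hne : K ≠ K') : Disjoint K K' := by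
  obtain ⟨z, rfl⟩ := hK
  obtain ⟨z', rfl⟩ := hK'
  exact Set.disjoint_left.2 fun x hx hx' => hne ((component_eq hx).trans (component_eq hx').symm)

section Filling

/-- The positive amount `t` fits strictly into `m` places of capacity `1`; if there are no places,
then `t` is `0`. -/
def IsFillable (m : ℕ) (t : ℝ) : Prop := (m = 0 ∧ t = 0) ∨ t ∈ Set.Ioo (0 : ℝ) m

lemma IsFillable.exists_level {m : ℕ} {t : ℝ} (h : IsFillable m t) :
    ∃ c : ℝ, m * c = t ∧ (0 < m → c ∈ Set.Ioo 0 1) := by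
  rcases h with ⟨rfl, rfl⟩ | ⟨h0, h1⟩
  · exact ⟨0, by simp, fun h => absurd h (lt_irrefl 0)⟩
  · have hm : (0 : ℝ) < m := h0.trans h1
    exact ⟨t / m, mul_div_cancel₀ t hm.ne', fun _ => ⟨div_pos h0 hm, (div_lt_one hm).2 h1⟩⟩

open Classical in
lemma exists_weight_eq [Fintype α] (hW : W ⊆ K) (hW' : W' ⊆ K) {t₁₁ t₁₀ t₀₁ t₀₀ : ℝ}
    (h₁₁ : IsFillable (W ∩ W').ncard t₁₁) (h₁₀ : IsFillable (W \ W').ncard t₁₀)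
    (h₀₁ : IsFillable (W' \ W).ncard t₀₁) (h₀₀ : IsFillable (K \ (W ∪ W')).ncard t₀₀) :
    ∃ g : α → ℝ, (∀ i ∈ K, g i ∈ Set.Ioo 0 1) ∧ weight K g = t₁₁ + t₁₀ + (t₀₁ + t₀₀) ∧
      weight W g = t₁₁ + t₁₀ ∧ weight W' g = t₁₁ + t₀₁ := by
  obtain ⟨c₁₁, rfl, hc₁₁⟩ := h₁₁.exists_level
  obtain ⟨c₁₀, rfl, hc₁₀⟩ := h₁₀.exists_level
  obtain ⟨c₀₁, rfl, hc₀₁⟩ := h₀₁.exists_level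
  obtain ⟨c₀₀, rfl, hc₀₀⟩ := h₀₀.exists_level
  set g : α → ℝ := fun i => if i ∈ W then if i ∈ W' then c₁₁ else c₁₀
    else if i ∈ W' then c₀₁ else c₀₀ with hg
  have g₁₁ : weight (W ∩ W') g = (W ∩ W').ncard * c₁₁ := by
    rw [← weight_const]
    exact weight_congr fun i hi => by simp [hg, hi.1, hi.2]
  have g₁₀ : weight (W \ W') g = (W \ W').ncard * c₁₀ := by
    rw [← weight_const]
    exact weight_congr fun i hi => by simp [hg, hi.1, hi.2]
  have g₀₁ : weight (W' \ W) g = (W' \ W).ncard * c₀₁ := by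
    rw [← weight_const]
    exact weight_congr fun i hi => by simp [hg, hi.1, hi.2]
  have g₀₀ : weight (K \ (W ∪ W')) g = (K \ (W ∪ W')).ncard * c₀₀ := by
    rw [← weight_const]
    refine weight_congr fun i hi => ?_
    obtain ⟨hi₁, hi₂⟩ := not_or.1 hi.2
    simp [hg, hi₁, hi₂]
  have gW := weight_inter_add_weight_sdiff W W' g
  have gW' := weight_inter_add_weight_sdiff W' W g
  have gU : weight (W ∪ W') g = weight W g + (W' \ W).ncard * c₀₁ := by
    rw [← Set.union_sdiff_self, weight_union Set.disjoint_sdiff_right, g₀₁]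
  have gK := weight_inter_add_weight_sdiff K (W ∪ W') g
  rw [Set.inter_eq_right.2 (Set.union_subset hW hW'), g₀₀, gU] at gK
  rw [g₁₁, g₁₀] at gW
  rw [Set.inter_comm, g₁₁, g₀₁] at gW'
  refine ⟨g, fun i hi => ?_, by rw [← gK, gW, add_assoc], gW.symm, gW'.symm⟩
  have pos : ∀ {R : Set α}, i ∈ R → 0 < R.ncard := fun h =>
    (Set.ncard_pos (Set.toFinite _)).2 ⟨i, h⟩
  simp only [hg]
  split_ifs with hiW hiW' hiW'
  exacts [hc₁₁ (pos ⟨hiW, hiW'⟩), hc₁₀ (pos ⟨hiW, hiW'⟩), hc₀₁ (pos ⟨hiW', hiW⟩),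
    hc₀₀ (pos ⟨hi, not_or.2 ⟨hiW, hiW'⟩⟩)]

lemma exists_overlap {w₁₁ w₁₀ w₀₁ w₀₀ a b r : ℕ} (ha : a ∈ Set.Ioo 0 (w₁₁ + w₁₀))
    (hb : b ∈ Set.Ioo 0 (w₁₁ + w₀₁)) (har : a < r) (har' : r < a + (w₀₁ + w₀₀)) (hbr : b < r)
    (hbr' : r < b + (w₁₀ + w₀₀)) (h₁₁ : a + b < w₁₁ + r) (h₁₀ : a < w₁₀ + b) (h₀₁ : b < w₀₁ + a)
    (h₀₀ : r < w₀₀ + a + b) :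
    ∃ u : ℝ, IsFillable w₁₁ u ∧ IsFillable w₁₀ (a - u) ∧ IsFillable w₀₁ (b - u) ∧
      IsFillable w₀₀ (r - a - (b - u)) := by
  obtain ⟨ha₀, ha₁⟩ := ha
  obtain ⟨hb₀, hb₁⟩ := hb
  rify at *
  rcases w₁₁.eq_zero_or_pos with rfl | n₁₁
  · refine ⟨0, Or.inl ⟨rfl, rfl⟩, ?_⟩
    refine ⟨Or.inr ?_, Or.inr ?_, Or.inr ?_⟩ <;> constructor <;> push_cast at * <;> linarith
  rcases w₀₀.eq_zero_or_pos with rfl | n₀₀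
  · refine ⟨a + b - r, Or.inr ?_, Or.inr ?_, Or.inr ?_, Or.inl ⟨rfl, by ring⟩⟩ <;>
      constructor <;> push_cast at * <;> linarith
  rcases w₁₀.eq_zero_or_pos with rfl | n₁₀
  · refine ⟨a, Or.inr ?_, Or.inl ⟨rfl, by ring⟩, Or.inr ?_, Or.inr ?_⟩ <;>
      constructor <;> push_cast at * <;> linarith
  rcases w₀₁.eq_zero_or_pos with rfl | n₀₁
  · refine ⟨b, Or.inr ?_, Or.inr ?_, Or.inl ⟨rfl, by ring⟩, Or.inr ?_⟩ <;>
      constructor <;> push_cast at * <;> linarith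
  rify at *
  obtain ⟨u, hu₀, hu₁⟩ := exists_between
    (show max (max 0 (a - w₁₀ : ℝ)) (max (b - w₀₁) (a + b - r)) <
      min (min (w₁₁ : ℝ) a) (min (b : ℝ) (a + b - r + w₀₀)) by
      simp only [max_lt_iff, lt_min_iff]
      refine ⟨⟨?_, ?_⟩, ?_, ?_⟩ <;> refine ⟨⟨?_, ?_⟩, ?_, ?_⟩ <;> linarith)
  simp only [max_lt_iff, lt_min_iff] at hu₀ hu₁
  refine ⟨u, Or.inr ?_, Or.inr ?_, Or.inr ?_, Or.inr ?_⟩ <;> constructor <;> linarith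

end Filling

/-- The point `x` lies on the affine span of the base polytope, and its coordinates, except for
those of loops and coloops, are strictly between `0` and `1`. -/
def IsInner [Fintype α] (M : Matroid α) (x : α → ℝ) : Prop :=
  (∀ z, weight (component M z) x = rk M (component M z)) ∧
    ∀ i, component M i ≠ {i} → x i ∈ Set.Ioo 0 1

lemma IsCut.ncard_inter_component (hE : M.E = Set.univ) [Finite α] (h : IsCut M X K W)
    (hB : M.IsBase B) : (B ∩ K).ncard = rk M K := by
  obtain ⟨z, rfl⟩ := h.eq_component
  exact isSeparator_component hE z B hB

lemma ncard_inter_mem_Ioo [Finite α] (h : (U ∩ X).Nonempty) (h' : (U \ X).Nonempty) :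
    (X ∩ U).ncard ∈ Set.Ioo 0 U.ncard := by
  obtain ⟨u, hu, huX⟩ := h'
  rw [Set.inter_comm]
  exact ⟨(Set.ncard_pos (Set.toFinite _)).2 h,
    Set.ncard_lt_ncard ⟨Set.inter_subset_left, fun e => huX (e hu).2⟩ (Set.toFinite _)⟩

lemma IsCut.ncard_bounds (hE : M.E = Set.univ) [Finite α] (h : IsCut M X K W) :
    (X ∩ W).ncard ∈ Set.Ioo 0 W.ncard ∧ (X ∩ W).ncard < rk M K ∧
      rk M K < (X ∩ W).ncard + (K \ W).ncard := by
  have hW := ncard_inter_mem_Ioo h.inter_nonempty h.sdiff_nonempty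
  obtain ⟨hW₀, hW₁⟩ := ncard_inter_mem_Ioo h.compl_inter_nonempty h.compl_sdiff_nonempty
  have hsum := Set.ncard_inter_add_ncard_sdiff_eq_ncard (X ∩ K) W (Set.toFinite _)
  rw [h.ncard_inter_component hE h.isBase, Set.inter_assoc, Set.inter_eq_right.2 h.subset,
    Set.inter_sdiff_assoc] at hsum
  exact ⟨hW, by omega, by omega⟩

open Classical in
lemma IsInner.piecewise [Fintype α] (h : IsInner M x) (hK : ∃ z, K = component M z)
    (hg : ∀ i ∈ K, g i ∈ Set.Ioo 0 1) (hgK : weight K g = rk M K) :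
    IsInner M (K.piecewise g x) := by
  refine ⟨fun w => ?_, fun i hi => ?_⟩
  · rcases eq_or_ne K (component M w) with rfl | hne
    · rw [← hgK]
      exact weight_congr fun i hi => Set.piecewise_eq_of_mem _ _ _ hi
    · rw [← h.1 w]
      have hdisj := disjoint_of_eq_component ⟨w, rfl⟩ hK hne.symm
      exact weight_congr fun i hi =>
        Set.piecewise_eq_of_notMem _ _ _ (Set.disjoint_left.1 hdisj hi)
  · by_cases hiK : i ∈ K
    · simpa [hiK] using hg i hiK
    · simpa [hiK] using h.2 i hi

variable [Fintype α]

lemma IsInner.exists (hE : M.E = Set.univ) : ∃ x, IsInner M x := by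
  refine ⟨fun i => rk M (component M i) / (component M i).ncard, fun z => ?_, fun i hi => ?_⟩
  · have hne : ((component M z).ncard : ℝ) ≠ 0 := Nat.cast_ne_zero.2
      ((Set.ncard_pos (Set.toFinite _)).2 ⟨z, mem_component_self M z⟩).ne'
    rw [← mul_div_cancel₀ (rk M (component M z) : ℝ) hne, ← weight_const]
    exact weight_congr fun i hi => by rw [component_eq hi]
  obtain ⟨X, hX⟩ := M.exists_isBase
  have hiK := mem_component_self M i
  obtain ⟨j, hj, hji⟩ : ∃ j ∈ component M i, j ≠ i := by
    by_contra! hall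
    exact hi (Set.eq_singleton_iff_unique_mem.2 ⟨hiK, hall⟩)
  obtain ⟨hin, hout⟩ : (component M i ∩ X).Nonempty ∧ (component M i \ X).Nonempty := by
    obtain ⟨u, hu, hiu | hui⟩ := (connectedOn_component hE hX i).exists_adj hiK hj hji.symm
    exacts [⟨⟨i, hiK, hiu.1⟩, ⟨u, hu, hiu.2.1⟩⟩, ⟨⟨u, hu, hui.1⟩, ⟨i, hiK, hui.2.1⟩⟩]
  obtain ⟨hpos, hlt⟩ := ncard_inter_mem_Ioo hin hout
  rw [isSeparator_component hE i X hX] at hpos hlt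
  rify at hpos hlt
  exact ⟨div_pos hpos (hpos.trans hlt), (div_lt_one (hpos.trans hlt)).2 hlt⟩

lemma mem_ambientPolytope (hE : M.E = Set.univ) (hx : x ∈ affineSpan ℝ (basePolytope M))
    (h : ∀ i, component M i ≠ {i} → x i ∈ Set.Ioo 0 1) : x ∈ ambientPolytope M := by
  refine ⟨⟨fun i => ?_, ?_⟩, hx⟩
  · by_cases hi : component M i = {i}
    · have hxi := (mem_affineSpan_iff hE).1 hx i
      obtain ⟨B, hB, hc⟩ := exists_isBase_ncard_inter_eq hE {i}
      have hle : (B ∩ {i}).ncard ≤ 1 :=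
        (Set.ncard_le_ncard Set.inter_subset_right (Set.toFinite _)).trans (by simp)
      rw [hi, weight_singleton, ← hc] at hxi
      rw [hxi]
      exact ⟨by positivity, by exact_mod_cast hle⟩
    · exact Set.Ioo_subset_Icc_self (h i hi)
  · rw [← weight_univ, weight_of_mem_affineSpan (isSeparator_univ hE) hx, rk, ← hE, M.eRk_ground]

lemma IsInner.mem_affineSpan (hE : M.E = Set.univ) (h : IsInner M x) :
    x ∈ affineSpan ℝ (basePolytope M) := (mem_affineSpan_iff hE).2 h.1

lemma IsInner.mem_intrinsicInterior (hE : M.E = Set.univ) (h : IsInner M x) :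
    x ∈ intrinsicInterior ℝ (ambientPolytope M) := by
  have hle : affineSpan ℝ (ambientPolytope M) ≤ affineSpan ℝ (basePolytope M) :=
    affineSpan_le.2 Set.inter_subset_right
  have hxD := mem_ambientPolytope hE (h.mem_affineSpan hE) h.2
  refine _root_.mem_intrinsicInterior.2 ⟨⟨x, subset_affineSpan ℝ _ hxD⟩, mem_interior.2
    ⟨Subtype.val ⁻¹' Set.pi {i | component M i ≠ {i}} fun _ => Set.Ioo 0 1, ?_, ?_, h.2⟩, rfl⟩
  · exact fun z hz => mem_ambientPolytope hE (hle z.2) hz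
  · exact (isOpen_set_pi (Set.toFinite _) fun _ _ => isOpen_Ioo).preimage continuous_subtype_val

lemma IsCut.exists_isInner (hE : M.E = Set.univ) (h : IsCut M X K W) (hx : IsInner M x) :
    ∃ y, IsInner M y ∧ weight W y = (X ∩ W).ncard ∧ ∀ i ∉ K, y i = x i := by
  classical
  obtain ⟨⟨hW₀, hW₁⟩, hr₀, hr₁⟩ := h.ncard_bounds hE
  have hsub : rk M K - (X ∩ W).ncard < (K \ W).ncard := by omega
  have hempty : IsFillable 0 0 := Or.inl ⟨rfl, rfl⟩
  obtain ⟨g, hg, hgK, hgW, -⟩ := exists_weight_eq (W' := ∅) (t₁₀ := (X ∩ W).ncard)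
    (t₀₀ := (rk M K - (X ∩ W).ncard : ℕ)) h.subset (Set.empty_subset K) (by simpa using hempty)
    (by simpa [IsFillable] using Or.inr ⟨hW₀, hW₁⟩) (by simpa using hempty)
    (by simpa [IsFillable] using Or.inr ⟨hr₀, hsub⟩)
  rw [zero_add, zero_add, ← Nat.cast_add, Nat.add_sub_cancel' hr₀.le] at hgK
  refine ⟨K.piecewise g x, hx.piecewise h.eq_component hg hgK, ?_,
    fun i hi => Set.piecewise_eq_of_notMem _ _ _ hi⟩
  rw [zero_add] at hgW
  rw [← hgW]
  exact weight_congr fun i hi => Set.piecewise_eq_of_mem _ _ _ (h.subset hi)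

lemma IsCut.isSplitFlacet (hE : M.E = Set.univ) (h : IsCut M X K W) : IsSplitFlacet M Wᶜ := by
  obtain ⟨x, hx⟩ := IsInner.exists hE
  obtain ⟨y, hy, hyW, -⟩ := h.exists_isInner hE hx
  exact ⟨h.isFlacet hE, y, (h.mem_rankHyperplane_iff hE (hy.mem_affineSpan hE)).2 hyW,
    hy.mem_intrinsicInterior hE⟩

lemma IsCut.isolates_of_rankFace_eq (hE : M.E = Set.univ) (h : IsCut M X K W)
    (h' : IsCut M Y K' W') (heq : rankFace M Wᶜ = rankFace M W'ᶜ) (hU : U ⊆ W ∨ Disjoint U W) :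
    Isolates (IsExchange M X) U W' := by
  intro p q hpq hp hq
  have hX := h.indicator_mem_rankFace hE
  have hiff := h.indicator_exchange_mem_rankFace_iff hE h.isBase hX hpq
  rw [heq] at hX hiff
  rw [← h'.indicator_exchange_mem_rankFace_iff hE h.isBase hX hpq, hiff]
  rcases hU with hU | hU
  · exact iff_of_true (hU hp) (hU hq)
  · exact iff_of_false (Set.disjoint_left.1 hU hp) (Set.disjoint_left.1 hU hq)

lemma IsCut.component_eq_of_rankFace_eq (hE : M.E = Set.univ) (h : IsCut M X K W)
    (h' : IsCut M Y K' W') (heq : rankFace M Wᶜ = rankFace M W'ᶜ) : K = K' := by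
  by_contra hne
  have hdisj := disjoint_of_eq_component h'.eq_component h.eq_component (Ne.symm hne)
  have hconn : ConnectedOn (IsExchange M X) K' := by
    obtain ⟨z, rfl⟩ := h'.eq_component
    exact connectedOn_component hE h.isBase z
  rcases hconn.subset_or_disjoint
    (h.isolates_of_rankFace_eq hE h' heq (Or.inr (hdisj.mono_right h.subset))) with hsub | hdisj'
  · obtain ⟨b, hb, -⟩ := h'.compl_inter_nonempty
    exact hb.2 (hsub hb.1)
  · obtain ⟨a, ha, -⟩ := h'.inter_nonempty
    exact hdisj'.le_bot ⟨h'.subset ha, ha⟩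

lemma IsCut.rankFace_ne (hE : M.E = Set.univ) (h : IsCut M X K W) (h' : IsCut M Y K' W')
    (hne : W ≠ W') : rankFace M Wᶜ ≠ rankFace M W'ᶜ := by
  intro heq
  obtain rfl := h.component_eq_of_rankFace_eq hE h' heq
  obtain ⟨a, ha, -⟩ := h'.inter_nonempty
  obtain ⟨b, hb, -⟩ := h'.compl_inter_nonempty
  rcases h.connectedOn.subset_or_disjoint
      (h.isolates_of_rankFace_eq hE h' heq (Or.inl subset_rfl)) with hW | hW <;>
    rcases h.connectedOn_sdiff.subset_or_disjoint
      (h.isolates_of_rankFace_eq hE h' heq (Or.inr Set.disjoint_sdiff_left)) with hW' | hW'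
  · exact hb.2 ((em (b ∈ W)).elim (fun hbW => hW hbW) fun hbW => hW' ⟨hb.1, hbW⟩)
  · refine hne (hW.antisymm fun x hx => ?_)
    by_contra hxW
    exact hW'.le_bot ⟨⟨h'.subset hx, hxW⟩, hx⟩
  · have hX := h.indicator_mem_rankFace hE
    rw [heq, h'.indicator_mem_rankFace_iff hE h.isBase] at hX
    refine h.not_isClosedAt_sdiff hE fun x y hxy hx => ?_
    have hy := h'.isClosedAt_of_ncard_eq hE h.isBase hX x y hxy (hW' hx)
    exact ⟨h'.subset hy, fun hyW => hW.le_bot ⟨hyW, hy⟩⟩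
  · exact (em (a ∈ W)).elim (fun haW => hW.le_bot ⟨haW, ha⟩)
      fun haW => hW'.le_bot ⟨⟨h'.subset ha, haW⟩, ha⟩

lemma IsCut.weight_ne (hE : M.E = Set.univ) (hM : IsSplit M) (h : IsCut M X K W)
    (h' : IsCut M Y K' W') (hne : W ≠ W') (hx : IsInner M x)
    (hxW : weight W x = (X ∩ W).ncard) : weight W' x ≠ (Y ∩ W').ncard := by
  intro hxW'
  have hspan := hx.mem_affineSpan hE
  exact Set.eq_empty_iff_forall_notMem.1
    (hM _ _ (h.isSplitFlacet hE) (h'.isSplitFlacet hE) (h.rankFace_ne hE h' hne)) x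
    ⟨⟨(h.mem_rankHyperplane_iff hE hspan).2 hxW, (h'.mem_rankHyperplane_iff hE hspan).2 hxW'⟩,
      hx.mem_intrinsicInterior hE⟩

lemma IsCut.component_unique (hE : M.E = Set.univ) (hM : IsSplit M) (h : IsCut M X K W)
    (h' : IsCut M Y K' W') : K = K' := by
  by_contra hK
  have hdisj := disjoint_of_eq_component h.eq_component h'.eq_component hK
  have hne : W ≠ W' := by
    rintro rfl
    obtain ⟨a, ha, -⟩ := h.inter_nonempty
    exact hdisj.le_bot ⟨h.subset ha, h'.subset ha⟩
  obtain ⟨x, hx⟩ := IsInner.exists hE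
  obtain ⟨y, hy, hyW, -⟩ := h.exists_isInner hE hx
  obtain ⟨z, hz, hzW', hzy⟩ := h'.exists_isInner hE hy
  refine h.weight_ne hE hM h' hne hz ?_ hzW'
  rw [← hyW]
  exact weight_congr fun i hi => hzy i (Set.disjoint_left.1 hdisj (h.subset hi))

theorem IsCut.ncard_sdiff_union_le (hE : M.E = Set.univ) (hM : IsSplit M) (h : IsCut M X K W)
    (h' : IsCut M Y K W') (hne : W ≠ W') :
    (K \ (W ∪ W')).ncard + (X ∩ W).ncard + (Y ∩ W').ncard ≤ rk M K := by
  classical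
  by_contra! hlt
  obtain ⟨⟨hW₀, hW₁⟩, hWr₀, hWr₁⟩ := h.ncard_bounds hE
  obtain ⟨⟨hW'₀, hW'₁⟩, hW'r₀, hW'r₁⟩ := h'.ncard_bounds hE
  have cW := Set.ncard_inter_add_ncard_sdiff_eq_ncard W W' (Set.toFinite _)
  have cW' := Set.ncard_inter_add_ncard_sdiff_eq_ncard W' W (Set.toFinite _)
  have cKW := Set.ncard_sdiff_add_ncard_of_subset h.subset
  have cKW' := Set.ncard_sdiff_add_ncard_of_subset h'.subset
  have cK := Set.ncard_sdiff_add_ncard_of_subset (Set.union_subset h.subset h'.subset)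
  have cU := Set.ncard_union_add_ncard_inter W W' (Set.toFinite _) (Set.toFinite _)
  rw [Set.inter_comm W' W] at cW'
  have h₁₁ := h.lt_ncard_inter_add hE h'
  rw [h.ncard_inter_component hE h.isBase] at h₁₁
  have h₁₀ : ¬(W \ W').ncard + (Y ∩ W').ncard ≤ (X ∩ W).ncard :=
    fun hle => hne (h.eq_of_ncard_sdiff_le hE h' hle)
  have h₀₁ : ¬(W' \ W).ncard + (X ∩ W).ncard ≤ (Y ∩ W').ncard :=
    fun hle => hne (h'.eq_of_ncard_sdiff_le hE h hle).symm
  obtain ⟨u, u₁₁, u₁₀, u₀₁, u₀₀⟩ := exists_overlap (w₁₁ := (W ∩ W').ncard)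
    (w₁₀ := (W \ W').ncard) (w₀₁ := (W' \ W).ncard) (w₀₀ := (K \ (W ∪ W')).ncard)
    (a := (X ∩ W).ncard) (b := (Y ∩ W').ncard) (r := rk M K) ⟨hW₀, by omega⟩ ⟨hW'₀, by omega⟩
    hWr₀ (by omega) hW'r₀ (by omega) (by omega) (by omega) (by omega) (by omega)
  obtain ⟨g, hg, hgK, hgW, hgW'⟩ := exists_weight_eq h.subset h'.subset u₁₁ u₁₀ u₀₁ u₀₀
  obtain ⟨x, hx⟩ := IsInner.exists hE
  refine h.weight_ne hE hM h' hne (hx.piecewise h.eq_component hg (by rw [hgK]; ring)) ?_ ?_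
  · rw [weight_congr fun i hi => Set.piecewise_eq_of_mem _ _ _ (h.subset hi), hgW]
    ring
  · rw [weight_congr fun i hi => Set.piecewise_eq_of_mem _ _ _ (h'.subset hi), hgW']
    ring

end RelativeInterior

/-! ### Recognizing obstructions -/

section Pattern

variable {α ι κ : Type*} {P Q : Finset α} {A : ι → Finset α} {s : ι → ℤ} {B : κ → Finset α}
  {t : κ → ℤ} {i j i₁ i₂ : ι} {j₁ j₂ : κ} {p q a b c d : α} {e e' e₁ e₂ f₁ f₂ : α → α → Prop}

/-- How a tight partition with `a`, `c` in one part and `b`, `d` in the other one is seen in the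
relation of allowed exchanges. -/
structure Separates (P Q : Finset α) (e : α → α → Prop) (a b c d : α) : Prop where
  memP : a ∈ P ∧ b ∈ P
  memQ : c ∈ Q ∧ d ∈ Q
  left : e a c
  right : e b d
  notP : ∀ p ∈ P, ¬ (e p c ∧ e p d)
  notQ : ∀ q ∈ Q, ¬ (e a q ∧ e b q)

open Classical in
/-- How an obstruction is seen in the relations of allowed exchanges. -/
def Pattern (P Q : Finset α) (e₁ e₂ : α → α → Prop) : Prop :=
  ∃ a b c d, Separates P Q e₁ a b c d ∧ Separates P Q e₂ a b d c ∧
    (P.filter fun p => e₁ p c ∧ e₂ p d).card ≠ (Q.filter fun q => e₁ a q ∧ e₂ a q).card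

lemma Separates.congr (he : ∀ p ∈ P, ∀ q ∈ Q, e p q ↔ e' p q) (h : Separates P Q e a b c d) :
    Separates P Q e' a b c d where
  memP := h.memP
  memQ := h.memQ
  left := (he a h.memP.1 c h.memQ.1).1 h.left
  right := (he b h.memP.2 d h.memQ.2).1 h.right
  notP p hp := by rw [← he p hp c h.memQ.1, ← he p hp d h.memQ.2]; exact h.notP p hp
  notQ q hq := by rw [← he a h.memP.1 q hq, ← he b h.memP.2 q hq]; exact h.notQ q hq

lemma Pattern.of_congr (h₁ : ∀ p ∈ P, ∀ q ∈ Q, e₁ p q ↔ f₁ p q)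
    (h₂ : ∀ p ∈ P, ∀ q ∈ Q, e₂ p q ↔ f₂ p q) (h : Pattern P Q e₁ e₂) : Pattern P Q f₁ f₂ := by
  classical
  obtain ⟨a, b, c, d, hs₁, hs₂, hne⟩ := h
  refine ⟨a, b, c, d, hs₁.congr h₁, hs₂.congr h₂, ?_⟩
  rwa [← Finset.filter_congr fun p hp => and_congr (h₁ p hp c hs₁.memQ.1) (h₂ p hp d hs₁.memQ.2),
    ← Finset.filter_congr fun q hq => and_congr (h₁ a hs₁.memP.1 q hq) (h₂ a hs₁.memP.1 q hq)]

lemma pattern_congr (h₁ : ∀ p ∈ P, ∀ q ∈ Q, e₁ p q ↔ f₁ p q)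
    (h₂ : ∀ p ∈ P, ∀ q ∈ Q, e₂ p q ↔ f₂ p q) : Pattern P Q e₁ e₂ ↔ Pattern P Q f₁ f₂ :=
  ⟨.of_congr h₁ h₂, .of_congr (fun p hp q hq => (h₁ p hp q hq).symm)
    fun p hp q hq => (h₂ p hp q hq).symm⟩

section Filter

variable {K : α → Prop} [DecidablePred K]

lemma separates_filter_iff (he : ∀ p ∈ P, ∀ q ∈ Q, e p q → (K p ↔ K q)) :
    Separates (P.filter K) (Q.filter K) e a b c d ↔
      Separates P Q e a b c d ∧ K a ∧ K b ∧ K c ∧ K d := by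
  constructor
  · rintro ⟨hP, hQ, hac, hbd, hnotP, hnotQ⟩
    simp only [Finset.mem_filter] at hP hQ hnotP hnotQ
    obtain ⟨⟨ha, hKa⟩, hb, hKb⟩ := hP
    obtain ⟨⟨hc, hKc⟩, hd, hKd⟩ := hQ
    exact ⟨⟨⟨ha, hb⟩, ⟨hc, hd⟩, hac, hbd,
      fun p hp h => hnotP p ⟨hp, (he p hp c hc h.1).2 hKc⟩ h,
      fun q hq h => hnotQ q ⟨hq, (he a ha q hq h.1).1 hKa⟩ h⟩, hKa, hKb, hKc, hKd⟩
  · rintro ⟨⟨hP, hQ, hac, hbd, hnotP, hnotQ⟩, hKa, hKb, hKc, hKd⟩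
    exact ⟨⟨Finset.mem_filter.2 ⟨hP.1, hKa⟩, Finset.mem_filter.2 ⟨hP.2, hKb⟩⟩,
      ⟨Finset.mem_filter.2 ⟨hQ.1, hKc⟩, Finset.mem_filter.2 ⟨hQ.2, hKd⟩⟩, hac, hbd,
      fun p hp => hnotP p (Finset.mem_of_mem_filter p hp),
      fun q hq => hnotQ q (Finset.mem_of_mem_filter q hq)⟩

lemma pattern_filter_iff (h₁ : ∀ p ∈ P, ∀ q ∈ Q, e₁ p q → (K p ↔ K q))
    (h₂ : ∀ p ∈ P, ∀ q ∈ Q, e₂ p q → (K p ↔ K q))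
    (hK : ∀ a b c d, Separates P Q e₁ a b c d → Separates P Q e₂ a b d c → K a) :
    Pattern (P.filter K) (Q.filter K) e₁ e₂ ↔ Pattern P Q e₁ e₂ := by
  unfold Pattern
  refine exists_congr fun a => exists_congr fun b => exists_congr fun c => exists_congr fun d => ?_
  rw [separates_filter_iff h₁, separates_filter_iff h₂]
  suffices h : Separates P Q e₁ a b c d → Separates P Q e₂ a b d c → (K a ∧ K b ∧ K c ∧ K d) ∧
      (∀ p ∈ P, e₁ p c → K p) ∧ (∀ q ∈ Q, e₁ a q → K q) by
    by_cases hs₁ : Separates P Q e₁ a b c d; swap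
    · simp only [hs₁, false_and]
    by_cases hs₂ : Separates P Q e₂ a b d c; swap
    · simp only [hs₂, false_and, and_false]
    obtain ⟨⟨ha, hb, hc, hd⟩, hP, hQ⟩ := h hs₁ hs₂
    simp only [hs₁, hs₂, ha, hb, hc, hd, true_and]
    classical
    rw [Finset.filter_filter, Finset.filter_filter,
      Finset.filter_congr fun p hp => and_iff_right_of_imp fun h => hP p hp h.1,
      Finset.filter_congr fun q hq => and_iff_right_of_imp fun h => hQ q hq h.1]
  intro hs₁ hs₂
  have ha := hK a b c d hs₁ hs₂
  have hc := (h₁ a hs₁.memP.1 c hs₁.memQ.1 hs₁.left).1 ha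
  have hd := (h₂ a hs₁.memP.1 d hs₁.memQ.2 hs₂.left).1 ha
  exact ⟨⟨ha, (h₁ b hs₁.memP.2 d hs₁.memQ.2 hs₁.right).2 hd, hc, hd⟩,
    fun p hp hpc => (h₁ p hp c hs₁.memQ.1 hpc).2 hc,
    fun q hq haq => (h₁ a hs₁.memP.1 q hq haq).1 ha⟩

end Filter

variable [DecidableEq α]

namespace TightPartition

lemma allowed_iff (h : TightPartition P Q A s i j) (hA : SplitSystem P Q A s)
    (hp : p ∈ P) (hq : q ∈ Q) : Allowed A s p q ↔ (p ∈ A i ↔ q ∈ A i) := by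
  refine ⟨h.mem_iff_of_allowed hp hq, fun hiff => ?_⟩
  by_cases hqi : q ∈ A i
  · exact hA.allowed_of_mem_tight h.left (hiff.2 hqi) hq hqi
  · exact hA.allowed_of_mem_tight h.right ((h.memP p hp).2 fun hpi => hqi (hiff.1 hpi)) hq
      ((h.memQ q hq).2 hqi)

lemma separates (h : TightPartition P Q A s i j) (hA : SplitSystem P Q A s)
    (hP : a ∈ P ∧ b ∈ P) (hQ : c ∈ Q ∧ d ∈ Q) (ha : a ∈ A i) (hb : b ∈ A j) (hc : c ∈ A i)
    (hd : d ∈ A j) : Separates P Q (Allowed A s) a b c d where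
  memP := hP
  memQ := hQ
  left := hA.allowed_of_mem_tight h.left ha hQ.1 hc
  right := hA.allowed_of_mem_tight h.right hb hQ.2 hd
  notP p hp := by
    rw [h.allowed_iff hA hp hQ.1, h.allowed_iff hA hp hQ.2, ← not_iff_not (b := d ∈ A i),
      ← h.memQ d hQ.2]
    tauto
  notQ q hq := by
    rw [h.allowed_iff hA hP.1 hq, h.allowed_iff hA hP.2 hq, ← not_iff_not (a := b ∈ A i),
      ← h.memP b hP.2]
    tauto

end TightPartition

lemma Separates.exists_tightPartition (h : Separates P Q (Allowed A s) a b c d)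
    (hA : SplitSystem P Q A s) :
    ∃ i j, TightPartition P Q A s i j ∧ a ∈ A i ∧ b ∈ A j ∧ c ∈ A i ∧ d ∈ A j := by
  have had : ¬ Allowed A s a d := fun had => h.notP a h.memP.1 ⟨h.left, had⟩
  have hbc : ¬ Allowed A s b c := fun hbc => h.notP b h.memP.2 ⟨hbc, h.right⟩
  unfold Allowed at had hbc
  push Not at had hbc
  obtain ⟨j, hj, hdj, haj⟩ := had
  obtain ⟨i, hi, hci, hbi⟩ := hbc
  have hai := h.left i hi hci
  have hbj := h.right j hj hdj
  have hij : i ≠ j := by rintro rfl; exact haj hai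
  refine ⟨i, j, ⟨hij, hi, hj, fun p hp => ⟨fun hpj hpi => h.notP p hp ⟨?_, ?_⟩,
    hA.mem_of_add_le_zero hij (by omega) hp⟩, fun q hq => ⟨fun hqj hqi => ?_, fun hqi => ?_⟩⟩,
    hai, hbj, hci, hdj⟩
  · exact hA.allowed_of_mem_tight hi hpi h.memQ.1 hci
  · exact hA.allowed_of_mem_tight hj hpj h.memQ.2 hdj
  · exact hij (hA.eq_of_tight hi hj hq hqi hqj)
  · by_contra hqj
    refine h.notQ q hq ⟨fun k hk hqk => ?_, fun k hk hqk => ?_⟩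
    · have hne : j ≠ k := by rintro rfl; exact hqj hqk
      exact hA.mem_of_add_le_zero hne (by omega) h.memP.1 haj
    · have hne : i ≠ k := by rintro rfl; exact hqi hqk
      exact hA.mem_of_add_le_zero hne (by omega) h.memP.2 hbi

lemma filter_allowed_left (hi : TightPartition P Q A s i₁ i₂) (hj : TightPartition P Q B t j₁ j₂)
    (hAB : SplitPair P Q A s B t) (hQ : c ∈ Q ∧ d ∈ Q) (hc : c ∈ A i₁) (hd : d ∈ B j₁) :
    (open Classical in P.filter fun p => Allowed A s p c ∧ Allowed B t p d) =
      P ∩ (A i₁ ∩ B j₁) := by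
  ext p
  simp only [Finset.mem_filter, Finset.mem_inter]
  refine and_congr_right fun hp => ?_
  rw [hi.allowed_iff hAB.left hp hQ.1, hj.allowed_iff hAB.right hp hQ.2, iff_true_right hc,
    iff_true_right hd]

lemma filter_allowed_right (hi : TightPartition P Q A s i₁ i₂) (hj : TightPartition P Q B t j₁ j₂)
    (hAB : SplitPair P Q A s B t) (ha : a ∈ P) (hai : a ∈ A i₁) (haj : a ∈ B j₁) :
    (open Classical in Q.filter fun q => Allowed A s a q ∧ Allowed B t a q) =
      Q ∩ (A i₁ ∩ B j₁) := by
  ext q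
  simp only [Finset.mem_filter, Finset.mem_inter]
  refine and_congr_right fun hq => ?_
  rw [hi.allowed_iff hAB.left ha hq, hj.allowed_iff hAB.right ha hq, iff_true_left hai,
    iff_true_left haj]

lemma exists_obstructed_of_card_ne (hi : TightPartition P Q A s i₁ i₂)
    (hj : TightPartition P Q B t j₁ j₂) (hAB : SplitPair P Q A s B t)
    (hne : (P ∩ (A i₁ ∩ B j₁)).card ≠ (Q ∩ (A i₁ ∩ B j₁)).card) :
    ∃ d, Obstructed P Q A s B t d := by
  rcases lt_or_gt_of_ne hne with hlt | hgt
  · have hP := card_inter_inter_add_card_inter_inter hj.memP (A i₁)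
    have hQ := card_inter_inter_add_card_inter_inter hj.memQ (A i₁)
    have hPQ := hi.card_eq hAB.left hAB.card_eq
    simp only [Finset.inter_comm (B _) (A _)] at hP hQ
    exact ⟨(P ∩ (A i₁ ∩ B j₂)).card - (Q ∩ (A i₁ ∩ B j₂)).card, i₁, i₂, j₂, j₁, hi, hj.symm,
      by omega, by omega⟩
  · exact ⟨(P ∩ (A i₁ ∩ B j₁)).card - (Q ∩ (A i₁ ∩ B j₁)).card, i₁, i₂, j₁, j₂, hi, hj,
      by omega, by omega⟩

theorem SplitPair.pattern_allowed_iff (h : SplitPair P Q A s B t) :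
    Pattern P Q (Allowed A s) (Allowed B t) ↔ ∃ k, Obstructed P Q A s B t k := by
  constructor
  · rintro ⟨a, b, c, d, hs₁, hs₂, hne⟩
    obtain ⟨i₁, i₂, hi, hai, -, hci, -⟩ := hs₁.exists_tightPartition h.left
    obtain ⟨j₁, j₂, hj, haj, -, hdj, -⟩ := hs₂.exists_tightPartition h.right
    rw [filter_allowed_left hi hj h hs₁.memQ hci hdj,
      filter_allowed_right hi hj h hs₁.memP.1 hai haj] at hne
    exact exists_obstructed_of_card_ne hi hj h hne
  · rintro ⟨k, i₁, i₂, j₁, j₂, ho⟩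
    obtain ⟨a, b, c, d, ⟨ha, hai, haj⟩, ⟨hb, hbi, hbj⟩, ⟨hc, hci, hcj⟩, hd, hdi, hdj⟩ :=
      ho.exists_corners h
    refine ⟨a, b, c, d, ho.fst.separates h.left ⟨ha, hb⟩ ⟨hc, hd⟩ hai hbi hci hdi,
      ho.snd.separates h.right ⟨ha, hb⟩ ⟨hd, hc⟩ haj hbj hdj hcj, ?_⟩
    rw [filter_allowed_left ho.fst ho.snd h ⟨hc, hd⟩ hci hdj,
      filter_allowed_right ho.fst ho.snd h ha hai haj, ho.card_eq]
    have := ho.pos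
    omega

end Pattern

/-! ### The split systems of a pair of bases -/

section Slack

variable {α : Type*} {M : Matroid α} {X Y D K W : Set α} {p q : α}

/-- How many elements `Y` has fewer than a base of `M` can have outside `W`. A set is closed under
the exchanges of a base if and only if the base has slack `0` there. -/
noncomputable def slack (M : Matroid α) (Y W : Set α) : ℤ := rk M Wᶜ - (Y ∩ Wᶜ).ncard

/-- The cuts of a matroid. -/
def Cut (M : Matroid α) : Type _ := {W : Set α // ∃ X K, IsCut M X K W}

/-- The slacks of `Y` at the cuts of `M`. -/
noncomputable def cutSlack (M : Matroid α) (Y : Set α) (W : Cut M) : ℤ := slack M Y W.1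

variable [Finite α]

lemma slack_nonneg (hY : M.IsBase Y) (W : Set α) : 0 ≤ slack M Y W :=
  sub_nonneg.2 (Nat.cast_le.2 (ncard_inter_le_rk hY Wᶜ))

lemma isClosedAt_iff_slack_eq_zero (hE : M.E = Set.univ) (hY : M.IsBase Y) :
    IsClosedAt M Y W ↔ slack M Y W = 0 := by
  rw [slack, sub_eq_zero, Nat.cast_inj, eq_comm]
  refine ⟨fun h => h.ncard_inter_compl hE hY, fun h x y hxy hx => ?_⟩
  by_contra hy
  exact mem_of_isExchange_of_ncard_inter_eq h hxy hy hx

lemma ncard_inter_le_slack_add (hY : M.IsBase Y) (hD : M.IsBase D) (W : Set α) :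
    ((Y ∩ W).ncard : ℤ) ≤ slack M Y W + (D ∩ W).ncard := by
  have hle := ncard_inter_le_rk hD Wᶜ
  have hYW := ncard_inter_add_ncard_inter_compl Y W
  have hDW := ncard_inter_add_ncard_inter_compl D W
  have hcard := hY.ncard_eq_ncard_of_isBase hD
  unfold slack
  omega

lemma IsCut.slack_eq (hE : M.E = Set.univ) (h : IsCut M X K W) (hY : M.IsBase Y) :
    slack M Y W = (Y ∩ W).ncard - (X ∩ W).ncard := by
  have hX := h.isClosedAt.ncard_inter_compl hE h.isBase
  have hXW := ncard_inter_add_ncard_inter_compl X W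
  have hYW := ncard_inter_add_ncard_inter_compl Y W
  have hcard := h.isBase.ncard_eq_ncard_of_isBase hY
  unfold slack
  omega

open Classical in
lemma slack_exchange (hp : p ∈ Y) (hq : q ∉ Y) (W : Set α) :
    slack M (insert q (Y \ {p})) W =
      slack M Y W + (if q ∈ W then 1 else 0) - (if p ∈ W then 1 else 0) := by
  rw [slack, slack, ncard_inter_exchange hp hq Wᶜ]
  by_cases hpW : p ∈ W <;> by_cases hqW : q ∈ W <;> simp [hpW, hqW] <;> ring

lemma isExchange_iff_forall_cut (hE : M.E = Set.univ) (hY : M.IsBase Y) (hp : p ∈ Y) (hq : q ∉ Y)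
    (hpq : SameComponent M p q) :
    IsExchange M Y p q ↔ ∀ W : Cut M, cutSlack M Y W = 0 → p ∈ W.1 → q ∈ W.1 := by
  refine ⟨fun h W hW => (isClosedAt_iff_slack_eq_zero hE hY).2 hW p q h, fun h => ?_⟩
  by_contra hno
  obtain ⟨W, hW, hpW, hqW⟩ := exists_isCut hE hY hp hq hpq hno
  exact hqW (h ⟨W, Y, _, hW⟩ ((isClosedAt_iff_slack_eq_zero hE hY).1 hW.isClosedAt) hpW)

/-- The elements of a cut. -/
noncomputable def inside (W : Cut M) : Finset α := W.1.toFinite.toFinset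

/-- The elements of the complement of a cut. -/
noncomputable def outside (W : Cut M) : Finset α := W.1ᶜ.toFinite.toFinset

@[simp] lemma coe_inside (W : Cut M) : (inside W : Set α) = W.1 := Set.Finite.coe_toFinset _

@[simp] lemma mem_inside {W : Cut M} : p ∈ inside W ↔ p ∈ W.1 := Set.Finite.mem_toFinset _

@[simp] lemma mem_outside {W : Cut M} : p ∈ outside W ↔ p ∉ W.1 := Set.Finite.mem_toFinset _

lemma allowed_outside_iff (hE : M.E = Set.univ) (hY : M.IsBase Y) (hp : p ∈ Y) (hq : q ∉ Y)
    (hpq : SameComponent M p q) :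
    Allowed outside (cutSlack M Y) p q ↔ IsExchange M Y p q := by
  simp only [isExchange_iff_forall_cut hE hY hp hq hpq, Allowed, mem_outside, not_imp_not]

lemma allowed_inside_iff (hE : M.E = Set.univ) (hY : M.IsBase Y) (hp : p ∉ Y) (hq : q ∈ Y)
    (hpq : SameComponent M p q) :
    Allowed inside (cutSlack M Y) p q ↔ IsExchange M Y q p := by
  simp only [isExchange_iff_forall_cut hE hY hq hp hpq.symm, Allowed, mem_inside]

open Classical in
lemma cutSlack_exchange_eq_nextSlack_outside (hp : p ∈ Y) (hq : q ∉ Y) :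
    cutSlack M (insert q (Y \ {p})) = nextSlack outside (cutSlack M Y) p q := by
  funext W
  simp only [cutSlack, nextSlack, slack_exchange hp hq, mem_outside]
  split_ifs <;> ring

open Classical in
lemma cutSlack_exchange_eq_nextSlack_inside (hp : p ∉ Y) (hq : q ∈ Y) :
    cutSlack M (insert p (Y \ {q})) = nextSlack inside (cutSlack M Y) p q := by
  funext W
  simp only [cutSlack, nextSlack, slack_exchange hq hp, mem_inside]

end Slack

section Excess

variable {α : Type*} [Finite α] {M : Matroid α} {Y D K : Set α} {x : α}

/-- The elements of `K` that have to be removed on the way from `Y` to `D`. -/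
noncomputable def excess (K Y D : Set α) : Finset α := ((Y \ D) ∩ K).toFinite.toFinset

@[simp] lemma coe_excess (K Y D : Set α) : (excess K Y D : Set α) = (Y \ D) ∩ K :=
  Set.Finite.coe_toFinset _

@[simp] lemma mem_excess : x ∈ excess K Y D ↔ x ∈ Y \ D ∧ x ∈ K := Set.Finite.mem_toFinset _

lemma card_excess (K Y D : Set α) : (excess K Y D).card = ((Y \ D) ∩ K).ncard := by
  rw [← Set.ncard_coe_finset, coe_excess]

lemma card_excess_add (K Y D : Set α) :
    (excess K Y D).card + (D ∩ K).ncard = (excess K D Y).card + (Y ∩ K).ncard := by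
  rw [card_excess, card_excess, Set.inter_sdiff_distrib_right, Set.inter_sdiff_distrib_right,
    Set.ncard_sdiff_add_ncard _ _ (Set.toFinite _) (Set.toFinite _),
    Set.ncard_sdiff_add_ncard _ _ (Set.toFinite _) (Set.toFinite _), Set.union_comm]

lemma IsSeparator.card_excess (hK : IsSeparator M K) (hY : M.IsBase Y) (hD : M.IsBase D) :
    (excess K Y D).card = (excess K D Y).card := by
  have hadd := card_excess_add K Y D
  rw [hK Y hY, hK D hD] at hadd
  exact Nat.add_right_cancel hadd

open Classical in
lemma filter_excess_univ (K Y D : Set α) :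
    (excess Set.univ Y D).filter (· ∈ K) = excess K Y D := by
  ext x
  simp

end Excess

section MainComponent

variable {α : Type*} {M : Matroid α} {Y D K : Set α} {p q : α}

/-- `K` contains all cuts of the matroid, and is a component of it or empty. -/
structure IsMainComponent (M : Matroid α) (K : Set α) : Prop where
  isSeparator : IsSeparator M K
  sameComponent : ∀ p ∈ K, ∀ q ∈ K, SameComponent M p q
  unique : ∀ X K' W, IsCut M X K' W → K' = K

lemma IsMainComponent.subset (hK : IsMainComponent M K) (W : Cut M) : W.1 ⊆ K := by
  obtain ⟨W, X, K', h⟩ := W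
  exact hK.unique X K' W h ▸ h.subset

lemma exists_isMainComponent [Fintype α] (hE : M.E = Set.univ) (hM : IsSplit M) :
    ∃ K, IsMainComponent M K := by
  by_cases! h : ∃ X K W, IsCut M X K W
  · obtain ⟨X, K, W, h⟩ := h
    obtain ⟨z, rfl⟩ := h.eq_component
    exact ⟨component M z, isSeparator_component hE z, fun p hp q hq => hp.symm.trans hq,
      fun X' K' W' h' => h'.component_unique hE hM h⟩
  · exact ⟨∅, fun _ _ => by simp [rk], by simp, fun X K W hW => absurd hW (h X K W)⟩

lemma IsMainComponent.mem_of_not_isExchange [Finite α] (hK : IsMainComponent M K)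
    (hE : M.E = Set.univ) (hY : M.IsBase Y) (hp : p ∈ Y) (hq : q ∉ Y) (hpq : SameComponent M p q)
    (hno : ¬ IsExchange M Y p q) : p ∈ K := by
  obtain ⟨W, hW, -⟩ := exists_isCut hE hY hp hq hpq hno
  exact hK.unique _ _ _ hW ▸ mem_component_self M p

lemma IsMainComponent.pair_le [Fintype α] (hK : IsMainComponent M K) (hE : M.E = Set.univ)
    (hM : IsSplit M) (hY : M.IsBase Y) {V W : Cut M} (hne : V ≠ W) :
    ((Y ∩ (V.1 ∩ W.1)).ncard : ℤ) + ((K \ (V.1 ∪ W.1)) \ Y).ncard ≤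
      cutSlack M Y V + cutSlack M Y W := by
  obtain ⟨V, X₁, K₁, h₁⟩ := V
  obtain ⟨W, X₂, K₂, h₂⟩ := W
  obtain rfl := hK.unique _ _ _ h₁
  obtain rfl := hK.unique _ _ _ h₂
  have hle := h₁.ncard_sdiff_union_le hE hM h₂ fun e => hne (Subtype.ext e)
  have houter := Set.ncard_inter_add_ncard_sdiff_eq_ncard (K₂ \ (V ∪ W)) Y
  have hinner := Set.ncard_inter_add_ncard_sdiff_eq_ncard (Y ∩ K₂) (V ∪ W)
  rw [h₁.ncard_inter_component hE hY, Set.inter_assoc, Set.inter_eq_right.2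
    (Set.union_subset h₁.subset h₂.subset), Set.inter_sdiff_assoc, Set.inter_comm Y (_ \ _)]
    at hinner
  have hunion := Set.ncard_union_add_ncard_inter (Y ∩ V) (Y ∩ W)
  rw [← Set.inter_union_distrib_left, ← Set.inter_inter_distrib_left] at hunion
  simp only [cutSlack, h₁.slack_eq hE hY, h₂.slack_eq hE hY]
  omega

open Classical in
lemma IsMainComponent.splitSystem_inside [Fintype α] (hK : IsMainComponent M K)
    (hE : M.E = Set.univ) (hM : IsSplit M) (hY : M.IsBase Y) (hD : M.IsBase D) :
    SplitSystem (excess K D Y) (excess K Y D) inside (cutSlack M Y) where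
  nonneg W := slack_nonneg hY W.1
  target W := by
    have hle := ncard_inter_le_slack_add hY hD W.1
    have hadd := card_excess_add W.1 Y D
    have card_inter : ∀ S T : Set α, (excess K S T ∩ inside W).card = (excess W.1 S T).card := by
      intro S T
      rw [card_excess, ← Set.ncard_coe_finset, Finset.coe_inter, coe_excess, coe_inside,
        Set.inter_assoc, Set.inter_eq_right.2 (hK.subset W)]
    rw [card_inter, card_inter, cutSlack]
    omega
  pair V W hVW := by
    refine le_trans ?_ (hK.pair_le hE hM hY hVW)
    simp only [← Set.ncard_coe_finset, Finset.coe_inter, Finset.coe_sdiff, Finset.coe_union,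
      coe_excess, coe_inside]
    refine add_le_add (Nat.cast_le.2 (Set.ncard_le_ncard (Set.inter_subset_inter_left _
      (Set.inter_subset_left.trans Set.sdiff_subset)) (Set.toFinite _)))
      (Nat.cast_le.2 (Set.ncard_le_ncard (fun x hx => ?_) (Set.toFinite _)))
    exact ⟨⟨hx.1.2, hx.2⟩, hx.1.1.2⟩

open Classical in
lemma IsMainComponent.splitSystem_outside [Fintype α] (hK : IsMainComponent M K)
    (hE : M.E = Set.univ) (hM : IsSplit M) (hY : M.IsBase Y) (hD : M.IsBase D) :
    SplitSystem (excess K Y D) (excess K D Y) outside (cutSlack M Y) :=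
  (hK.splitSystem_inside hE hM hY hD).compl (hK.isSeparator.card_excess hD hY) (by simp)

end MainComponent

/-! ### Monotone exchanges and obstructed pairs -/

section Step

variable {α : Type*} {M : Matroid α} {X B : Set α × Set α} {Y D K : Set α} {s : α × α} {p q : α}

/-- A symmetric exchange of the pair `X` towards the compatible pair `B`. -/
structure IsStep (M : Matroid α) (B X : Set α × Set α) (s : α × α) : Prop where
  left : s.1 ∈ X.1 \ B.1
  right : s.2 ∈ B.1 \ X.1
  fst : IsExchange M X.1 s.1 s.2
  snd : IsExchange M X.2 s.2 s.1

lemma Compatible.mem_iff (h : Compatible X B) (x : α) :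
    (x ∈ X.1 ∧ x ∈ X.2 ↔ x ∈ B.1 ∧ x ∈ B.2) ∧ (x ∈ X.1 ∨ x ∈ X.2 ↔ x ∈ B.1 ∨ x ∈ B.2) :=
  ⟨Set.ext_iff.1 h.1 x, Set.ext_iff.1 h.2 x⟩

lemma Compatible.sdiff_snd (h : Compatible X B) : X.2 \ B.2 = B.1 \ X.1 := by
  ext x
  have := h.mem_iff x
  simp only [Set.mem_sdiff]
  tauto

lemma Compatible.snd_sdiff (h : Compatible X B) : B.2 \ X.2 = X.1 \ B.1 := by
  ext x
  have := h.mem_iff x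
  simp only [Set.mem_sdiff]
  tauto

lemma ncard_exchange_sdiff_lt_iff [Finite α] (hp : p ∈ Y) (hq : q ∉ Y) (D : Set α) :
    (insert q (Y \ {p}) \ D).ncard < (Y \ D).ncard ↔ p ∉ D ∧ q ∈ D := by
  classical
  have hcard := ncard_inter_exchange hp hq Dᶜ
  simp only [Set.mem_compl_iff, ← Set.sdiff_eq] at hcard
  split_ifs at hcard <;> constructor <;> intro <;> first | omega | tauto

lemma isStep_iff [Finite α] :
    IsStep M B X s ↔
      IsSymmetricExchange M X s ∧ ((swap X s).1 \ B.1).ncard < (X.1 \ B.1).ncard := by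
  constructor
  · rintro ⟨hp, hq, h₁, h₂⟩
    exact ⟨⟨⟨hp.1, h₂.2.1⟩, ⟨h₂.1, hq.2⟩, h₁.2.2, h₂.2.2⟩,
      (ncard_exchange_sdiff_lt_iff h₁.1 h₁.2.1 B.1).2 ⟨hp.2, hq.1⟩⟩
  · rintro ⟨⟨hp, hq, hX⟩, hlt⟩
    obtain ⟨hpB, hqB⟩ := (ncard_exchange_sdiff_lt_iff hp.1 hq.2 B.1).1 hlt
    exact ⟨⟨hp.1, hpB⟩, ⟨hqB, hq.2⟩, ⟨hp.1, hq.2, hX.1⟩, ⟨hq.1, hp.2, hX.2⟩⟩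

lemma exchange_sdiff (hq : q ∈ D) : insert q (Y \ {p}) \ D = (Y \ D) \ {p} := by
  rw [Set.insert_sdiff_of_mem _ hq, Set.sdiff_sdiff_comm]

lemma sdiff_exchange (hp : p ∉ D) : D \ insert q (Y \ {p}) = (D \ Y) \ {q} := by
  rw [← Set.union_singleton, ← Set.sdiff_sdiff, Set.sdiff_sdiff_right,
    Set.inter_singleton_eq_empty.2 hp, Set.union_empty]

namespace IsStep

lemma isBasisPair (h : IsStep M B X s) : IsBasisPair M (swap X s) := ⟨h.fst.2.2, h.snd.2.2⟩

lemma compatible (h : IsStep M B X s) (hc : Compatible X B) : Compatible (swap X s) B := by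
  obtain ⟨hp₁, hq₁, -⟩ := h.fst
  obtain ⟨hq₂, hp₂, -⟩ := h.snd
  constructor
  · rw [← hc.1]
    ext x
    simp only [swap, Set.mem_inter_iff, Set.mem_insert_iff, Set.mem_sdiff, Set.mem_singleton_iff]
    grind
  · rw [← hc.2]
    ext x
    simp only [swap, Set.mem_union, Set.mem_insert_iff, Set.mem_sdiff, Set.mem_singleton_iff]
    grind

variable [Finite α]

open Classical in
lemma excess_left (h : IsStep M B X s) :
    excess K (swap X s).1 B.1 = (excess K X.1 B.1).erase s.1 := by
  apply Finset.coe_injective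
  rw [Finset.coe_erase, coe_excess, coe_excess, swap, exchange_sdiff h.right.1,
    Set.inter_sdiff_right_comm]

open Classical in
lemma excess_right (h : IsStep M B X s) :
    excess K B.1 (swap X s).1 = (excess K B.1 X.1).erase s.2 := by
  apply Finset.coe_injective
  rw [Finset.coe_erase, coe_excess, coe_excess, swap, sdiff_exchange h.left.2,
    Set.inter_sdiff_right_comm]

lemma ncard_add_one (h : IsStep M B X s) :
    ((swap X s).1 \ B.1).ncard + 1 = (X.1 \ B.1).ncard := by
  rw [swap, exchange_sdiff h.right.1, Set.ncard_sdiff_singleton_add_one h.left]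

end IsStep

end Step

section Position

variable {α : Type*} {M : Matroid α} {X B : Set α × Set α} {K : Set α} {s : α × α}
  {p q : α} {d : ℕ}

/-- A pair of bases `X` on its way to the compatible pair `B`, in a split matroid whose cuts lie in
`K`. -/
structure Position [Fintype α] (M : Matroid α) (K : Set α) (B X : Set α × Set α) : Prop where
  ground : M.E = Set.univ
  split : IsSplit M
  main : IsMainComponent M K
  pair : IsBasisPair M X
  target : IsBasisPair M B
  compatible : Compatible X B

open Classical in
/-- The exchanges that are still needed on the way from `X` to `B` have an obstruction of size
`d`. -/
def ObstructedAt [Finite α] (M : Matroid α) (K : Set α) (B X : Set α × Set α) (d : ℕ) : Prop :=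
  Obstructed (excess K X.1 B.1) (excess K B.1 X.1) outside (cutSlack M X.1)
    inside (cutSlack M X.2) d

open Classical in
lemma IsStep.obstructedAt_swap_iff [Finite α] (h : IsStep M B X s) :
    ObstructedAt M K B (swap X s) d ↔
      Obstructed ((excess K X.1 B.1).erase s.1) ((excess K B.1 X.1).erase s.2)
        outside (nextSlack outside (cutSlack M X.1) s.1 s.2)
        inside (nextSlack inside (cutSlack M X.2) s.1 s.2) d := by
  rw [← cutSlack_exchange_eq_nextSlack_outside h.fst.1 h.fst.2.1,
    ← cutSlack_exchange_eq_nextSlack_inside h.snd.2.1 h.snd.1, ← h.excess_left, ← h.excess_right]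
  rfl

lemma IsStep.obstructedAt_swap_iff_of_notMem [Finite α] (h : IsStep M B X s)
    (hK : IsMainComponent M K) (hp : s.1 ∉ K) (hq : s.2 ∉ K) :
    ObstructedAt M K B (swap X s) d ↔ ObstructedAt M K B X d := by
  classical
  have hpW : ∀ W : Cut M, s.1 ∉ W.1 := fun W hW => hp (hK.subset W hW)
  have hqW : ∀ W : Cut M, s.2 ∉ W.1 := fun W hW => hq (hK.subset W hW)
  have houtside : nextSlack outside (cutSlack M X.1) s.1 s.2 = cutSlack M X.1 := by
    funext W
    simp [nextSlack, hpW, hqW]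
  have hinside : nextSlack inside (cutSlack M X.2) s.1 s.2 = cutSlack M X.2 := by
    funext W
    simp [nextSlack, hpW, hqW]
  rw [h.obstructedAt_swap_iff, Finset.erase_eq_of_notMem fun h => hp (mem_excess.1 h).2,
    Finset.erase_eq_of_notMem fun h => hq (mem_excess.1 h).2, houtside, hinside]
  rfl

namespace Position

variable [Fintype α]

lemma next (h : Position M K B X) (hs : IsStep M B X s) : Position M K B (swap X s) :=
  ⟨h.ground, h.split, h.main, hs.isBasisPair, h.target, hs.compatible h.compatible⟩

open Classical in
lemma splitPair (h : Position M K B X) :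
    SplitPair (excess K X.1 B.1) (excess K B.1 X.1) outside (cutSlack M X.1)
      inside (cutSlack M X.2) where
  left := h.main.splitSystem_outside h.ground h.split h.pair.1 h.target.1
  right := by
    have hinside := h.main.splitSystem_inside h.ground h.split h.pair.2 h.target.2
    simp only [excess, h.compatible.sdiff_snd, h.compatible.snd_sdiff] at hinside
    exact hinside
  card_eq := h.main.isSeparator.card_excess h.pair.1 h.target.1

lemma allowed_outside_iff (h : Position M K B X) (hp : p ∈ excess K X.1 B.1)
    (hq : q ∈ excess K B.1 X.1) :
    Allowed outside (cutSlack M X.1) p q ↔ IsExchange M X.1 p q := by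
  rw [mem_excess] at hp hq
  exact SplitExchange.allowed_outside_iff h.ground h.pair.1 hp.1.1 hq.1.2
    (h.main.sameComponent p hp.2 q hq.2)

lemma allowed_inside_iff (h : Position M K B X) (hp : p ∈ excess K X.1 B.1)
    (hq : q ∈ excess K B.1 X.1) :
    Allowed inside (cutSlack M X.2) p q ↔ IsExchange M X.2 q p := by
  rw [mem_excess, ← h.compatible.snd_sdiff] at hp
  rw [mem_excess, ← h.compatible.sdiff_snd] at hq
  exact SplitExchange.allowed_inside_iff h.ground h.pair.2 hp.1.2 hq.1.1
    (h.main.sameComponent p hp.2 q hq.2)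

lemma isStep_iff_allowed (h : Position M K B X) (hp : p ∈ excess K X.1 B.1)
    (hq : q ∈ excess K B.1 X.1) :
    IsStep M B X (p, q) ↔
      Allowed outside (cutSlack M X.1) p q ∧ Allowed inside (cutSlack M X.2) p q := by
  rw [h.allowed_outside_iff hp hq, h.allowed_inside_iff hp hq]
  exact ⟨fun hs => ⟨hs.fst, hs.snd⟩, fun hs =>
    ⟨(mem_excess.1 hp).1, (mem_excess.1 hq).1, hs.1, hs.2⟩⟩

lemma mem_main_iff (h : Position M K B X) (hs : IsStep M B X s) : s.1 ∈ K ↔ s.2 ∈ K :=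
  hs.fst.sameComponent h.pair.1 K h.main.isSeparator

lemma exists_isStep_of_notMem (h : Position M K B X) (hp : p ∈ X.1 \ B.1) (hpK : p ∉ K) :
    ∃ q ∉ K, IsStep M B X (p, q) := by
  have hcard := (isSeparator_component h.ground p).card_excess h.pair.1 h.target.1
  obtain ⟨q, hq⟩ := Finset.card_pos.1
    (hcard ▸ Finset.card_pos.2 ⟨p, mem_excess.2 ⟨hp, mem_component_self M p⟩⟩)
  obtain ⟨hq, hpq : SameComponent M p q⟩ := mem_excess.1 hq
  have hqK : q ∉ K := (hpq K h.main.isSeparator).not.1 hpK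
  have hp₂ : p ∈ B.2 \ X.2 := h.compatible.snd_sdiff ▸ hp
  have hq₂ : q ∈ X.2 \ B.2 := h.compatible.sdiff_snd ▸ hq
  refine ⟨q, hqK, hp, hq, ?_, ?_⟩ <;> by_contra hno
  · exact hpK (h.main.mem_of_not_isExchange h.ground h.pair.1 hp.1 hq.2 hpq hno)
  · exact hqK (h.main.mem_of_not_isExchange h.ground h.pair.2 hq₂.1 hp₂.2 hpq.symm hno)

lemma obstructedAt_swap (h : Position M K B X) (hs : IsStep M B X s)
    (ho : ObstructedAt M K B X d) : ObstructedAt M K B (swap X s) d := by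
  classical
  by_cases hpK : s.1 ∈ K
  · have hp : s.1 ∈ excess K X.1 B.1 := mem_excess.2 ⟨hs.left, hpK⟩
    have hq : s.2 ∈ excess K B.1 X.1 := mem_excess.2 ⟨hs.right, (h.mem_main_iff hs).1 hpK⟩
    obtain ⟨i₁, i₂, j₁, j₂, ho⟩ := ho
    exact hs.obstructedAt_swap_iff.2 ⟨i₁, i₂, j₁, j₂, ho.next hp hq
      ((h.allowed_outside_iff hp hq).2 hs.fst) ((h.allowed_inside_iff hp hq).2 hs.snd)⟩
  · exact (hs.obstructedAt_swap_iff_of_notMem h.main hpK ((h.mem_main_iff hs).not.1 hpK)).2 ho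

lemma two_mul_le (h : Position M K B X) (ho : ObstructedAt M K B X d) :
    2 * d ≤ (X.1 \ B.1).ncard := by
  classical
  obtain ⟨i₁, i₂, j₁, j₂, ho⟩ := ho
  calc
    2 * d ≤ (excess K X.1 B.1).card := ho.two_mul_le h.splitPair
    _ = ((X.1 \ B.1) ∩ K).ncard := card_excess K X.1 B.1
    _ ≤ (X.1 \ B.1).ncard := Set.ncard_le_ncard Set.inter_subset_left (Set.toFinite _)

lemma ncard_eq_two_mul (h : Position M K B X) (ho : ObstructedAt M K B X d)
    (hno : ∀ s, ¬ IsStep M B X s) : (X.1 \ B.1).ncard = 2 * d := by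
  classical
  obtain ⟨i₁, i₂, j₁, j₂, ho⟩ := ho
  have hsub : X.1 \ B.1 ⊆ K := by
    intro p hp
    by_contra hpK
    obtain ⟨q, -, hs⟩ := h.exists_isStep_of_notMem hp hpK
    exact hno _ hs
  rw [← Set.inter_eq_left.2 hsub, ← card_excess]
  exact ho.card_eq_of_stuck h.splitPair fun p hp q hq h₁ h₂ =>
    hno _ ((h.isStep_iff_allowed hp hq).2 ⟨h₁, h₂⟩)

lemma exists_isStep (h : Position M K B X) (hne : (X.1 \ B.1).Nonempty)
    (ho : ∀ d, ¬ ObstructedAt M K B X d) :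
    ∃ s, IsStep M B X s ∧ ∀ d, ¬ ObstructedAt M K B (swap X s) d := by
  classical
  by_cases hP : (excess K X.1 B.1).Nonempty
  · obtain ⟨p, hp, q, hq, h₁, h₂, hd⟩ := h.splitPair.exists_allowed_not_obstructed hP ho
    have hs := (h.isStep_iff_allowed hp hq).2 ⟨h₁, h₂⟩
    exact ⟨(p, q), hs, fun d => hs.obstructedAt_swap_iff.not.2 (hd d)⟩
  · obtain ⟨p, hp⟩ := hne
    have hpK : p ∉ K := fun hpK => hP ⟨p, mem_excess.2 ⟨hp, hpK⟩⟩
    obtain ⟨q, hqK, hs⟩ := h.exists_isStep_of_notMem hp hpK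
    exact ⟨(p, q), hs, fun d => (hs.obstructedAt_swap_iff_of_notMem h.main hpK hqK).not.2 (ho d)⟩

end Position

/-- A condition which says that some exchanges towards `B` will be impossible, and which an oracle
can check. -/
def IsBad [Finite α] (M : Matroid α) (B X : Set α × Set α) : Prop :=
  Pattern (excess Set.univ X.1 B.1) (excess Set.univ B.1 X.1) (IsExchange M X.1)
    (fun p q => IsExchange M X.2 q p)

lemma Position.isBad_iff [Fintype α] (h : Position M K B X) :
    IsBad M B X ↔ ∃ d, ObstructedAt M K B X d := by
  classical
  have hK : ∀ a b c d,
      Separates (excess Set.univ X.1 B.1) (excess Set.univ B.1 X.1) (IsExchange M X.1) a b c d →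
      Separates (excess Set.univ X.1 B.1) (excess Set.univ B.1 X.1)
        (fun p q => IsExchange M X.2 q p) a b d c → a ∈ K := by
    intro a b c d h₁ h₂
    have had : SameComponent M a d := (h₂.left.sameComponent h.pair.2).symm
    exact h.main.mem_of_not_isExchange h.ground h.pair.1 h₁.left.1 (mem_excess.1 h₁.memQ.2).1.2 had
      fun hex => h₁.notP a h₁.memP.1 ⟨h₁.left, hex⟩
  calc
    IsBad M B X ↔ Pattern (excess K X.1 B.1) (excess K B.1 X.1) (IsExchange M X.1)
        (fun p q => IsExchange M X.2 q p) := by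
      rw [IsBad, ← filter_excess_univ K, ← filter_excess_univ K]
      exact (pattern_filter_iff
        (fun p _ q _ hpq => hpq.sameComponent h.pair.1 K h.main.isSeparator)
        (fun p _ q _ hpq => (hpq.sameComponent h.pair.2 K h.main.isSeparator).symm) hK).symm
    _ ↔ Pattern (excess K X.1 B.1) (excess K B.1 X.1) (Allowed outside (cutSlack M X.1))
        (Allowed inside (cutSlack M X.2)) :=
      pattern_congr (fun p hp q hq => (h.allowed_outside_iff hp hq).symm)
        fun p hp q hq => (h.allowed_inside_iff hp hq).symm
    _ ↔ ∃ d, ObstructedAt M K B X d := h.splitPair.pattern_allowed_iff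

end Position

section Greedy

variable {α : Type*} {M : Matroid α} {X B : Set α × Set α} {K : Set α} {s : α × α}
  {l : List (α × α)} {d : ℕ}

/-- A sequence of exchanges that avoids bad pairs whenever it can and goes on as long as
possible. -/
inductive GreedyRun [Finite α] (M : Matroid α) (B : Set α × Set α) :
    Set α × Set α → List (α × α) → Prop where
  | stuck (X : Set α × Set α) (h : ∀ s, ¬ IsStep M B X s) : GreedyRun M B X []
  | step (X : Set α × Set α) (s : α × α) (l : List (α × α)) (hs : IsStep M B X s)
      (hbad : IsBad M B (swap X s) → ∀ s', IsStep M B X s' → IsBad M B (swap X s'))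
      (hl : GreedyRun M B (swap X s) l) : GreedyRun M B X (s :: l)

lemma GreedyRun.isStrictlyMonotone [Finite α] (hl : GreedyRun M B X l) :
    IsStrictlyMonotone M B X l := by
  induction hl with
  | stuck => trivial
  | step X s l hs _ _ ih => exact ⟨(isStep_iff.1 hs).1, (isStep_iff.1 hs).2, ih⟩

variable [Fintype α]

lemma Position.length_le (h : Position M K B X) (hl : IsStrictlyMonotone M B X l) :
    l.length ≤ (X.1 \ B.1).ncard := by
  induction l generalizing X with
  | nil => exact Nat.zero_le _
  | cons s l ih =>
    obtain ⟨hs, hlt, hl⟩ := hl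
    exact (ih (h.next (isStep_iff.2 ⟨hs, hlt⟩)) hl).trans_lt hlt

lemma Position.length_add_le (h : Position M K B X) (ho : ObstructedAt M K B X d)
    (hl : IsStrictlyMonotone M B X l) : l.length + 2 * d ≤ (X.1 \ B.1).ncard := by
  induction l generalizing X with
  | nil => simpa using h.two_mul_le ho
  | cons s l ih =>
    obtain ⟨hs, hlt, hl⟩ := hl
    have hstep : IsStep M B X s := isStep_iff.2 ⟨hs, hlt⟩
    have hle := ih (h.next hstep) (h.obstructedAt_swap hstep ho) hl
    rw [List.length_cons]
    omega

lemma GreedyRun.length_add_eq (hl : GreedyRun M B X l) (h : Position M K B X)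
    (ho : ObstructedAt M K B X d) : l.length + 2 * d = (X.1 \ B.1).ncard := by
  induction hl with
  | stuck X hno => simp [h.ncard_eq_two_mul ho hno]
  | step X s l hs _ _ ih =>
    have heq := ih (h.next hs) (h.obstructedAt_swap hs ho)
    rw [← hs.ncard_add_one, ← heq, List.length_cons, Nat.add_right_comm]

lemma Position.not_obstructedAt_swap (h : Position M K B X) (hs : IsStep M B X s)
    (hbad : IsBad M B (swap X s) → ∀ s', IsStep M B X s' → IsBad M B (swap X s'))
    (ho : ∀ d, ¬ ObstructedAt M K B X d) : ∀ d, ¬ ObstructedAt M K B (swap X s) d := by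
  obtain ⟨s', hs', hgood⟩ := h.exists_isStep ⟨_, hs.left⟩ ho
  rw [← not_exists, ← (h.next hs).isBad_iff]
  rw [← not_exists, ← (h.next hs').isBad_iff] at hgood
  exact fun hX => hgood (hbad hX s' hs')

lemma GreedyRun.length_eq (hl : GreedyRun M B X l) (h : Position M K B X)
    (ho : ∀ d, ¬ ObstructedAt M K B X d) : l.length = (X.1 \ B.1).ncard := by
  induction hl with
  | stuck X hno =>
    by_contra! hne
    obtain ⟨s, hs, -⟩ := h.exists_isStep (Set.nonempty_of_ncard_ne_zero hne.symm) ho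
    exact hno s hs
  | step X s l hs hbad _ ih =>
    have heq := ih (h.next hs) (h.not_obstructedAt_swap hs hbad ho)
    rw [← hs.ncard_add_one, ← heq, List.length_cons]

theorem GreedyRun.isLongest (hl : GreedyRun M B X l) (hE : M.E = Set.univ) (hM : IsSplit M)
    (hX : IsBasisPair M X) (hB : IsBasisPair M B) (hc : Compatible X B) :
    IsLongestStrictlyMonotone M X B l := by
  obtain ⟨K, hK⟩ := exists_isMainComponent hE hM
  have h : Position M K B X := ⟨hE, hM, hK, hX, hB, hc⟩
  refine ⟨hl.isStrictlyMonotone, fun l' hl' => ?_⟩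
  by_cases! ho : ∃ d, ObstructedAt M K B X d
  · obtain ⟨d, hd⟩ := ho
    have hle := h.length_add_le hd hl'
    rw [← hl.length_add_eq h hd] at hle
    exact Nat.le_of_add_le_add_right hle
  · exact (h.length_le hl').trans_eq (hl.length_eq h ho).symm

end Greedy

/-! ### Formulas -/

section Formulas

variable {n : ℕ} {indep : Set (Fin n) → Prop} {reg : ℕ → ℕ} {arr : ℕ → ℕ → ℕ}

/-- The reading of a term as a formula, which holds if the value of the term is not `0`. -/
def Term.Holds (indep : Set (Fin n) → Prop) (t : Term) (reg : ℕ → ℕ) (arr : ℕ → ℕ → ℕ) : Prop :=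
  t.den indep reg arr ≠ 0

/-- Conjunction. -/
def Term.and (t u : Term) : Term := .ite t u (.expr (.const 0))

/-- Negation. -/
def Term.not (t : Term) : Term := .ite t (.expr (.const 0)) (.expr (.const 1))

/-- The number of values below `n` of a register for which a formula holds. -/
def Term.count (v : ℕ) (t : Term) : Term := .sum v (.ite t (.expr (.const 1)) (.expr (.const 0)))

/-- The formula saying that two terms have different values. Subtraction is truncated, so it takes
both differences. -/
def Term.ne (t u : Term) : Term := .add (.sub t u) (.sub u t)

namespace Term

@[simp] lemma holds_expr (e : Expr) :
    (Term.expr e).Holds indep reg arr ↔ e.eval reg arr ≠ 0 := Iff.rfl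

@[simp] lemma holds_query (a : ℕ) :
    (Term.query a).Holds indep reg arr ↔ indep {i | arr a i ≠ 0} := by
  simp [Holds, den]

@[simp] lemma holds_update (a : ℕ) (i e : Expr) (t : Term) :
    (Term.update a i e t).Holds indep reg arr ↔ t.Holds indep reg
      (Function.update arr a (Function.update (arr a) (i.eval reg arr) (e.eval reg arr))) := Iff.rfl

@[simp] lemma holds_and (t u : Term) :
    (t.and u).Holds indep reg arr ↔ t.Holds indep reg arr ∧ u.Holds indep reg arr := by
  simp only [Holds, Term.and, den, Expr.eval_const]
  split_ifs <;> simp_all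

@[simp] lemma holds_not (t : Term) : t.not.Holds indep reg arr ↔ ¬ t.Holds indep reg arr := by
  simp only [Holds, Term.not, den, Expr.eval_const]
  split_ifs <;> simp_all

lemma holds_ne (t u : Term) :
    (t.ne u).Holds indep reg arr ↔ t.den indep reg arr ≠ u.den indep reg arr := by
  simp only [Holds, Term.ne, den]
  omega

lemma holds_sum (h : reg 0 = n) (v : ℕ) (t : Term) :
    (Term.sum v t).Holds indep reg arr ↔
      ∃ i : Fin n, t.Holds indep (Function.update reg v i) arr := by
  simp only [Holds, den, h, Finset.sum_range, ne_eq, Finset.sum_eq_zero_iff, Finset.mem_univ,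
    true_implies, not_forall]

open Classical in
lemma den_count (h : reg 0 = n) (v : ℕ) (t : Term) :
    (Term.count v t).den indep reg arr =
      (Finset.univ.filter fun i : Fin n => t.Holds indep (Function.update reg v i) arr).card := by
  rw [Finset.card_filter]
  simp only [count, den, h, Finset.sum_range, Holds, Expr.eval_const]
  exact Finset.sum_congr rfl fun _ _ => by congr

end Term

/-- The formula saying that the set in array `a` remains independent when the element in register
`x` is replaced by that in register `y`. -/
def exchangeTerm (a x y : ℕ) : Term :=
  .update a (.var x) (.const 0) (.update a (.var y) (.const 1) (.query a))

/-- The formula saying that the element in register `x` is in the set in array `a` but not in that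
in array `b`. -/
def memSdiffTerm (a b x : ℕ) : Term :=
  (Term.expr (.get a (.var x))).and (Term.expr (.get b (.var x))).not

/-- The formula for `Separates`, where `e` is the formula for the relation. The current pair of
bases is in arrays `0` and `1`, and the first target in array `2`. Existential quantifiers are
sums. -/
def separatesTerm (e : ℕ → ℕ → Term) (x y z w : ℕ) : Term :=
  (memSdiffTerm 0 2 x).and <| (memSdiffTerm 0 2 y).and <|
  (memSdiffTerm 2 0 z).and <| (memSdiffTerm 2 0 w).and <|
  (e x z).and <| (e y w).and <|
  (Term.sum 12 ((memSdiffTerm 0 2 12).and ((e 12 z).and (e 12 w)))).not.and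
  (Term.sum 12 ((memSdiffTerm 2 0 12).and ((e x 12).and (e y 12)))).not

/-- The formula for `IsBad`; the four elements of the pattern are in registers `8` to `11`. -/
def badTerm : Term :=
  .sum 8 <| .sum 9 <| .sum 10 <| .sum 11 <|
  (separatesTerm (exchangeTerm 0) 8 9 10 11).and <|
  (separatesTerm (fun x y => exchangeTerm 1 y x) 8 9 11 10).and <|
  (Term.count 12 ((memSdiffTerm 0 2 12).and ((exchangeTerm 0 12 10).and (exchangeTerm 1 11 12)))).ne
    (Term.count 12 ((memSdiffTerm 2 0 12).and ((exchangeTerm 0 8 12).and (exchangeTerm 1 12 8))))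

/-- The formula for `IsStep`, for the exchange in registers `5` and `6`. -/
def stepTerm : Term :=
  (memSdiffTerm 0 2 5).and <| (memSdiffTerm 2 0 6).and <|
  (exchangeTerm 0 5 6).and (exchangeTerm 1 6 5)

/-- The formula saying that the exchange in registers `5` and `6` leads to a bad pair. -/
def badAfterTerm : Term :=
  .update 0 (.var 5) (.const 0) <| .update 0 (.var 6) (.const 1) <|
  .update 1 (.var 6) (.const 0) <| .update 1 (.var 5) (.const 1) badTerm

/-- The term for `score`, for the exchange in registers `5` and `6`. -/
def scoreTerm : Term :=
  .ite stepTerm (.ite badAfterTerm (.expr (.const 1)) (.expr (.const 2))) (.expr (.const 0))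

/-- The nonzero entries of `f` below `n` are the elements of `Y`. -/
def IsCharVec (f : ℕ → ℕ) (Y : Set (Fin n)) : Prop := ∀ i : Fin n, f i ≠ 0 ↔ i ∈ Y

/-- The vector `f` after the replacement of the element `x` by `y`. -/
def exchangeVec (f : ℕ → ℕ) (x y : ℕ) : ℕ → ℕ := Function.update (Function.update f x 0) y 1

variable {f : ℕ → ℕ} {Y D : Set (Fin n)} {a b x y z w : ℕ} {p q r s : Fin n}

lemma isCharVec_charVec (Y : Set (Fin n)) : IsCharVec (charVec Y) Y := fun i => by simp [charVec]

lemma IsCharVec.exchange (hf : IsCharVec f Y) (p q : Fin n) :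
    IsCharVec (exchangeVec f p q) (insert q (Y \ {p})) := by
  intro i
  have hi := hf i
  simp only [exchangeVec, Function.update_apply, Fin.val_inj, Set.mem_insert_iff, Set.mem_sdiff,
    Set.mem_singleton_iff]
  split_ifs <;> simp_all

lemma holds_exchangeTerm_iff (hY : IsCharVec (arr a) Y) (hp : reg x = p) (hq : reg y = q) :
    (exchangeTerm a x y).Holds indep reg arr ↔ indep (insert q (Y \ {p})) := by
  have hset : {i : Fin n | exchangeVec (arr a) p q i ≠ 0} = insert q (Y \ {p}) :=
    Set.ext (hY.exchange p q)
  simp [← hset, exchangeTerm, exchangeVec, hp, hq]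

lemma holds_memSdiffTerm_iff (hY : IsCharVec (arr a) Y) (hD : IsCharVec (arr b) D)
    (hp : reg x = p) : (memSdiffTerm a b x).Holds indep reg arr ↔ p ∈ Y \ D := by
  rw [Set.mem_sdiff, ← hY, ← hD]
  simp [memSdiffTerm, hp]

lemma holds_memSdiffTerm_iff_mem_excess (hY : IsCharVec (arr a) Y) (hD : IsCharVec (arr b) D)
    (hp : reg x = p) :
    (memSdiffTerm a b x).Holds indep reg arr ↔ p ∈ excess Set.univ Y D := by
  rw [holds_memSdiffTerm_iff hY hD hp, mem_excess, and_iff_left (Set.mem_univ p)]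

lemma holds_separatesTerm_iff {e : ℕ → ℕ → Term} {R : Fin n → Fin n → Prop} (h0 : reg 0 = n)
    (hY : IsCharVec (arr 0) Y) (hD : IsCharVec (arr 2) D)
    (he : ∀ {reg : ℕ → ℕ} {x y} {p q : Fin n}, reg x = p → reg y = q →
      ((e x y).Holds indep reg arr ↔ R p q))
    (hx : reg x = p) (hy : reg y = q) (hz : reg z = r) (hw : reg w = s)
    (hx' : x ≠ 12) (hy' : y ≠ 12) (hz' : z ≠ 12) (hw' : w ≠ 12) :
    (separatesTerm e x y z w).Holds indep reg arr ↔
      Separates (excess Set.univ Y D) (excess Set.univ D Y) R p q r s := by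
  have keep : ∀ {v : ℕ} {p : Fin n} (i : Fin n), v ≠ 12 → reg v = p →
      Function.update reg 12 (i : ℕ) v = p := fun i hv hp => by
    rw [Function.update_of_ne hv, hp]
  have bound : ∀ i : Fin n, Function.update reg 12 (i : ℕ) 12 = i := fun i =>
    Function.update_self _ _ _
  have hP {reg : ℕ → ℕ} {x} {p : Fin n} (hp : reg x = p) :=
    holds_memSdiffTerm_iff_mem_excess (indep := indep) hY hD hp
  have hQ {reg : ℕ → ℕ} {x} {p : Fin n} (hp : reg x = p) :=
    holds_memSdiffTerm_iff_mem_excess (indep := indep) hD hY hp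
  simp only [separatesTerm, Term.holds_and, Term.holds_not, Term.holds_sum h0, hP hx, hP hy, hQ hz,
    hQ hw, he hx hz, he hy hw, hP (bound _), hQ (bound _), he (bound _) (keep _ hz' hz),
    he (bound _) (keep _ hw' hw), he (keep _ hx' hx) (bound _), he (keep _ hy' hy) (bound _)]
  constructor
  · rintro ⟨hp, hq, hr, hs, left, right, notP, notQ⟩
    exact ⟨⟨hp, hq⟩, ⟨hr, hs⟩, left, right, fun p hp h => notP ⟨p, hp, h⟩,
      fun q hq h => notQ ⟨q, hq, h⟩⟩
  · rintro ⟨⟨hp, hq⟩, ⟨hr, hs⟩, left, right, notP, notQ⟩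
    exact ⟨hp, hq, hr, hs, left, right, fun ⟨p, hp, h⟩ => notP p hp h, fun ⟨q, hq, h⟩ =>
      notQ q hq h⟩

variable {M : Matroid (Fin n)} {B X : Set (Fin n) × Set (Fin n)} {e : Fin n × Fin n}

/-- The memory contains `n` and the pair `X` of bases on its way to the compatible pair `B`. -/
structure Encodes (M : Matroid (Fin n)) (B X : Set (Fin n) × Set (Fin n)) (reg : ℕ → ℕ)
    (arr : ℕ → ℕ → ℕ) : Prop where
  size : reg 0 = n
  fst : IsCharVec (arr 0) X.1
  snd : IsCharVec (arr 1) X.2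
  target : IsCharVec (arr 2) B.1
  pair : IsBasisPair M X
  compatible : Compatible X B

lemma indep_iff_isExchange (hY : M.IsBase Y) (hp : p ∈ Y) (hq : q ∉ Y) :
    M.Indep (insert q (Y \ {p})) ↔ IsExchange M Y p q :=
  ⟨fun hi => ⟨hp, hq, hY.exchange_isBase_of_indep hq hi⟩, fun hx => hx.2.2.indep⟩

namespace Encodes

lemma indep_fst_iff (h : Encodes M B X reg arr) (hp : p ∈ X.1 \ B.1) (hq : q ∈ B.1 \ X.1) :
    M.Indep (insert q (X.1 \ {p})) ↔ IsExchange M X.1 p q :=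
  indep_iff_isExchange h.pair.1 hp.1 hq.2

lemma indep_snd_iff (h : Encodes M B X reg arr) (hp : p ∈ X.1 \ B.1) (hq : q ∈ B.1 \ X.1) :
    M.Indep (insert p (X.2 \ {q})) ↔ IsExchange M X.2 q p := by
  rw [← h.compatible.snd_sdiff] at hp
  rw [← h.compatible.sdiff_snd] at hq
  exact indep_iff_isExchange h.pair.2 hq.1 hp.2

lemma next (h : Encodes M B X reg arr) (hs : IsStep M B X e) :
    Encodes M B (swap X e) reg (Function.update (Function.update arr 0
      (exchangeVec (arr 0) e.1 e.2)) 1 (exchangeVec (arr 1) e.2 e.1)) where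
  size := h.size
  fst := h.fst.exchange e.1 e.2
  snd := h.snd.exchange e.2 e.1
  target := h.target
  pair := hs.isBasisPair
  compatible := hs.compatible h.compatible

lemma holds_stepTerm_iff (h : Encodes M B X reg arr) (hp : reg 5 = e.1) (hq : reg 6 = e.2) :
    stepTerm.Holds M.Indep reg arr ↔ IsStep M B X e := by
  simp only [stepTerm, Term.holds_and, holds_memSdiffTerm_iff h.fst h.target hp,
    holds_memSdiffTerm_iff h.target h.fst hq, holds_exchangeTerm_iff h.fst hp hq,
    holds_exchangeTerm_iff h.snd hq hp]
  constructor
  · rintro ⟨left, right, fst, snd⟩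
    exact ⟨left, right, (h.indep_fst_iff left right).1 fst, (h.indep_snd_iff left right).1 snd⟩
  · rintro ⟨left, right, fst, snd⟩
    exact ⟨left, right, (h.indep_fst_iff left right).2 fst, (h.indep_snd_iff left right).2 snd⟩

lemma holds_badTerm_iff_pattern (h : Encodes M B X reg arr) :
    badTerm.Holds M.Indep reg arr ↔
      Pattern (excess Set.univ X.1 B.1) (excess Set.univ B.1 X.1)
        (fun p q => M.Indep (insert q (X.1 \ {p})))
        (fun p q => M.Indep (insert p (X.2 \ {q}))) := by
  classical
  have size : ∀ a b c d : ℕ, Function.update (Function.update (Function.update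
      (Function.update reg 8 a) 9 b) 10 c) 11 d 0 = n := fun _ _ _ _ => by simp [h.size]
  refine (Term.holds_sum h.size _ _).trans (exists_congr fun a => ?_)
  refine (Term.holds_sum (by simp [h.size]) _ _).trans (exists_congr fun b => ?_)
  refine (Term.holds_sum (by simp [h.size]) _ _).trans (exists_congr fun c => ?_)
  refine (Term.holds_sum (by simp [h.size]) _ _).trans (exists_congr fun d => ?_)
  rw [Term.holds_and, Term.holds_and, Term.holds_ne, Term.den_count (size a b c d),
    Term.den_count (size a b c d)]
  refine and_congr ?_ (and_congr ?_ (not_congr (Eq.congr (congrArg _ ?_) (congrArg _ ?_))))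
  · apply holds_separatesTerm_iff (size a b c d) h.fst h.target
      (holds_exchangeTerm_iff h.fst) <;> simp
  · apply holds_separatesTerm_iff (size a b c d) h.fst h.target
      (fun hp hq => holds_exchangeTerm_iff h.snd hq hp) <;> simp
  · ext p
    rw [Finset.mem_filter, Finset.mem_filter, Term.holds_and, Term.holds_and,
      holds_memSdiffTerm_iff_mem_excess (p := p) h.fst h.target (by simp),
      holds_exchangeTerm_iff (p := p) (q := c) h.fst (by simp) (by simp),
      holds_exchangeTerm_iff (p := d) (q := p) h.snd (by simp) (by simp)]
    simp only [Finset.mem_univ, true_and]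
  · ext q
    rw [Finset.mem_filter, Finset.mem_filter, Term.holds_and, Term.holds_and,
      holds_memSdiffTerm_iff_mem_excess (p := q) h.target h.fst (by simp),
      holds_exchangeTerm_iff (p := a) (q := q) h.fst (by simp) (by simp),
      holds_exchangeTerm_iff (p := q) (q := a) h.snd (by simp) (by simp)]
    simp only [Finset.mem_univ, true_and]

lemma holds_badTerm_iff (h : Encodes M B X reg arr) :
    badTerm.Holds M.Indep reg arr ↔ IsBad M B X :=
  h.holds_badTerm_iff_pattern.trans (pattern_congr
    (fun _ hp _ hq => h.indep_fst_iff (mem_excess.1 hp).1 (mem_excess.1 hq).1)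
    fun _ hp _ hq => h.indep_snd_iff (mem_excess.1 hp).1 (mem_excess.1 hq).1)

lemma holds_badAfterTerm_iff (h : Encodes M B X reg arr) (hp : reg 5 = e.1) (hq : reg 6 = e.2)
    (hs : IsStep M B X e) : badAfterTerm.Holds M.Indep reg arr ↔ IsBad M B (swap X e) := by
  rw [← (h.next hs).holds_badTerm_iff]
  simp [badAfterTerm, exchangeVec, hp, hq]

end Encodes

open Classical in
/-- The value of an exchange: `2` if it leads to a pair that is not bad, `1` if it leads to a bad
pair, and `0` if it is not an exchange towards `B`. -/
noncomputable def score (M : Matroid (Fin n)) (B X : Set (Fin n) × Set (Fin n))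
    (e : Fin n × Fin n) : ℕ :=
  if IsStep M B X e then if IsBad M B (swap X e) then 1 else 2 else 0

lemma score_ne_zero_iff : score M B X e ≠ 0 ↔ IsStep M B X e := by
  unfold score
  split_ifs with h <;> simp [h]

lemma Encodes.den_scoreTerm (h : Encodes M B X reg arr) (hp : reg 5 = e.1) (hq : reg 6 = e.2) :
    scoreTerm.den M.Indep reg arr = score M B X e := by
  classical
  rw [scoreTerm, Term.den, score]
  refine if_ctx_congr (h.holds_stepTerm_iff hp hq) (fun hs => ?_) fun _ => rfl
  rw [Term.den]
  exact if_ctx_congr (h.holds_badAfterTerm_iff hp hq hs) (fun _ => rfl) fun _ => rfl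

end Formulas

/-! ### The greedy algorithm -/

section Algorithm

/-- Evaluates the exchange in registers `5` and `6`, and keeps its value in register `2` and the
exchange in registers `3` and `4` if it is the best so far. -/
def tryExchange : Program :=
  .seq (scoreTerm.compile 20) <| .ite (.sub (.var 20) (.var 2))
    (.seq (.assign 2 (.var 20)) (.seq (.assign 3 (.var 5)) (.assign 4 (.var 6)))) .skip

/-- Finds an exchange of largest value. -/
def search : Program :=
  .seq (.assign 2 (.const 0)) (.loop 5 (.var 0) (.loop 6 (.var 0) tryExchange))

/-- Performs the exchange in registers `3` and `4` and appends it to the output. -/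
def perform : Program :=
  .seq (.store 0 (.var 3) (.const 0)) <| .seq (.store 0 (.var 4) (.const 1)) <|
  .seq (.store 1 (.var 4) (.const 0)) <| .seq (.store 1 (.var 3) (.const 1)) <|
  .seq (.store 4 (.var 1) (.var 3)) <| .seq (.store 5 (.var 1) (.var 4)) <|
  .assign 1 (.add (.var 1) (.const 1))

/-- Performs an exchange of largest value, if there is any. -/
def round : Program := .seq search (.ite (.var 2) perform .skip)

/-- The algorithm: as many rounds as the ground set has elements, which is enough to get stuck. -/
def greedy : Program := .loop 7 (.var 0) round

lemma greedy_tame : greedy.Tame := by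
  have hscore : scoreTerm.Tame := by
    simp [scoreTerm, stepTerm, badAfterTerm, badTerm, separatesTerm, memSdiffTerm, exchangeTerm,
      Term.Tame, Term.and, Term.not, Term.ne, Term.count]
  simp [greedy, round, search, tryExchange, perform, Program.Tame, hscore.compile]

lemma bound_scoreTerm : scoreTerm.bound ≤ 20 := by
  simp [scoreTerm, stepTerm, badAfterTerm, badTerm, separatesTerm, memSdiffTerm, exchangeTerm,
    Term.bound, Expr.bound, Term.and, Term.not, Term.ne, Term.count]

variable {n : ℕ} {indep : Set (Fin n) → Prop} {M : Matroid (Fin n)}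
  {A B X : Set (Fin n) × Set (Fin n)} {V V' : Set (Fin n × Fin n)} {l : List (Fin n × Fin n)}
  {e : Fin n × Fin n} {s s' s₀ : Config}

lemma exec_tryExchange (s : Config) :
    let t := scoreTerm.den indep s.reg s.arr
    let s' := tryExchange.exec indep s
    s'.arr = s.arr ∧ (∀ v < 20, v ≠ 2 → v ≠ 3 → v ≠ 4 → s'.reg v = s.reg v) ∧
      if s.reg 2 < t then s'.reg 2 = t ∧ s'.reg 3 = s.reg 5 ∧ s'.reg 4 = s.reg 6
      else s'.reg 2 = s.reg 2 ∧ s'.reg 3 = s.reg 3 ∧ s'.reg 4 = s.reg 4 := by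
  obtain ⟨val, frame, arr⟩ := scoreTerm.computes_compile (indep := indep) bound_scoreTerm s
  simp only [tryExchange, exec_seq, exec_ite, tick_reg, tick_arr, Expr.eval_sub, Expr.eval_var, val,
    frame 2 (by norm_num), ← Nat.pos_iff_ne_zero, Nat.sub_pos_iff_lt]
  split_ifs
  · simp +contextual [arr, val, frame]
  · simp +contextual [Program.exec, arr, frame]

/-- The state `s` of a search that began in the state `s₀`, after the exchanges in `V` have been
tried. -/
structure Searching (M : Matroid (Fin n)) (B X : Set (Fin n) × Set (Fin n)) (s₀ : Config)
    (V : Set (Fin n × Fin n)) (s : Config) : Prop where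
  reg_eq : ∀ v < 2, s.reg v = s₀.reg v
  arr_eq : s.arr = s₀.arr
  le : ∀ e ∈ V, score M B X e ≤ s.reg 2
  best : s.reg 2 ≠ 0 → ∃ e : Fin n × Fin n,
    s.reg 3 = e.1 ∧ s.reg 4 = e.2 ∧ s.reg 2 = score M B X e

namespace Searching

lemma congr (h : Searching M B X s₀ V s) (hr : ∀ v < 5, s'.reg v = s.reg v) (ha : s'.arr = s.arr)
    (hV : V' ⊆ V) : Searching M B X s₀ V' s' where
  reg_eq v hv := (hr v (by omega)).trans (h.reg_eq v hv)
  arr_eq := ha.trans h.arr_eq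
  le e he := by rw [hr 2 (by norm_num)]; exact h.le e (hV he)
  best := by
    rw [hr 2 (by norm_num), hr 3 (by norm_num), hr 4 (by norm_num)]
    exact h.best

lemma tryExchange (h : Searching M B X s₀ V s) (h₀ : Encodes M B X s₀.reg s₀.arr)
    (hp : s.reg 5 = e.1) (hq : s.reg 6 = e.2) :
    Searching M B X s₀ (insert e V) (tryExchange.exec M.Indep s) := by
  have hs : Encodes M B X s.reg s.arr := by
    rw [h.arr_eq]
    exact { h₀ with size := (h.reg_eq 0 (by norm_num)).trans h₀.size }
  obtain ⟨arr, frame, best⟩ := exec_tryExchange (indep := M.Indep) s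
  rw [hs.den_scoreTerm hp hq] at best
  have reg_eq : ∀ v < 2, ((SplitExchange.tryExchange).exec M.Indep s).reg v = s₀.reg v :=
    fun v hv => (frame v (by omega) (by omega) (by omega) (by omega)).trans (h.reg_eq v hv)
  split_ifs at best with hlt
  · obtain ⟨val, fst, snd⟩ := best
    refine ⟨reg_eq, arr.trans h.arr_eq, fun e' he' => ?_, fun _ =>
      ⟨e, fst.trans hp, snd.trans hq, val⟩⟩
    rw [val]
    rcases he' with rfl | he'
    · exact le_rfl
    · exact (h.le e' he').trans hlt.le
  · obtain ⟨val, fst, snd⟩ := best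
    refine ⟨reg_eq, arr.trans h.arr_eq, fun e' he' => ?_, ?_⟩
    · rw [val]
      rcases he' with rfl | he'
      · exact not_lt.1 hlt
      · exact h.le e' he'
    · rw [val, fst, snd]
      exact h.best

lemma row (h : Searching M B X s₀ V s) (h₀ : Encodes M B X s₀.reg s₀.arr) {p : Fin n}
    (hp : s.reg 5 = p) :
    Searching M B X s₀ (V ∪ {e | e.1 = p})
      ((Program.loop 6 (.var 0) SplitExchange.tryExchange).exec M.Indep s) := by
  have size : (Expr.var 0).eval s.reg s.arr = n := (h.reg_eq 0 (by norm_num)).trans h₀.size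
  have hrow := exec_loop_induction M.Indep (v := 6) (e := .var 0)
    (c := SplitExchange.tryExchange) (s := s) (fun k t => t.reg 5 = p ∧
      Searching M B X s₀ (V ∪ {e | e.1 = p ∧ (e.2 : ℕ) < k}) t) ?_ ?_
  · exact hrow.2.congr (fun _ _ => rfl) rfl
      (Set.union_subset_union_right _ fun e he => ⟨he, size ▸ e.2.2⟩)
  · exact ⟨hp, h.congr (fun _ _ => rfl) rfl (by simp)⟩
  · rintro k t hk ⟨htp, ht⟩
    rw [size] at hk
    have ht' : Searching M B X s₀ (V ∪ {e | e.1 = p ∧ (e.2 : ℕ) < k}) ((t.setReg 6 k).tick 1) :=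
      ht.congr (fun v hv => by simp [show v ≠ 6 by omega]) rfl subset_rfl
    refine ⟨?_, (ht'.tryExchange h₀ (e := (p, ⟨k, hk⟩)) (by simp [htp]) (by simp)).congr
      (fun _ _ => rfl) rfl ?_⟩
    · have frame := (exec_tryExchange (indep := M.Indep) ((t.setReg 6 k).tick 1)).2.1
      rw [frame 5 (by norm_num) (by norm_num) (by norm_num) (by norm_num)]
      simp [htp]
    · rintro ⟨p', q⟩ (he | ⟨rfl, hq⟩)
      · exact .inr (.inl he)
      · rcases Nat.lt_succ_iff_lt_or_eq.1 hq with hq | hq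
        · exact .inr (.inr ⟨rfl, hq⟩)
        · exact .inl (Prod.ext rfl (Fin.ext hq))

end Searching

lemma searching_search (h : Encodes M B X s.reg s.arr) :
    Searching M B X s Set.univ (search.exec M.Indep s) := by
  have start : Searching M B X s ∅ (((Program.assign 2 (.const 0)).exec M.Indep s).tick 1) :=
    ⟨fun v hv => by simp [hv.ne], rfl, fun e he => he.elim, fun hne => (hne (by simp)).elim⟩
  rw [search, exec_seq]
  generalize ((Program.assign 2 (.const 0)).exec M.Indep s).tick 1 = s₁ at start ⊢
  have size : (Expr.var 0).eval s₁.reg s₁.arr = n :=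
    (start.reg_eq 0 (by norm_num)).trans h.size
  have hsearch := exec_loop_induction M.Indep (v := 5) (e := .var 0)
    (c := .loop 6 (.var 0) tryExchange) (s := s₁)
    (fun k t => Searching M B X s {e | (e.1 : ℕ) < k} t) ?_ ?_
  · exact hsearch.congr (fun _ _ => rfl) rfl fun e _ => size ▸ e.1.2
  · exact start.congr (fun _ _ => rfl) rfl fun e he => absurd he (Nat.not_lt_zero _)
  · intro k t hk ht
    rw [size] at hk
    have ht' : Searching M B X s {e | (e.1 : ℕ) < k} ((t.setReg 5 k).tick 1) :=
      ht.congr (fun v hv => by simp [show v ≠ 5 by omega]) rfl subset_rfl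
    refine (ht'.row h (p := ⟨k, hk⟩) (by simp)).congr (fun _ _ => rfl) rfl fun e he => ?_
    exact (Nat.lt_succ_iff_lt_or_eq.1 he).imp_right Fin.ext

lemma not_isStep_of_search (h : Encodes M B X s.reg s.arr)
    (h0 : (search.exec M.Indep s).reg 2 = 0) (e : Fin n × Fin n) : ¬ IsStep M B X e := by
  rw [← score_ne_zero_iff, not_not, ← Nat.le_zero, ← h0]
  exact (searching_search h).le e (Set.mem_univ e)

lemma exists_isStep_of_search (h : Encodes M B X s.reg s.arr)
    (h0 : (search.exec M.Indep s).reg 2 ≠ 0) :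
    ∃ e : Fin n × Fin n, (search.exec M.Indep s).reg 3 = e.1 ∧
      (search.exec M.Indep s).reg 4 = e.2 ∧ IsStep M B X e ∧
      (IsBad M B (swap X e) → ∀ e', IsStep M B X e' → IsBad M B (swap X e')) := by
  obtain ⟨e, fst, snd, val⟩ := (searching_search h).best h0
  have he : IsStep M B X e := score_ne_zero_iff.1 (val ▸ h0)
  refine ⟨e, fst, snd, he, fun hbad e' he' => ?_⟩
  by_contra hbad'
  have hle := (searching_search h).le e' (Set.mem_univ e')
  simp [val, score, he, hbad, he', hbad'] at hle

lemma exec_perform (s : Config) :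
    (perform.exec indep s).reg = Function.update s.reg 1 (s.reg 1 + 1) ∧
    (perform.exec indep s).arr 0 = exchangeVec (s.arr 0) (s.reg 3) (s.reg 4) ∧
    (perform.exec indep s).arr 1 = exchangeVec (s.arr 1) (s.reg 4) (s.reg 3) ∧
    (perform.exec indep s).arr 2 = s.arr 2 ∧
    (perform.exec indep s).arr 4 = Function.update (s.arr 4) (s.reg 1) (s.reg 3) ∧
    (perform.exec indep s).arr 5 = Function.update (s.arr 5) (s.reg 1) (s.reg 4) := by
  simp [perform, exchangeVec]

/-- The state of the algorithm between two rounds: `X` is the current pair, and `l` is the list of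
the exchanges that lead from `A` to `X`. -/
structure Between (M : Matroid (Fin n)) (B A X : Set (Fin n) × Set (Fin n))
    (l : List (Fin n × Fin n)) (s : Config) : Prop where
  encodes : Encodes M B X s.reg s.arr
  output : s.Outputs l
  run : ∀ l', GreedyRun M B X l' → GreedyRun M B A (l ++ l')

namespace Between

lemma start (hA : IsBasisPair M A) (hc : Compatible A B) :
    Between M B A A [] (startConfig A B) where
  encodes := ⟨rfl, isCharVec_charVec _, isCharVec_charVec _, isCharVec_charVec _, hA, hc⟩
  output := ⟨rfl, fun i hi => absurd hi (Nat.not_lt_zero i)⟩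
  run _ hl := hl

lemma congr (h : Between M B A X l s) (hr : ∀ v < 2, s'.reg v = s.reg v) (ha : s'.arr = s.arr) :
    Between M B A X l s' where
  encodes := by
    rw [ha]
    exact { h.encodes with size := (hr 0 (by norm_num)).trans h.encodes.size }
  output := by
    rw [Config.Outputs, hr 1 (by norm_num), ha]
    exact h.output
  run := h.run

lemma perform (h : Between M B A X l s) (he : IsStep M B X e)
    (hbad : IsBad M B (swap X e) → ∀ e', IsStep M B X e' → IsBad M B (swap X e'))
    (hp : s.reg 3 = e.1) (hq : s.reg 4 = e.2) :
    Between M B A (swap X e) (l ++ [e]) (perform.exec M.Indep s) := by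
  obtain ⟨reg, arr_fst, arr_snd, arr_target, arr_left, arr_right⟩ :=
    exec_perform (indep := M.Indep) s
  rw [hp, hq] at arr_fst arr_snd
  refine ⟨⟨?_, ?_, ?_, ?_, he.isBasisPair, he.compatible h.encodes.compatible⟩,
    ⟨?_, fun i hi => ?_⟩, fun l' hl' => ?_⟩
  · simp [reg, h.encodes.size]
  · exact arr_fst ▸ h.encodes.fst.exchange e.1 e.2
  · exact arr_snd ▸ h.encodes.snd.exchange e.2 e.1
  · exact arr_target ▸ h.encodes.target
  · simp [reg, h.output.1]
  · rw [arr_left, arr_right, hp, hq, h.output.1]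
    rw [List.length_append, List.length_singleton] at hi
    rcases Nat.lt_succ_iff_lt_or_eq.1 hi with hi | rfl
    · simpa [hi.ne, List.getElem_append_left hi] using h.output.2 i hi
    · simp
  · rw [List.append_assoc]
    exact h.run _ (.step X e l' he hbad hl')

lemma round (h : Between M B A X l s) :
    (∀ e, ¬ IsStep M B X e) ∧ Between M B A X l (round.exec M.Indep s) ∨
      ∃ e, IsStep M B X e ∧ Between M B A (swap X e) (l ++ [e]) (round.exec M.Indep s) := by
  have hs := searching_search h.encodes
  have hstuck := not_isStep_of_search h.encodes
  have hstep := exists_isStep_of_search h.encodes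
  rw [SplitExchange.round, exec_seq, exec_ite]
  generalize search.exec M.Indep s = r at hs hstuck hstep ⊢
  have h' : Between M B A X l ((r.tick 1).tick ((Expr.var 2).cost + 1)) :=
    h.congr hs.reg_eq hs.arr_eq
  split_ifs with h0
  · obtain ⟨e, hp, hq, he, hbad⟩ := hstep h0
    exact .inr ⟨e, he, h'.perform he hbad hp hq⟩
  · exact .inl ⟨hstuck (not_not.1 h0), h'.congr (fun _ _ => rfl) rfl⟩

end Between

theorem exec_greedy (hA : IsBasisPair M A) (hc : Compatible A B) :
    ∃ l, (greedy.exec M.Indep (startConfig A B)).Outputs l ∧ GreedyRun M B A l := by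
  have hgreedy := exec_loop_induction M.Indep (v := 7) (e := .var 0) (c := round)
    (s := startConfig A B) (fun k s => ∃ X l, Between M B A X l s ∧
      ((∀ e, ¬ IsStep M B X e) ∨ (X.1 \ B.1).ncard + k ≤ n)) ?_ ?_
  · obtain ⟨X, l, h, hX⟩ := hgreedy
    have hstuck : ∀ e, ¬ IsStep M B X e := by
      rcases hX with hX | (hX : (X.1 \ B.1).ncard + n ≤ n)
      · exact hX
      · intro e he
        rw [← he.ncard_add_one] at hX
        omega
    exact ⟨l, h.output, l.append_nil ▸ h.run [] (.stuck X hstuck)⟩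
  · refine ⟨A, [], (Between.start hA hc).congr (fun _ _ => rfl) rfl, .inr ?_⟩
    simpa using Set.ncard_le_card (A.1 \ B.1)
  · rintro k s - ⟨X, l, h, hX⟩
    have h' : Between M B A X l ((s.setReg 7 k).tick 1) :=
      h.congr (fun v hv => by simp [show v ≠ 7 by omega]) rfl
    rcases h'.round with ⟨hstuck, h'⟩ | ⟨e, he, h'⟩
    · exact ⟨X, l, h', .inl hstuck⟩
    · refine ⟨swap X e, l ++ [e], h', .inr ?_⟩
      have hcard := he.ncard_add_one
      rcases hX with hX | hX
      · exact absurd he (hX e)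
      · omega

end Algorithm

end SplitExchange

open SplitExchange in
theorem theorem4p1 :
    ∃ (algorithm : Program) (p : Polynomial ℕ),
      ∀ (n : ℕ) (M : Matroid (Fin n)), M.E = Set.univ → IsSplit M →
        ∀ A B : Set (Fin n) × Set (Fin n), IsBasisPair M A → IsBasisPair M B → Compatible A B →
          (algorithm.exec M.Indep (startConfig A B)).calls ≤ p.eval n ∧
          (algorithm.exec M.Indep (startConfig A B)).steps ≤ p.eval n ∧
          ∃ l : List (Fin n × Fin n),
            (algorithm.exec M.Indep (startConfig A B)).Outputs l ∧
              IsLongestStrictlyMonotone M A B l := by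
  refine ⟨greedy, greedy.time, fun n M hE hM A B hA hB hc => ?_⟩
  obtain ⟨-, calls, steps⟩ := greedy_tame.exec_le M.Indep (startConfig A B)
  obtain ⟨l, hl, hrun⟩ := exec_greedy hA hc
  exact ⟨by simpa [startConfig] using calls, by simpa [startConfig] using steps, l, hl,
    hrun.isLongest hE hM hA hB hc⟩
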